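/- Everything is real and of class $C^\infty$. Let $d\ge 3$ and let a planar $d$-web be given on an open set $U\subset\mathbb R^2$ by $d$ differential $1$-forms that are pairwise linearly independent at every point of $U$. The *abelian equation* of a web given by forms $\omega_1,\dots,\omega_d$ is the system $\lambda_1\omega_1+\dots+\lambda_d\omega_d=0$, $d(\lambda_1\omega_1)=\dots=d(\lambda_d\omega_d)=0$ for functions $\lambda_1,\dots,\lambda_d$, and the *rank* of the web at $p\in U$ is the dimension of the space of germs at $p$ of its solutions (it does not change when the forms are multiplied by nonvanishing functions). The web is *of maximum rank* if its rank is $(d-1)(d-2)/2$ at every point of $U$. The forms can be multiplied by nonvanishing functions so that $a_i\omega_1+\omega_2+\omega_{i+2}=0$ for $i=1,\dots,d-2$, with functions $a_i$ and $a_1=1$. Fix any such normalization. Let $\partial_1,\partial_2$ be the frame dual to $\omega_1,\omega_2$, let $\gamma=g_1\omega_1+g_2\omega_2$ be the form with $d\omega_i=\omega_i\wedge\gamma$ for $i=1,2,3$, and on functions of weight $k$ put $\delta_jf=\partial_jf-kg_jf$ ($j=1,2$) and $\Delta_if=\delta_1f-\delta_2(a_if)$; these operators raise the weight by one. In terms of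 the functions $u_i=\lambda_{i+2}$, $i=1,\dots,d-2$, of weight one, the abelian equation is the system $$\Delta_1u_1=\dots=\Delta_{d-2}u_{d-2}=0,\qquad \delta_1u_1+\dots+\delta_1u_{d-2}=0 .$$ Let $\mathfrak A_k$, $k\ge 1$, be its $(k-1)$-st prolongation: the fibre of $\mathfrak A_k$ at $p\in U$ consists of the $k$-jets at $p$ of those $u=(u_1,\dots,u_{d-2})$ for which the left-hand sides of these equations have vanishing $(k-1)$-jets at $p$. Let $\mathfrak A_0$ be the bundle of all $0$-jets, and let $\pi_{k,k-1}:\mathfrak A_k\to\mathfrak A_{k-1}$ be the jet projections. Put $$\varkappa(u)=\sum_{i=1}^{d-2}\square_iu_i,\qquad \square_i=\Delta_1\cdots\Delta_{d-2}\,\delta_1-\Delta_1\cdots\Delta_{i-1}\,\delta_1\,\Delta_{i+1}\cdots\Delta_{d-2}\,\Delta_i .$$ **Theorem 1.** (1) For $0\le k\le d-2$, $\mathfrak A_k$ is a smooth vector bundle over $U$ of rank $\sum_{j=0}^{k}(d-2-j)$, and for $1\le k\le d-2$ the map $\pi_{k,k-1}$ is surjective with kernel of dimension $d-k-2$. In particular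 $\mathfrak A_{d-3}$ has rank $(d-1)(d-2)/2$. (2) The last projection $\pi_{d-2,d-3}:\mathfrak A_{d-2}\to\mathfrak A_{d-3}$ is an isomorphism. It is a linear connection on $\mathfrak A_{d-3}$ in the following sense: for a section $s$ of $\mathfrak A_{d-3}$ with lift $\hat s=\pi_{d-2,d-3}^{-1}(s)$, the formula $\nabla_vs=\partial_vs-v\lrcorner\hat s$ defines a linear connection on $\mathfrak A_{d-3}$, where $v\lrcorner\hat s$ is the $(d-3)$-jet with components $v_x\hat s_{m+1,n}+v_y\hat s_{m,n+1}$, $m+n\le d-3$, and $\hat s_{m,n}$ denotes the jet coordinate that corresponds to $\partial_x^m\partial_y^nu$. (3) The rank of the web at every point of $U$ is at most $(d-1)(d-2)/2$. (4) $\varkappa$ is a linear differential operator of order at most $d-2$, i.e. at each point of $U$ its value is a linear function on $(d-2)$-jets; and the web is of maximum rank if and only if this linear function vanishes identically on $\mathfrak A_{d-2}$. -/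

import Mathlib

open scoped ContDiff Topology
open Set Filter

noncomputable section

namespace Web

/-- The plane, with its coordinates `x = p.1`, `y = p.2`. -/
abbrev Plane : Type := ℝ × ℝ

/-- The coordinate vector `∂/∂x`. -/
def ex : Plane := (1, 0)

/-- The coordinate vector `∂/∂y`. -/
def ey : Plane := (0, 1)

/-- (Values at a point of) differential `1`-forms. -/
abbrev Covector : Type := Plane →L[ℝ] ℝ

/-- `α ∧ β = (wedge α β) dx ∧ dy`. -/
def wedge (α β : Covector) : ℝ := α ex * β ey - α ey * β ex

/-- The exterior derivative of a `1`-form: `dβ = (extD β) dx ∧ dy`. -/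
def extD (β : Plane → Covector) (p : Plane) : ℝ :=
  fderiv ℝ β p ex ey - fderiv ℝ β p ey ex

/-! ### Webs, the abelian equation and the rank -/

/-- A planar `d`-web on an open set, given by `d` smooth `1`-forms that are pairwise linearly
independent at every point; the foliations are `form i = 0`. -/
structure PlanarWeb (d : ℕ) where
  domain : Set Plane
  isOpen : IsOpen domain
  form : Fin d → Plane → Covector
  smooth : ∀ i, ContDiffOn ℝ ∞ (form i) domain
  transverse : ∀ i j, i ≠ j → ∀ p ∈ domain, wedge (form i p) (form j p) ≠ 0

namespace PlanarWeb

variable {d : ℕ} (W : PlanarWeb d)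

/-- `lam = (λ₁, …, λ_d)` is a smooth solution on `V` of the abelian equation
`λ₁ ω₁ + ⋯ + λ_d ω_d = 0`, `d(λ₁ ω₁) = ⋯ = d(λ_d ω_d) = 0`. -/
structure IsAbelianSolution (V : Set Plane) (lam : Plane → Fin d → ℝ) : Prop where
  smooth : ContDiffOn ℝ ∞ lam V
  sum_eq_zero : ∀ p ∈ V, ∑ i, lam p i • W.form i p = 0
  closed : ∀ i, ∀ p ∈ V, extD (fun q => lam q i • W.form i q) p = 0

theorem extD_add {β η : Plane → Covector} {p : Plane} (hβ : DifferentiableAt ℝ β p)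
    (hη : DifferentiableAt ℝ η p) : extD (fun q => β q + η q) p = extD β p + extD η p := by
  have h : fderiv ℝ (fun q => β q + η q) p = fderiv ℝ β p + fderiv ℝ η p := fderiv_add hβ hη
  simp only [extD, h, add_apply]
  ring

theorem extD_smul {β : Plane → Covector} {p : Plane} (c : ℝ) (hβ : DifferentiableAt ℝ β p) :
    extD (fun q => c • β q) p = c * extD β p := by
  have h : fderiv ℝ (fun q => c • β q) p = c • fderiv ℝ β p := fderiv_const_smul hβ c
  simp only [extD, h, smul_apply, smul_eq_mul]
  ring

theorem IsAbelianSolution.mono {V V' : Set Plane} {lam : Plane → Fin d → ℝ}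
    (h : W.IsAbelianSolution V lam) (hV : V' ⊆ V) : W.IsAbelianSolution V' lam :=
  ⟨h.smooth.mono hV, fun p hp => h.sum_eq_zero p (hV hp), fun i p hp => h.closed i p (hV hp)⟩

theorem IsAbelianSolution.diff {V : Set Plane} {lam : Plane → Fin d → ℝ} (hV : IsOpen V)
    (hVW : V ⊆ W.domain) (h : W.IsAbelianSolution V lam) (i : Fin d) {p : Plane} (hp : p ∈ V) :
    DifferentiableAt ℝ (fun q => lam q i • W.form i q) p := by
  have h1 : ContDiffOn ℝ ∞ (fun q => lam q i) V := contDiffOn_pi.1 h.smooth i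
  have h2 : ContDiffOn ℝ ∞ (fun q => lam q i • W.form i q) V := h1.smul ((W.smooth i).mono hVW)
  exact (h2.contDiffAt (hV.mem_nhds hp)).differentiableAt (by simp)

/-- The vector space of germs at `p` of solutions of the abelian equation (`p ∈ W.domain`). -/
def abelianGerms (p : Plane) : Submodule ℝ (Germ (𝓝 p) (Fin d → ℝ)) where
  carrier := {g | ∃ lam : Plane → Fin d → ℝ, (lam : Germ (𝓝 p) (Fin d → ℝ)) = g ∧
    ∃ V, IsOpen V ∧ p ∈ V ∧ W.IsAbelianSolution (V ∩ W.domain) lam}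
  zero_mem' := by
    refine ⟨fun _ => 0, rfl, univ, isOpen_univ, mem_univ p, contDiffOn_const, by simp, ?_⟩
    intro i q _
    simp [extD]
  add_mem' := by
    rintro _ _ ⟨l, rfl, V, hV, hpV, hl⟩ ⟨l', rfl, V', hV', hpV', hl'⟩
    have hO : IsOpen ((V ∩ V') ∩ W.domain) := (hV.inter hV').inter W.isOpen
    have hl := hl.mono W (V' := (V ∩ V') ∩ W.domain) fun q hq => ⟨hq.1.1, hq.2⟩
    have hl' := hl'.mono W (V' := (V ∩ V') ∩ W.domain) fun q hq => ⟨hq.1.2, hq.2⟩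
    refine ⟨l + l', rfl, V ∩ V', hV.inter hV', ⟨hpV, hpV'⟩, hl.smooth.add hl'.smooth, ?_, ?_⟩
    · intro q hq
      simp only [Pi.add_apply, add_smul, Finset.sum_add_distrib, hl.sum_eq_zero q hq,
        hl'.sum_eq_zero q hq, add_zero]
    · intro i q hq
      simp only [Pi.add_apply, add_smul]
      rw [extD_add (hl.diff W hO inter_subset_right i hq) (hl'.diff W hO inter_subset_right i hq),
        hl.closed i q hq, hl'.closed i q hq, add_zero]
  smul_mem' := by
    rintro c _ ⟨l, rfl, V, hV, hpV, hl⟩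
    refine ⟨c • l, rfl, V, hV, hpV, hl.smooth.const_smul c, ?_, ?_⟩
    · intro q hq
      simp only [Pi.smul_apply, smul_assoc, ← Finset.smul_sum, hl.sum_eq_zero q hq, smul_zero]
    · intro i q hq
      simp only [Pi.smul_apply, smul_assoc]
      rw [extD_smul c (hl.diff W (hV.inter W.isOpen) inter_subset_right i hq),
        hl.closed i q hq, mul_zero]

/-- The rank of the web at `p`: the dimension of the space of local solutions of the abelian
equation near `p`. -/
def rankAt (p : Plane) : Cardinal := Module.rank ℝ (W.abelianGerms p)

/-- The web is of maximum rank `(d - 1)(d - 2)/2`. -/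
def IsOfMaximumRank : Prop :=
  ∀ p ∈ W.domain, W.rankAt p = (((d - 1) * (d - 2) / 2 : ℕ) : Cardinal)

/-- A normalization of the web: the forms `ω_i` are proportional to the given ones, and
`a_i ω₁ + ω₂ + ω_{i+2} = 0` for `i = 1, …, d - 2`, with `a₁ = 1`. Indices start from `0`, so that
`ω₁, ω₂, ω_{i+2}` are `form 0`, `form 1`, `form (i + 2)`, and `a₁, …, a_{d-2}` are
`a 0, …, a (d - 3)`. -/
structure Normalization (hd : 3 ≤ d) where
  form : Fin d → Plane → Covector
  scale : Fin d → Plane → ℝ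
  a : Fin (d - 2) → Plane → ℝ
  scale_smooth : ∀ i, ContDiffOn ℝ ∞ (scale i) W.domain
  scale_ne_zero : ∀ i, ∀ p ∈ W.domain, scale i p ≠ 0
  form_eq : ∀ i, ∀ p ∈ W.domain, form i p = scale i p • W.form i p
  a_smooth : ∀ i, ContDiffOn ℝ ∞ (a i) W.domain
  relation : ∀ i : Fin (d - 2), ∀ p ∈ W.domain,
    a i p • form ⟨0, by omega⟩ p + form ⟨1, by omega⟩ p + form ⟨i + 2, by omega⟩ p = 0
  a_first : ∀ p ∈ W.domain, a ⟨0, by omega⟩ p = 1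

end PlanarWeb

/-! ### Operators on smooth functions -/

/-- The partial derivative `∂_x`. -/
def dx (f : Plane → ℝ) (p : Plane) : ℝ := fderiv ℝ f p ex

/-- The partial derivative `∂_y`. -/
def dy (f : Plane → ℝ) (p : Plane) : ℝ := fderiv ℝ f p ey

/-- The partial derivative `∂_x^m ∂_y^n`. -/
def partialD (m n : ℕ) (f : Plane → ℝ) : Plane → ℝ := dx^[m] (dy^[n] f)

/-- `P` is a well-defined linear operator on the smooth functions on `U`. -/
structure IsOperatorOn (U : Set Plane) (P : (Plane → ℝ) → Plane → ℝ) : Prop where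
  smooth : ∀ f, ContDiffOn ℝ ∞ f U → ContDiffOn ℝ ∞ (P f) U
  add : ∀ f g, ContDiffOn ℝ ∞ f U → ContDiffOn ℝ ∞ g U →
    EqOn (P fun q => f q + g q) (fun q => P f q + P g q) U
  smul : ∀ (c : ℝ) f, ContDiffOn ℝ ∞ f U → EqOn (P fun q => c * f q) (fun q => c * P f q) U
  congr : ∀ f g, EqOn f g U → EqOn (P f) (P g) U

theorem isOperatorOn_id (U : Set Plane) : IsOperatorOn U id :=
  ⟨fun _ hf => hf, fun _ _ _ _ _ _ => rfl, fun _ _ _ _ _ => rfl, fun _ _ h => h⟩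

theorem IsOperatorOn.comp {U : Set Plane} {P Q : (Plane → ℝ) → Plane → ℝ}
    (hP : IsOperatorOn U P) (hQ : IsOperatorOn U Q) : IsOperatorOn U (P ∘ Q) where
  smooth f hf := hP.smooth _ (hQ.smooth f hf)
  add f g hf hg := (hP.congr _ _ (hQ.add f g hf hg)).trans
    (hP.add _ _ (hQ.smooth f hf) (hQ.smooth g hg))
  smul c f hf := (hP.congr _ _ (hQ.smul c f hf)).trans (hP.smul c _ (hQ.smooth f hf))
  congr f g h := hP.congr _ _ (hQ.congr f g h)

theorem IsOperatorOn.sub {U : Set Plane} {P Q : (Plane → ℝ) → Plane → ℝ}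
    (hP : IsOperatorOn U P) (hQ : IsOperatorOn U Q) :
    IsOperatorOn U fun f q => P f q - Q f q where
  smooth f hf := (hP.smooth f hf).sub (hQ.smooth f hf)
  add f g hf hg q hq := by
    have h1 := hP.add f g hf hg hq
    have h2 := hQ.add f g hf hg hq
    simp only at h1 h2 ⊢
    rw [h1, h2]; ring
  smul c f hf q hq := by
    have h1 := hP.smul c f hf hq
    have h2 := hQ.smul c f hf hq
    simp only at h1 h2 ⊢
    rw [h1, h2]; ring
  congr f g h q hq := by
    simp only [hP.congr f g h hq, hQ.congr f g h hq]

theorem isOperatorOn_mul {U : Set Plane} {b : Plane → ℝ} (hb : ContDiffOn ℝ ∞ b U) :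
    IsOperatorOn U fun f q => b q * f q where
  smooth f hf := hb.mul hf
  add f g hf hg q hq := by simp only; ring
  smul c f hf q hq := by simp only; ring
  congr f g h q hq := by simp only [h hq]

theorem isOperatorOn_fderiv {U : Set Plane} (hU : IsOpen U) {X : Plane → Plane}
    (hX : ContDiffOn ℝ ∞ X U) : IsOperatorOn U fun f q => fderiv ℝ f q (X q) where
  smooth f hf := (hf.fderiv_of_isOpen hU (by simp)).clm_apply hX
  add f g hf hg q hq := by
    have h1 := (hf.contDiffAt (hU.mem_nhds hq)).differentiableAt (by simp)
    have h2 := (hg.contDiffAt (hU.mem_nhds hq)).differentiableAt (by simp)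
    simp only
    rw [fderiv_fun_add h1 h2]
    rfl
  smul c f hf q hq := by
    have h1 := (hf.contDiffAt (hU.mem_nhds hq)).differentiableAt (by simp)
    simp only
    rw [fderiv_const_mul h1]
    rfl
  congr f g h q hq := by
    have : f =ᶠ[𝓝 q] g := h.eventuallyEq_of_mem (hU.mem_nhds hq)
    simp only [this.fderiv_eq]

theorem IsOperatorOn.iterate {U : Set Plane} {P : (Plane → ℝ) → Plane → ℝ}
    (hP : IsOperatorOn U P) : ∀ n, IsOperatorOn U (P^[n])
  | 0 => isOperatorOn_id U
  | n + 1 => (IsOperatorOn.iterate hP n).comp hP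

theorem isOperatorOn_partialD {U : Set Plane} (hU : IsOpen U) (m n : ℕ) :
    IsOperatorOn U (partialD m n) :=
  ((isOperatorOn_fderiv hU contDiffOn_const).iterate m).comp
    ((isOperatorOn_fderiv hU contDiffOn_const).iterate n)

/-! ### Jets of sections of the trivial bundle of rank `r` over the plane -/

/-- Multi-indices `(m, n)` with `m + n ≤ k`. -/
def JetIndex (k : ℕ) : Type := {α : ℕ × ℕ // α.1 + α.2 ≤ k}

instance (k : ℕ) : Fintype (JetIndex k) :=
  Fintype.subtype (((Finset.range (k + 1)) ×ˢ (Finset.range (k + 1))).filter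
    fun α => α.1 + α.2 ≤ k) (by
      intro α
      simp only [Finset.mem_filter, Finset.mem_product, Finset.mem_range]
      omega)

/-- The fibre of the bundle of `k`-jets, in the standard jet coordinates: `θ (m, n) i` is the
coordinate that takes on the jet of `u` the value `∂_x^m ∂_y^n u_i`. -/
abbrev Jet (r k : ℕ) : Type := JetIndex k → Fin r → ℝ

/-- The `k`-jet of `u` at `p`. -/
def jet {r : ℕ} (k : ℕ) (p : Plane) (u : Plane → Fin r → ℝ) : Jet r k :=
  fun α i => partialD α.1.1 α.1.2 (fun q => u q i) p

/-- The natural projection from `k`-jets to `l`-jets. -/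
def jetProj {r k l : ℕ} (h : l ≤ k) : Jet r k →ₗ[ℝ] Jet r l where
  toFun θ := fun α => θ ⟨α.1, α.2.trans h⟩
  map_add' _ _ := rfl
  map_smul' _ _ := rfl

/-- The formal derivative of a `k`-jet along the vector `v`: the `l`-jet, `l < k`, with components
`v_x θ (m + 1, n) + v_y θ (m, n + 1)`. -/
def jetContract {r k l : ℕ} (h : l + 1 ≤ k) (v : Plane) (θ : Jet r k) : Jet r l := fun α =>
  v.1 • θ ⟨(α.1.1 + 1, α.1.2), by have := α.2; simp only; omega⟩ +
    v.2 • θ ⟨(α.1.1, α.1.2 + 1), by have := α.2; simp only; omega⟩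

/-! ### Vector subbundles and linear connections -/

section Bundles

variable {E : Type*} [NormedAddCommGroup E] [NormedSpace ℝ E]

/-- The subspaces `A p`, `p ∈ U`, are the fibres of a smooth vector subbundle of rank `n` of the
trivial bundle over `U` with fibre `E`: there are smooth local frames. -/
def IsSmoothSubbundle (U : Set Plane) (A : Plane → Submodule ℝ E) (n : ℕ) : Prop :=
  ∀ p ∈ U, ∃ V, IsOpen V ∧ p ∈ V ∧ V ⊆ U ∧ ∃ e : Fin n → Plane → E,
    (∀ j, ContDiffOn ℝ ∞ (e j) V) ∧
    ∀ q ∈ V, LinearIndependent ℝ (fun j => e j q) ∧ Submodule.span ℝ (range fun j => e j q) = A q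

/-- `s` is a smooth section over `V` of the bundle with fibres `A p`. -/
structure IsSmoothSection (A : Plane → Submodule ℝ E) (V : Set Plane) (s : Plane → E) : Prop where
  smooth : ContDiffOn ℝ ∞ s V
  mem : ∀ p ∈ V, s p ∈ A p

/-- `nabla` is (the covariant derivative of) a linear connection in the bundle over `U` with fibres
`A p`; here `nabla s p v` is the derivative at `p` of the section `s` in the direction `v`. -/
structure IsLinearConnection (U : Set Plane) (A : Plane → Submodule ℝ E)
    (nabla : (Plane → E) → Plane → Plane → E) : Prop where
  isSection : ∀ V, IsOpen V → V ⊆ U → ∀ s, IsSmoothSection A V s → ∀ v,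
    IsSmoothSection A V fun p => nabla s p v
  map_vector : ∀ V, IsOpen V → V ⊆ U → ∀ s, IsSmoothSection A V s → ∀ p ∈ V,
    IsLinearMap ℝ (nabla s p)
  add : ∀ V, IsOpen V → V ⊆ U → ∀ s t, IsSmoothSection A V s → IsSmoothSection A V t →
    ∀ p ∈ V, ∀ v, nabla (fun q => s q + t q) p v = nabla s p v + nabla t p v
  leibniz : ∀ V, IsOpen V → V ⊆ U → ∀ (f : Plane → ℝ) s, ContDiffOn ℝ ∞ f V →
    IsSmoothSection A V s → ∀ p ∈ V, ∀ v,
      nabla (fun q => f q • s q) p v = fderiv ℝ f p v • s p + f p • nabla s p v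

end Bundles

/-! ### The Chern connection, covariant derivatives and the prolongations -/

namespace PlanarWeb.Normalization

variable {d : ℕ} {W : PlanarWeb d} {hd : 3 ≤ d} (N : W.Normalization hd)

/-- The normalized form `ω₁`. -/
def om1 : Plane → Covector := N.form ⟨0, by omega⟩

/-- The normalized form `ω₂`. -/
def om2 : Plane → Covector := N.form ⟨1, by omega⟩

/-- The vector field `∂₁` of the frame dual to `ω₁, ω₂`. -/
def e1 (p : Plane) : Plane :=
  (wedge (N.om1 p) (N.om2 p))⁻¹ • (N.om2 p ey, -N.om2 p ex)

/-- The vector field `∂₂` of the frame dual to `ω₁, ω₂`. -/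
def e2 (p : Plane) : Plane :=
  (wedge (N.om1 p) (N.om2 p))⁻¹ • (-N.om1 p ey, N.om1 p ex)

/-- The coefficient `g₁` of the Chern connection form `γ = g₁ ω₁ + g₂ ω₂`, which is determined by
`dω₁ = ω₁ ∧ γ = g₂ ω₁ ∧ ω₂` and `dω₂ = ω₂ ∧ γ = -g₁ ω₁ ∧ ω₂`. -/
def g1 (p : Plane) : ℝ := -(extD N.om2 p / wedge (N.om1 p) (N.om2 p))

/-- The coefficient `g₂` of the Chern connection form `γ = g₁ ω₁ + g₂ ω₂`. -/
def g2 (p : Plane) : ℝ := extD N.om1 p / wedge (N.om1 p) (N.om2 p)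

/-- The covariant derivative `δ₁` on functions of weight `k`: `δ₁ f = ∂₁ f - k g₁ f`. -/
def delta1 (k : ℕ) (f : Plane → ℝ) (p : Plane) : ℝ :=
  fderiv ℝ f p (N.e1 p) - k * N.g1 p * f p

/-- The covariant derivative `δ₂` on functions of weight `k`: `δ₂ f = ∂₂ f - k g₂ f`. -/
def delta2 (k : ℕ) (f : Plane → ℝ) (p : Plane) : ℝ :=
  fderiv ℝ f p (N.e2 p) - k * N.g2 p * f p

/-- The operator `Δ_i = δ₁ - δ₂ ∘ a_i` on functions of weight `k` (the weight of `a_i` is `0`). -/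
def Delta (i : Fin (d - 2)) (k : ℕ) (f : Plane → ℝ) (p : Plane) : ℝ :=
  N.delta1 k f p - N.delta2 k (fun q => N.a i q * f q) p

/-- The composition `P₁ ∘ ⋯ ∘ P_n` on functions of weight `k`, for operators `P_j` each of which
raises the weight by one. -/
def compose : List (ℕ → (Plane → ℝ) → Plane → ℝ) → ℕ → (Plane → ℝ) → Plane → ℝ
  | [], _, f => f
  | P :: L, k, f => P (k + L.length) (compose L k f)

/-- The operator `□_i = Δ₁ ⋯ Δ_{d-2} δ₁ - Δ₁ ⋯ Δ_{i-1} δ₁ Δ_{i+1} ⋯ Δ_{d-2} Δ_i` on functions of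
weight one. -/
def box (i : Fin (d - 2)) (f : Plane → ℝ) (p : Plane) : ℝ :=
  compose (List.ofFn N.Delta ++ [N.delta1]) 1 f p -
    compose (List.ofFn (Function.update N.Delta i N.delta1) ++ [N.Delta i]) 1 f p

/-- The compatibility obstruction `ϰ = □₁ u₁ + ⋯ + □_{d-2} u_{d-2}`. -/
def obstruction (u : Plane → Fin (d - 2) → ℝ) (p : Plane) : ℝ :=
  ∑ i, N.box i (fun q => u q i) p

theorem om_smooth (i : Fin d) : ContDiffOn ℝ ∞ (N.form i) W.domain :=
  ((N.scale_smooth i).smul (W.smooth i)).congr fun p hp => N.form_eq i p hp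

theorem wedge_ne_zero {p : Plane} (hp : p ∈ W.domain) : wedge (N.om1 p) (N.om2 p) ≠ 0 := by
  have h := W.transverse ⟨0, by omega⟩ ⟨1, by omega⟩ (by simp) p hp
  have h0 := N.scale_ne_zero ⟨0, by omega⟩ p hp
  have h1 := N.scale_ne_zero ⟨1, by omega⟩ p hp
  have : wedge (N.om1 p) (N.om2 p) = N.scale ⟨0, by omega⟩ p * N.scale ⟨1, by omega⟩ p *
      wedge (W.form ⟨0, by omega⟩ p) (W.form ⟨1, by omega⟩ p) := by
    simp only [wedge, om1, om2, N.form_eq _ p hp, smul_apply, smul_eq_mul]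
    ring
  rw [this]
  exact mul_ne_zero (mul_ne_zero h0 h1) h

theorem wedge_inv_smooth :
    ContDiffOn ℝ ∞ (fun p => (wedge (N.om1 p) (N.om2 p))⁻¹) W.domain := by
  have h1 := N.om_smooth ⟨0, by omega⟩
  have h2 := N.om_smooth ⟨1, by omega⟩
  refine ContDiffOn.inv ?_ fun p hp => N.wedge_ne_zero hp
  exact ((h1.clm_apply contDiffOn_const).mul (h2.clm_apply contDiffOn_const)).sub
    ((h1.clm_apply contDiffOn_const).mul (h2.clm_apply contDiffOn_const))

theorem extD_smooth (i : Fin d) : ContDiffOn ℝ ∞ (extD (N.form i)) W.domain := by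
  have h := (N.om_smooth i).fderiv_of_isOpen (m := ∞) W.isOpen (by simp)
  exact ((h.clm_apply contDiffOn_const).clm_apply contDiffOn_const).sub
    ((h.clm_apply contDiffOn_const).clm_apply contDiffOn_const)

theorem e1_smooth : ContDiffOn ℝ ∞ N.e1 W.domain :=
  N.wedge_inv_smooth.smul (((N.om_smooth ⟨1, by omega⟩).clm_apply contDiffOn_const).prodMk
    ((N.om_smooth ⟨1, by omega⟩).clm_apply contDiffOn_const).neg)

theorem e2_smooth : ContDiffOn ℝ ∞ N.e2 W.domain :=
  N.wedge_inv_smooth.smul (((N.om_smooth ⟨0, by omega⟩).clm_apply contDiffOn_const).neg.prodMk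
    ((N.om_smooth ⟨0, by omega⟩).clm_apply contDiffOn_const))

theorem isOperatorOn_delta1 (k : ℕ) : IsOperatorOn W.domain (N.delta1 k) := by
  have hg : ContDiffOn ℝ ∞ N.g1 W.domain :=
    ((N.extD_smooth ⟨1, by omega⟩).mul N.wedge_inv_smooth).neg
  exact (isOperatorOn_fderiv W.isOpen N.e1_smooth).sub
    (isOperatorOn_mul (contDiffOn_const.mul hg))

theorem isOperatorOn_delta2 (k : ℕ) : IsOperatorOn W.domain (N.delta2 k) := by
  have hg : ContDiffOn ℝ ∞ N.g2 W.domain :=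
    (N.extD_smooth ⟨0, by omega⟩).mul N.wedge_inv_smooth
  exact (isOperatorOn_fderiv W.isOpen N.e2_smooth).sub
    (isOperatorOn_mul (contDiffOn_const.mul hg))

theorem isOperatorOn_Delta (i : Fin (d - 2)) (k : ℕ) : IsOperatorOn W.domain (N.Delta i k) :=
  (N.isOperatorOn_delta1 k).sub ((N.isOperatorOn_delta2 k).comp (isOperatorOn_mul (N.a_smooth i)))

/-- The left-hand side `δ₁ u₁ + ⋯ + δ₁ u_{d-2}` of the last equation of the abelian system for
functions `u_i` of weight one. -/
def sumDelta1 (u : Plane → Fin (d - 2) → ℝ) (p : Plane) : ℝ :=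
  ∑ i, N.delta1 1 (fun q => u q i) p

theorem sumDelta1_smooth {u : Plane → Fin (d - 2) → ℝ} (hu : ContDiff ℝ ∞ u) :
    ContDiffOn ℝ ∞ (N.sumDelta1 u) W.domain :=
  ContDiffOn.sum fun i _ => (N.isOperatorOn_delta1 1).smooth _ (contDiff_pi.1 hu i).contDiffOn

/-- The fibre over `p ∈ W.domain` of the bundle `𝔄_k`, the `(k - 1)`-st prolongation of the abelian
equation `Δ₁ u₁ = ⋯ = Δ_{d-2} u_{d-2} = 0`, `δ₁ u₁ + ⋯ + δ₁ u_{d-2} = 0`: the `k`-jets at `p` of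
the smooth `u` for which the `(k - 1)`-jets at `p` of the left-hand sides vanish. For `k = 0` there
is no condition. -/
def prolongation (k : ℕ) (p : Plane) : Submodule ℝ (Jet (d - 2) k) where
  carrier := {θ | ∃ u : Plane → Fin (d - 2) → ℝ, ContDiff ℝ ∞ u ∧ jet k p u = θ ∧
    (p ∈ W.domain → ∀ m n : ℕ, m + n + 1 ≤ k →
      (∀ i, partialD m n (N.Delta i 1 fun q => u q i) p = 0) ∧
      partialD m n (N.sumDelta1 u) p = 0)}
  zero_mem' := by
    have h0 : ∀ {U : Set Plane} {P : (Plane → ℝ) → Plane → ℝ}, IsOperatorOn U P → ∀ q ∈ U,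
        P (fun _ => 0) q = 0 := by
      intro U P hP q hq
      have := hP.smul 0 (fun _ => 0) contDiffOn_const hq
      simpa using this
    refine ⟨fun _ _ => 0, contDiff_const, ?_, fun hp m n _ => ⟨fun i => ?_, ?_⟩⟩
    · ext α i
      exact h0 (isOperatorOn_partialD isOpen_univ _ _) p (mem_univ p)
    · exact h0 ((isOperatorOn_partialD W.isOpen m n).comp (N.isOperatorOn_Delta i 1)) p hp
    · have h : EqOn (N.sumDelta1 fun _ _ => 0) (fun _ => 0) W.domain := fun q hq =>
        Finset.sum_eq_zero fun i _ => h0 (N.isOperatorOn_delta1 1) q hq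
      have hP := isOperatorOn_partialD W.isOpen m n
      rw [hP.congr _ _ h hp]
      exact h0 hP p hp
  add_mem' := by
    rintro _ _ ⟨u, hu, rfl, hu'⟩ ⟨v, hv, rfl, hv'⟩
    have hui := contDiff_pi.1 hu
    have hvi := contDiff_pi.1 hv
    refine ⟨fun q i => u q i + v q i, hu.add hv, ?_, fun hp m n hmn => ⟨fun i => ?_, ?_⟩⟩
    · ext α i
      exact (isOperatorOn_partialD isOpen_univ _ _).add _ _ (hui i).contDiffOn (hvi i).contDiffOn
        (mem_univ p)
    · have hP := (isOperatorOn_partialD W.isOpen m n).comp (N.isOperatorOn_Delta i 1)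
      refine (hP.add _ _ (hui i).contDiffOn (hvi i).contDiffOn hp).trans ?_
      simp [(hu' hp m n hmn).1 i, (hv' hp m n hmn).1 i]
    · have hP := isOperatorOn_partialD W.isOpen m n
      have h : EqOn (N.sumDelta1 fun q i => u q i + v q i)
          (fun q => N.sumDelta1 u q + N.sumDelta1 v q) W.domain := by
        intro q hq
        simp only [sumDelta1, ← Finset.sum_add_distrib]
        exact Finset.sum_congr rfl fun i _ =>
          (N.isOperatorOn_delta1 1).add _ _ (hui i).contDiffOn (hvi i).contDiffOn hq
      rw [hP.congr _ _ h hp, hP.add _ _ (N.sumDelta1_smooth hu) (N.sumDelta1_smooth hv) hp]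
      simp [(hu' hp m n hmn).2, (hv' hp m n hmn).2]
  smul_mem' := by
    rintro c _ ⟨u, hu, rfl, hu'⟩
    have hui := contDiff_pi.1 hu
    refine ⟨fun q i => c * u q i, hu.const_smul c, ?_, fun hp m n hmn => ⟨fun i => ?_, ?_⟩⟩
    · ext α i
      exact (isOperatorOn_partialD isOpen_univ _ _).smul c _ (hui i).contDiffOn (mem_univ p)
    · have hP := (isOperatorOn_partialD W.isOpen m n).comp (N.isOperatorOn_Delta i 1)
      refine (hP.smul c _ (hui i).contDiffOn hp).trans ?_
      simp [(hu' hp m n hmn).1 i]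
    · have hP := isOperatorOn_partialD W.isOpen m n
      have h : EqOn (N.sumDelta1 fun q i => c * u q i) (fun q => c * N.sumDelta1 u q)
          W.domain := by
        intro q hq
        simp only [sumDelta1, Finset.mul_sum]
        exact Finset.sum_congr rfl fun i _ =>
          (N.isOperatorOn_delta1 1).smul c _ (hui i).contDiffOn hq
      rw [hP.congr _ _ h hp, hP.smul c _ (N.sumDelta1_smooth hu) hp]
      simp [(hu' hp m n hmn).2]

/-- The lift to `𝔄_{d-2}` of an element of `𝔄_{d-3}` over `p`: the inverse of the last projection
`𝔄_{d-2} → 𝔄_{d-3}`. -/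
def lift (p : Plane) (θ : Jet (d - 2) (d - 3)) : Jet (d - 2) (d - 2) :=
  Function.invFunOn (jetProj (by omega)) (N.prolongation (d - 2) p : Set (Jet (d - 2) (d - 2))) θ

/-- The covariant derivative of sections of `𝔄_{d-3}` that the last projection
`𝔄_{d-2} → 𝔄_{d-3}` determines: an element of `𝔄_{d-2}` prescribes the first derivatives of a
horizontal section through its projection. -/
def cartan (s : Plane → Jet (d - 2) (d - 3)) (p v : Plane) : Jet (d - 2) (d - 3) :=
  fderiv ℝ s p v - jetContract (by omega) v (N.lift p (s p))

end PlanarWeb.Normalization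

end Web

end

open Web

noncomputable section

namespace Web

/-! Put n = d - 2. The abelian equation has n unknowns and n + 1 first order equations, whose
principal symbols are the vector fields ∂₁ and ∂₁ - a_i ∂₂; these are pairwise independent because
the web is transverse. The symbol decides everything about the prolongations. On homogeneous jets of
order k it maps a space of dimension n(k + 1) to one of dimension (n + 1)k. For k = n it is an
isomorphism (`symbol_injective`). Suppose that the i-th symbol kills w_i for every i and that ∂₁
kills ∑ w_i. Multiplying the last relation by the symbols of all Δ_j with j ≠ i leaves a product
that kills w_i alone; it is coprime to the symbol of Δ_i, so w_i = 0. Consequently the symbol is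
surjective for k ≤ n with kernel of dimension n - k, which gives the tower (`exists_lift`). For k =
n + 1 it is injective and its image is a hyperplane (`exists_symbol_eq_of_obstruction`). An n-jet is
therefore determined by its (n - 1)-jet and the equations of top order. The resulting lift makes the
jets of solutions parallel for a total differential equation ds = M s on (n - 1)-jets (`connForm`),
and this equation preserves 𝔄_{n-1} (`fderiv_prolongedEqn_connForm`). Uniqueness of parallel
sections bounds the rank by the fibre dimension n + (n - 1) + ⋯ + 1. Existence is Frobenius' theorem
(`exists_solution_of_flat`). It needs flatness only on 𝔄_{n-1}, and this follows once 𝔄_{n+1} → 𝔄_n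
is onto (`connForm_flat`). The obstruction to that is the functional that cuts out the image of the
symbol in order n + 1, and ϰ computes it: ϰ(u) is a combination of Δ-products applied to the
left-hand sides of the equations (`obstruction_eq`), so if these vanish to order n at p, only
principal symbols count (`obstruction_eq_symbolObstruction`). The terms of order n + 1 in u cancel
because symbols commute. Conversely, solutions annihilate the left-hand sides and hence ϰ. -/

theorem natCast_le_infty (n : ℕ) : (n : WithTop ℕ∞) ≤ ∞ := by
  exact_mod_cast (le_top : (n : ℕ∞) ≤ ⊤)

/-! ### Linear total differential equations: Frobenius' theorem, smoothness and uniqueness. -/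

section Frobenius

variable {E : Type*} [NormedAddCommGroup E] [NormedSpace ℝ E]

/-- Grönwall's inequality with constant 1 at times t ≤ 1; the factor 3 is a bound for e. -/
theorem norm_le_of_deriv_le_unitInterval {f f' : ℝ → E} {δ ε : ℝ} (hδ : 0 ≤ δ) (hε : 0 ≤ ε)
    (hf : ∀ t ∈ Icc (0 : ℝ) 1, HasDerivWithinAt f (f' t) (Icc 0 1) t) (h0 : ‖f 0‖ ≤ δ)
    (hb : ∀ t ∈ Icc (0 : ℝ) 1, ‖f' t‖ ≤ ‖f t‖ + ε) :
    ∀ t ∈ Icc (0 : ℝ) 1, ‖f t‖ ≤ 3 * (δ + ε) := by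
  intro t ht
  have h := norm_le_gronwallBound_of_norm_deriv_right_le (f := f) (f' := f') (δ := δ) (K := 1)
    (ε := ε) (a := 0) (b := 1) (fun t ht => (hf t ht).continuousWithinAt)
    (fun t ht => (hf t ⟨ht.1, ht.2.le⟩).mono_of_mem_nhdsWithin (Icc_mem_nhdsGE_of_mem ht)) h0
    (fun t ht => by simpa using hb t ⟨ht.1, ht.2.le⟩) t ht
  refine h.trans ?_
  rw [gronwallBound_of_K_ne_0 one_ne_zero]
  have h1 : Real.exp t ≤ 3 := (Real.exp_le_exp.2 ht.2).trans (Real.exp_one_lt_three.le)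
  simp only [sub_zero, one_mul, div_one]
  nlinarith

/-- A linear equation with a continuous coefficient of norm at most `1 / 2` has solutions on the
unit interval. -/
theorem exists_linear_ode_solution [CompleteSpace E] {B : ℝ → E →L[ℝ] E}
    (hB : ContinuousOn B (Icc 0 1)) (hb : ∀ t ∈ Icc (0 : ℝ) 1, ‖B t‖ ≤ 1 / 2) (x : E) :
    ∃ f : ℝ → E, f 0 = x ∧
      (∀ t ∈ Icc (0 : ℝ) 1, HasDerivWithinAt f (B t (f t)) (Icc 0 1) t) ∧
      ∀ t ∈ Icc (0 : ℝ) 1, ‖f t‖ ≤ 3 * ‖x‖ := by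
  -- On the ball of radius ‖x‖ + 1 about x the right-hand side is at most (2‖x‖ + 1) / 2 ≤ ‖x‖ + 1,
  -- so the solution stays in the ball up to time 1 and no continuation argument is needed.
  have hpl : IsPicardLindelof (fun t y => B t y) (tmin := 0) (tmax := 1) ⟨0, by simp⟩ x
      ⟨‖x‖ + 1, by positivity⟩ 0 ⟨‖x‖ + 1, by positivity⟩ ⟨1 / 2, by norm_num⟩ := by
    refine ⟨fun t ht => ?_, fun y _ => hB.clm_apply continuousOn_const, fun t ht y hy => ?_, ?_⟩
    · refine LipschitzOnWith.of_dist_le_mul fun y _ z _ => ?_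
      rw [dist_eq_norm, ← map_sub, dist_eq_norm]
      exact (B t).le_of_opNorm_le (hb t ht) _
    · refine ((B t).le_of_opNorm_le (hb t ht) _).trans ?_
      have : ‖y - x‖ ≤ ‖x‖ + 1 := by simpa [dist_eq_norm] using! hy
      have := norm_le_norm_add_norm_sub' y x
      change _ ≤ ‖x‖ + 1
      linarith [norm_nonneg x]
    · simp
  obtain ⟨f, hf0, hf⟩ := hpl.exists_eq_forall_mem_Icc_hasDerivWithinAt₀
  refine ⟨f, hf0, hf, ?_⟩
  have := norm_le_of_deriv_le_unitInterval (norm_nonneg x) le_rfl hf (le_of_eq (by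
    simpa using! congrArg norm hf0)) (fun t ht => ?_)
  · simpa using this
  · refine ((B t).le_of_opNorm_le (hb t ht) _).trans ?_
    linarith [norm_nonneg (f t)]

variable {V G : Type*} [NormedAddCommGroup V] [NormedSpace ℝ V] [NormedAddCommGroup G]
  [NormedSpace ℝ G]

/-- Near a point where M is C², its derivative is bounded and Lipschitz, and the mean value
inequality yields the Lipschitz bound and the quadratic Taylor remainder. A single constant serves
all estimates. -/
theorem exists_ball_second_order_bound {M : V → G} {p : V} (hM : ContDiffAt ℝ 2 M p) :
    ∃ R > 0, ∃ C > 0, (∀ q ∈ Metric.ball p R, ContDiffAt ℝ 2 M q ∧ ‖M q‖ ≤ C ∧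
      ‖fderiv ℝ M q‖ ≤ C) ∧ ∀ q ∈ Metric.ball p R, ∀ q' ∈ Metric.ball p R,
        ‖M q' - M q‖ ≤ C * ‖q' - q‖ ∧
        ‖M q' - M q - fderiv ℝ M q (q' - q)‖ ≤ C * ‖q' - q‖ ^ 2 := by
  have h1 : ContDiffAt ℝ 1 (fderiv ℝ M) p := hM.fderiv_right (by norm_num)
  obtain ⟨K, t, ht, hK⟩ := h1.exists_lipschitzOnWith
  have e1 := hM.eventually (by simp)
  have e2 : ∀ᶠ q in 𝓝 p, ‖M q‖ < ‖M p‖ + 1 :=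
    hM.continuousAt.norm.eventually_lt continuousAt_const (by simp)
  have e3 : ∀ᶠ q in 𝓝 p, ‖fderiv ℝ M q‖ < ‖fderiv ℝ M p‖ + 1 :=
    h1.continuousAt.norm.eventually_lt continuousAt_const (by simp)
  obtain ⟨R, hR, hb⟩ := Metric.eventually_nhds_iff_ball.1 (e1.and (e2.and (e3.and ht)))
  have hC1 := norm_nonneg (M p)
  have hC2 := norm_nonneg (fderiv ℝ M p)
  refine ⟨R, hR, ‖M p‖ + 1 + (‖fderiv ℝ M p‖ + 1) + K, by positivity, fun q hq => ?_,
    fun q hq q' hq' => ⟨?_, ?_⟩⟩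
  · obtain ⟨a, b, c, -⟩ := hb q hq
    have := K.2
    refine ⟨a, ?_, ?_⟩ <;> nlinarith [K.coe_nonneg]
  · have := (convex_ball p R).norm_image_sub_le_of_norm_fderiv_le (𝕜 := ℝ) (f := M)
      (C := ‖M p‖ + 1 + (‖fderiv ℝ M p‖ + 1) + K)
      (fun x hx => (hb x hx).1.differentiableAt (by simp)) (fun x hx => by
        have := (hb x hx).2.2.1; linarith [K.coe_nonneg]) hq hq'
    exact this
  · have hs : segment ℝ q q' ⊆ Metric.ball p R := (convex_ball p R).segment_subset hq hq'
    have := (convex_segment q q').norm_image_sub_le_of_norm_hasFDerivWithin_le' (𝕜 := ℝ) (f := M)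
      (f' := fderiv ℝ M) (φ := fderiv ℝ M q) (C := K * ‖q' - q‖)
      (fun x hx => ((hb x (hs hx)).1.differentiableAt (by simp)).hasFDerivAt.hasFDerivWithinAt)
      (fun x hx => ?_) (left_mem_segment ℝ q q') (right_mem_segment ℝ q q')
    · refine this.trans ?_
      rw [pow_two, ← mul_assoc]
      gcongr
      linarith
    · rw [← dist_eq_norm]
      refine (hK.dist_le_mul x (hb x (hs hx)).2.2.2 q (hb q hq).2.2.2).trans ?_
      gcongr
      rw [dist_eq_norm]
      obtain ⟨a, b, ha, hb', hab, rfl⟩ := hx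
      have : a • q + b • q' - q = b • (q' - q) := by
        rw [← sub_eq_iff_eq_add'.2 hab.symm]; module
      rw [this, norm_smul, Real.norm_of_nonneg hb']
      exact mul_le_of_le_one_left (norm_nonneg _) (by linarith)

/-- **Frobenius' theorem** for linear total differential equations `ds = M s`, for initial values in
the kernel of a family of linear maps `F` that the equation preserves and on which it is flat. -/
theorem exists_solution_of_flat [CompleteSpace E] {U : Set V} (hU : IsOpen U)
    {M : V → V →L[ℝ] E →L[ℝ] E} (hM : ContDiffOn ℝ ∞ M U)
    {F : V → E →L[ℝ] G} (hF : ContDiffOn ℝ ∞ F U) (T : V →L[ℝ] G →L[ℝ] G)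
    (hT : ∀ q ∈ U, ∀ v x, fderiv ℝ F q v x + F q (M q v x) = T v (F q x))
    (flat : ∀ q ∈ U, ∀ x, F q x = 0 → ∀ v w, fderiv ℝ M q v w x + M q w (M q v x) =
      fderiv ℝ M q w v x + M q v (M q w x))
    {p : V} (hp : p ∈ U) {x : E} (hx : F p x = 0) :
    ∃ r > 0, Metric.ball p r ⊆ U ∧ ∃ s : V → E, s p = x ∧ ∀ q ∈ Metric.ball p r, F q (s q) = 0 ∧
      HasFDerivAt s ((M q).flip (s q)) q := by
  obtain ⟨R, hR, C, hC, hb, hb2⟩ := exists_ball_second_order_bound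
    (((hM p hp).contDiffAt (hU.mem_nhds hp)).of_le (natCast_le_infty 2))
  obtain ⟨R', hR', hRU⟩ := Metric.isOpen_iff.1 hU p hp
  -- The bound C r ≤ 1/2 lets the equation along each ray p + t v be solved up to t = 1; ‖T‖ r ≤ 1
  -- is the Grönwall constant needed for F along the ray.
  obtain ⟨r, hr, hrR, hrR', hrC, hrT⟩ : ∃ r > 0, r ≤ R ∧ r ≤ R' ∧ C * r ≤ 1 / 2 ∧ ‖T‖ * r ≤ 1 := by
    refine ⟨min (min R R') (min (1 / (2 * C)) (1 / (‖T‖ + 1))), by positivity,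
      (min_le_left _ _).trans (min_le_left _ _), (min_le_left _ _).trans (min_le_right _ _), ?_, ?_⟩
    · refine (mul_le_mul_of_nonneg_left ((min_le_right _ _).trans (min_le_left _ _)) hC.le).trans ?_
      exact le_of_eq (by field_simp)
    · refine (mul_le_mul_of_nonneg_left ((min_le_right _ _).trans (min_le_right _ _))
        (norm_nonneg T)).trans ?_
      rw [mul_one_div, div_le_one (by positivity)]
      linarith
  have hrU : Metric.ball p r ⊆ U := (Metric.ball_subset_ball hrR').trans hRU
  have mem : ∀ v : V, ‖v‖ < r → ∀ t ∈ Icc (0 : ℝ) 1, p + t • v ∈ Metric.ball p r := by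
    intro v hv t ht
    rw [mem_ball_iff_norm, add_sub_cancel_left, norm_smul, Real.norm_of_nonneg ht.1]
    exact (mul_le_of_le_one_left (norm_nonneg _) ht.2).trans_lt hv
  have line : ∀ (v : V) (t : ℝ), HasDerivWithinAt (fun t : ℝ => p + t • v) v (Icc 0 1) t := by
    intro v t
    simpa using (((hasDerivAt_id t).smul_const v).const_add p).hasDerivWithinAt (s := Icc 0 1)
  have Mdiff : ∀ q ∈ Metric.ball p r, DifferentiableAt ℝ M q := fun q hq =>
    (hb q (Metric.ball_subset_ball hrR hq)).1.differentiableAt (by simp)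
  have Mline : ∀ v : V, ‖v‖ < r → ∀ t ∈ Icc (0 : ℝ) 1, HasDerivWithinAt (fun t => M (p + t • v))
      (fderiv ℝ M (p + t • v) v) (Icc 0 1) t := fun v hv t ht =>
    HasFDerivAt.comp_hasDerivWithinAt (l := M) (f := fun t : ℝ => p + t • v) t
      (Mdiff _ (mem v hv t ht)).hasFDerivAt (line v t)
  have Bnd : ∀ v : V, ‖v‖ < r → ∀ t ∈ Icc (0 : ℝ) 1, ‖M (p + t • v) v‖ ≤ 1 / 2 := by
    intro v hv t ht
    refine (ContinuousLinearMap.le_of_opNorm_le_of_le _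
      (hb _ (Metric.ball_subset_ball hrR (mem v hv t ht))).2.1 hv.le).trans hrC
  -- The candidate solution is built by integrating along the rays from p; its value at p + v is f v
  -- 1.
  have ex : ∀ v : V, ∃ f : ℝ → E, ‖v‖ < r → f 0 = x ∧ (∀ t ∈ Icc (0 : ℝ) 1,
      HasDerivWithinAt f (M (p + t • v) v (f t)) (Icc 0 1) t) ∧
      ∀ t ∈ Icc (0 : ℝ) 1, ‖f t‖ ≤ 3 * ‖x‖ := by
    intro v
    by_cases hv : ‖v‖ < r
    · obtain ⟨f, hf⟩ := exists_linear_ode_solution (B := fun t => M (p + t • v) v)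
        (fun t ht => ((Mline v hv t ht).clm_apply (hasDerivWithinAt_const t _ v)).continuousWithinAt)
        (Bnd v hv) x
      exact ⟨f, fun _ => hf⟩
    · exact ⟨0, fun h => absurd h hv⟩
  choose f hf using ex
  -- Along a ray F(f) solves the linear equation with coefficient T v and starts at zero. This must
  -- precede the next estimate, since flatness is available only on the kernel of F.
  have hFf : ∀ v : V, ‖v‖ < r → ∀ t ∈ Icc (0 : ℝ) 1, F (p + t • v) (f v t) = 0 := by
    intro v hv t ht
    have key := norm_le_of_deriv_le_unitInterval (f := fun t => F (p + t • v) (f v t))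
      (f' := fun t => T v (F (p + t • v) (f v t))) le_rfl le_rfl (fun t ht => ?_) ?_
      (fun t ht => ?_) t ht
    · simpa using key
    · have hq := hrU (mem v hv t ht)
      have h1 := (((hF _ hq).contDiffAt (hU.mem_nhds hq)).differentiableAt
        (by simp)).hasFDerivAt.comp_hasDerivWithinAt t (line v t)
      have h2 := h1.clm_apply ((hf v hv).2.1 t ht)
      rw [← hT _ hq]
      exact h2
    · simp [(hf v hv).1, hx]
    · rw [add_zero]
      refine (ContinuousLinearMap.le_opNorm _ _).trans (mul_le_of_le_one_left (norm_nonneg _) ?_)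
      refine (ContinuousLinearMap.le_opNorm _ _).trans (le_trans ?_ hrT)
      gcongr
  -- The function t M(p + t v) h f(v, t) is the expected variation of the ray solution in the
  -- direction h. The error in this first order approximation satisfies the ray equation up to
  -- O(‖h‖²) and is zero at t = 0, so it is O(‖h‖²) at t = 1.
  have est : ∀ v h : V, ‖v‖ < r → ‖v + h‖ < r →
      ‖f (v + h) 1 - f v 1 - M (p + v) h (f v 1)‖ ≤
        3 * (0 + ((C * r + C) * (3 * ‖x‖) + (C * r + C) * (C * (3 * ‖x‖))) * ‖h‖ ^ 2) := by
    intro v h hv hvh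
    have key := norm_le_of_deriv_le_unitInterval
      (f := fun t => f (v + h) t - f v t - t • M (p + t • v) h (f v t))
      (f' := fun t => M (p + t • (v + h)) (v + h) (f (v + h) t) - M (p + t • v) v (f v t) -
        (t • (fderiv ℝ M (p + t • v) v h (f v t) + M (p + t • v) h (M (p + t • v) v (f v t))) +
          (1 : ℝ) • M (p + t • v) h (f v t)))
      (δ := 0) (ε := ((C * r + C) * (3 * ‖x‖) + (C * r + C) * (C * (3 * ‖x‖))) * ‖h‖ ^ 2)
      le_rfl (by positivity) (fun t ht => ?_) ?_ (fun t ht => ?_) 1 (by simp)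
    · simpa using key
    · refine (((hf _ hvh).2.1 t ht).sub ((hf v hv).2.1 t ht)).sub ?_
      have h1 : HasDerivWithinAt (fun t => M (p + t • v) h) (fderiv ℝ M (p + t • v) v h)
          (Icc 0 1) t := by
        simpa using (Mline v hv t ht).clm_apply (hasDerivWithinAt_const t _ h)
      exact (hasDerivWithinAt_id t _).smul (h1.clm_apply ((hf v hv).2.1 t ht))
    · simp [(hf v hv).1, (hf _ hvh).1]
    · have hq := mem v hv t ht
      have hq' := mem _ hvh t ht
      obtain ⟨b1, b2⟩ := hb2 _ (Metric.ball_subset_ball hrR hq) _ (Metric.ball_subset_ball hrR hq')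
      have hqq : p + t • (v + h) - (p + t • v) = t • h := by module
      have hth : ‖t • h‖ ≤ ‖h‖ := by
        rw [norm_smul, Real.norm_of_nonneg ht.1]
        exact mul_le_of_le_one_left (norm_nonneg _) ht.2
      rw [hqq] at b1 b2
      have hfl := flat _ (hrU hq) _ (hFf v hv t ht) v h
      set y := f v t with hy
      set M' := M (p + t • (v + h))
      set M0 := M (p + t • v)
      set D := fderiv ℝ M (p + t • v)
      have hM0 : ‖M0‖ ≤ C := (hb _ (Metric.ball_subset_ball hrR hq)).2.1
      have hyn : ‖y‖ ≤ 3 * ‖x‖ := (hf v hv).2.2 t ht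
      have b1' : ‖M' - M0‖ ≤ C * ‖h‖ := b1.trans (by gcongr)
      have b2' : ‖M' - M0 - D (t • h)‖ ≤ C * ‖h‖ ^ 2 := b2.trans (by gcongr)
      -- Flatness replaces the derivative of M along v applied to h by the one along h applied to v,
      -- which is what the Taylor expansion of M' produces; the terms linear in h then cancel.
      have split : M' (v + h) (f (v + h) t) - M0 v y -
          (t • (D v h y + M0 h (M0 v y)) + (1 : ℝ) • M0 h y) =
          M' (v + h) (f (v + h) t - y - t • M0 h y) +
          (((M' - M0 - D (t • h)) v + (M' - M0) h) y +
            t • ((M' - M0) (v + h) + M0 h) (M0 h y)) := by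
        rw [hfl]
        simp only [map_add, map_sub, map_smul, add_apply, sub_apply, smul_apply, one_smul]
        module
      rw [split]
      refine (norm_add_le _ _).trans (add_le_add ?_ ?_)
      · refine (ContinuousLinearMap.le_of_opNorm_le _ (Bnd _ hvh t ht) _).trans ?_
        linarith [norm_nonneg (f (v + h) t - y - t • M0 h y)]
      · have n1 : ‖(M' - M0 - D (t • h)) v + (M' - M0) h‖ ≤ (C * r + C) * ‖h‖ ^ 2 := by
          refine (norm_add_le_of_le (ContinuousLinearMap.le_of_opNorm_le_of_le _ b2' hv.le)
            (ContinuousLinearMap.le_of_opNorm_le _ b1' _)).trans (le_of_eq (by ring))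
        have n2 : ‖(M' - M0) (v + h) + M0 h‖ ≤ (C * r + C) * ‖h‖ := by
          refine (norm_add_le_of_le (ContinuousLinearMap.le_of_opNorm_le_of_le _ b1' hvh.le)
            (ContinuousLinearMap.le_of_opNorm_le _ hM0 _)).trans (le_of_eq (by ring))
        have n3 : ‖M0 h y‖ ≤ C * ‖h‖ * (3 * ‖x‖) :=
          ContinuousLinearMap.le_of_opNorm_le_of_le _ (ContinuousLinearMap.le_of_opNorm_le _ hM0 _)
            hyn
        have n4 : ‖t • ((M' - M0) (v + h) + M0 h) (M0 h y)‖ ≤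
            (C * r + C) * ‖h‖ * (C * ‖h‖ * (3 * ‖x‖)) := by
          rw [norm_smul, Real.norm_of_nonneg ht.1]
          exact (mul_le_of_le_one_left (norm_nonneg _) ht.2).trans
            (ContinuousLinearMap.le_of_opNorm_le_of_le _ n2 n3)
        refine (norm_add_le_of_le (ContinuousLinearMap.le_of_opNorm_le_of_le _ n1 hyn) n4).trans
          (le_of_eq (by ring))
  refine ⟨r, hr, hrU, fun q => f (q - p) 1, ?_, fun q hq => ⟨?_, ?_⟩⟩
  · have h0 : ‖(0 : V)‖ < r := by simpa using hr
    have key := norm_le_of_deriv_le_unitInterval (f := fun t => f 0 t - x)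
      (f' := fun t => 0) le_rfl le_rfl (fun t ht => ?_) ?_ (fun t ht => by simp) 1 (by simp)
    · simpa [sub_eq_zero] using key
    · simpa using ((hf 0 h0).2.1 t ht).sub_const x
    · simp [(hf 0 h0).1]
  · have hv : ‖q - p‖ < r := mem_ball_iff_norm.1 hq
    simpa using hFf _ hv 1 (by simp)
  · rw [hasFDerivAt_iff_isLittleO_nhds_zero]
    refine Asymptotics.IsBigO.trans_isLittleO (g := fun h : V => ‖h‖ ^ 2) ?_ ?_
    · refine Asymptotics.IsBigO.of_bound
        (3 * ((C * r + C) * (3 * ‖x‖) + (C * r + C) * (C * (3 * ‖x‖)))) ?_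
      have : ∀ᶠ h : V in 𝓝 0, q + h ∈ Metric.ball p r := by
        apply ContinuousAt.eventually_mem (by fun_prop)
        simpa using Metric.isOpen_ball.mem_nhds hq
      filter_upwards [this] with h hh
      have e := est (q - p) h (mem_ball_iff_norm.1 hq) (by
        rwa [mem_ball_iff_norm, add_sub_right_comm] at hh)
      have e1 : q + h - p = q - p + h := by abel
      simp only [add_sub_cancel, ContinuousLinearMap.flip_apply, e1] at e ⊢
      refine e.trans (le_of_eq ?_)
      rw [Real.norm_of_nonneg (by positivity)]
      ring
    · have := (Asymptotics.isLittleO_norm_pow_id (E' := V) (n := 2) (by norm_num))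
      exact this

/-- Solutions of `ds = M s` are smooth. -/
theorem contDiffOn_of_hasFDerivAt [FiniteDimensional ℝ V] {U : Set V} (hU : IsOpen U)
    {M : V → V →L[ℝ] E →L[ℝ] E} (hM : ContDiffOn ℝ ∞ M U) {s : V → E}
    (hs : ∀ q ∈ U, HasFDerivAt s ((M q).flip (s q)) q) : ContDiffOn ℝ ∞ s U := by
  rw [contDiffOn_infty]
  intro n
  induction n with
  | zero => exact contDiffOn_zero.2 fun q hq => (hs q hq).continuousAt.continuousWithinAt
  | succ n ih =>
    push_cast
    rw [contDiffOn_succ_iff_fderiv_of_isOpen hU]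
    refine ⟨fun q hq => (hs q hq).differentiableAt.differentiableWithinAt, by simp, ?_⟩
    have h1 : ContDiffOn ℝ n (fun q => (M q).flip (s q)) U := by
      rw [contDiffOn_clm_apply]
      exact fun v => ((hM.of_le (natCast_le_infty n)).clm_apply contDiffOn_const).clm_apply ih
    exact h1.congr fun q hq => (hs q hq).fderiv

/-- Uniqueness for `ds = M s` on a ball. -/
theorem eqOn_zero_of_hasFDerivAt {p : V} {r : ℝ} {U : Set V}
    (hrU : Metric.ball p r ⊆ U) {M : V → V →L[ℝ] E →L[ℝ] E} (hM : ContinuousOn M U) {s : V → E}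
    (hs : ∀ q ∈ Metric.ball p r, HasFDerivAt s ((M q).flip (s q)) q) (h0 : s p = 0) :
    ∀ q ∈ Metric.ball p r, s q = 0 := by
  intro q hq
  have mem : ∀ t ∈ Icc (0 : ℝ) 1, p + t • (q - p) ∈ Metric.ball p r := by
    intro t ht
    rw [mem_ball_iff_norm, add_sub_cancel_left, norm_smul, Real.norm_of_nonneg ht.1]
    exact (mul_le_of_le_one_left (norm_nonneg _) ht.2).trans_lt (mem_ball_iff_norm.1 hq)
  have line : ∀ t : ℝ, HasDerivAt (fun t : ℝ => p + t • (q - p)) (q - p) t := by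
    intro t
    simpa using ((hasDerivAt_id t).smul_const (q - p)).const_add p
  have hc : ContinuousOn (fun t : ℝ => M (p + t • (q - p)) (q - p)) (Icc 0 1) :=
    (hM.comp (by fun_prop) fun t ht => hrU (mem t ht)).clm_apply continuousOn_const
  obtain ⟨K, hK⟩ := isCompact_Icc.exists_bound_of_continuousOn hc
  have hd : ∀ t ∈ Icc (0 : ℝ) 1, HasDerivAt (fun t : ℝ => s (p + t • (q - p)))
      (M (p + t • (q - p)) (q - p) (s (p + t • (q - p)))) t := fun t ht =>
    HasFDerivAt.comp_hasDerivAt (l := s) (f := fun t : ℝ => p + t • (q - p)) t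
      (hs _ (mem t ht)) (line t)
  have := eq_zero_of_abs_deriv_le_mul_abs_self_of_eq_zero_right (K := K) (a := 0) (b := 1)
    (fun t ht => (hd t ht).continuousAt.continuousWithinAt)
    (fun t ht => (hd t ⟨ht.1, ht.2.le⟩).hasDerivWithinAt) (by simpa using h0)
    (fun t ht => (ContinuousLinearMap.le_of_opNorm_le _ (hK t ⟨ht.1, ht.2.le⟩) _)) 1 (by simp)
  simpa using this

end Frobenius

/-! ### Partial derivatives and jets -/

section Calculus

variable {V : Set Plane} {f g : Plane → ℝ} {p q : Plane}

theorem IsOperatorOn.sum {ι : Type*} {U : Set Plane} {P : (Plane → ℝ) → Plane → ℝ}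
    (hP : IsOperatorOn U P) (s : Finset ι) {f : ι → Plane → ℝ}
    (hf : ∀ i ∈ s, ContDiffOn ℝ ∞ (f i) U) :
    EqOn (P fun q => ∑ i ∈ s, f i q) (fun q => ∑ i ∈ s, P (f i) q) U := by
  classical
  induction s using Finset.induction_on with
  | empty =>
    intro q hq
    simpa using hP.smul 0 (fun _ => 0) contDiffOn_const hq
  | insert a s ha ih =>
    intro q hq
    simp only [Finset.sum_insert ha]
    have h1 : ContDiffOn ℝ ∞ (fun q => ∑ i ∈ s, f i q) U :=
      ContDiffOn.sum fun i hi => hf i (Finset.mem_insert_of_mem hi)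
    rw [hP.add _ _ (hf a (Finset.mem_insert_self _ _)) h1 hq]
    simp only [ih (fun i hi => hf i (Finset.mem_insert_of_mem hi)) hq]

theorem IsOperatorOn.map_zero {U : Set Plane} {P : (Plane → ℝ) → Plane → ℝ}
    (hP : IsOperatorOn U P) {f : Plane → ℝ} (hf : EqOn f (fun _ => 0) U) (hq : q ∈ U) :
    P f q = 0 := by
  rw [hP.congr _ _ hf hq]
  simpa using hP.smul 0 (fun _ => 0) contDiffOn_const hq

theorem isOperatorOn_dx (hV : IsOpen V) : IsOperatorOn V dx :=
  isOperatorOn_fderiv hV contDiffOn_const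

theorem isOperatorOn_dy (hV : IsOpen V) : IsOperatorOn V dy :=
  isOperatorOn_fderiv hV contDiffOn_const

theorem differentiableAt_of_smooth (hV : IsOpen V) (hf : ContDiffOn ℝ ∞ f V) (hq : q ∈ V) :
    DifferentiableAt ℝ f q :=
  ((hf q hq).contDiffAt (hV.mem_nhds hq)).differentiableAt (by simp)

theorem clm_apply_eq (T : Covector) (v : Plane) : T v = v.1 * T ex + v.2 * T ey := by
  have : v = v.1 • ex + v.2 • ey := by ext <;> simp [ex, ey]
  conv_lhs => rw [this]
  simp

theorem fderiv_eq_dx_dy (f : Plane → ℝ) (q v : Plane) :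
    fderiv ℝ f q v = v.1 * dx f q + v.2 * dy f q := clm_apply_eq _ _

theorem dx_dy_comm (hV : IsOpen V) (hf : ContDiffOn ℝ ∞ f V) :
    EqOn (dx (dy f)) (dy (dx f)) V := by
  intro q hq
  have hc : ContDiffAt ℝ ∞ f q := (hf q hq).contDiffAt (hV.mem_nhds hq)
  have hd : DifferentiableAt ℝ (fderiv ℝ f) q :=
    ((hf.fderiv_of_isOpen (m := ∞) hV (by simp) q hq).contDiffAt
      (hV.mem_nhds hq)).differentiableAt (by simp)
  have h := hc.isSymmSndFDerivAt (by simpa using natCast_le_infty 2)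
  have e : ∀ v w : Plane, fderiv ℝ (fun q => fderiv ℝ f q v) q w = fderiv ℝ (fderiv ℝ f) q w v := by
    intro v w
    have := (hd.hasFDerivAt.clm_apply (hasFDerivAt_const v q)).fderiv
    rw [this]
    simp
  simp only [dx, dy]
  exact (e _ _).trans ((h.eq _ _).trans (e _ _).symm)

theorem partialD_smooth (hV : IsOpen V) (hf : ContDiffOn ℝ ∞ f V) (m n : ℕ) :
    ContDiffOn ℝ ∞ (partialD m n f) V := (isOperatorOn_partialD hV m n).smooth f hf

theorem dx_partialD (m n : ℕ) (f : Plane → ℝ) : dx (partialD m n f) = partialD (m + 1) n f :=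
  (Function.iterate_succ_apply' _ _ _).symm

theorem dy_partialD (hV : IsOpen V) (hf : ContDiffOn ℝ ∞ f V) (m n : ℕ) :
    EqOn (dy (partialD m n f)) (partialD m (n + 1) f) V := by
  induction m with
  | zero => exact fun q _ => congrFun (Function.iterate_succ_apply' dy n f).symm q
  | succ m ih =>
    rw [← dx_partialD, ← dx_partialD]
    exact (dx_dy_comm hV (partialD_smooth hV hf m n)).symm.trans ((isOperatorOn_dx hV).congr _ _ ih)

theorem partialD_dy (m n : ℕ) (f : Plane → ℝ) : partialD m n (dy f) = partialD m (n + 1) f := rfl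

theorem partialD_dx (hV : IsOpen V) (hf : ContDiffOn ℝ ∞ f V) (m n : ℕ) :
    EqOn (partialD m n (dx f)) (partialD (m + 1) n f) V := by
  induction n with
  | zero => exact fun q _ => rfl
  | succ n ih =>
    have hx := (isOperatorOn_dx hV).smooth f hf
    exact (dy_partialD hV hx m n).symm.trans
      (((isOperatorOn_dy hV).congr _ _ ih).trans (dy_partialD hV hf (m + 1) n))

/-- The bilinear map underlying `jetContract`. -/
def contractL {r k l : ℕ} (h : l + 1 ≤ k) : Plane →L[ℝ] Jet r k →L[ℝ] Jet r l :=
  LinearMap.toContinuousLinearMap ((LinearMap.toContinuousLinearMap (𝕜 := ℝ)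
      (E := Jet r k) (F' := Jet r l)).toLinearMap ∘ₗ
    LinearMap.mk₂ ℝ (fun v θ => jetContract h v θ)
      (fun v w θ => by ext; simp [jetContract]; ring)
      (fun c v θ => by ext; simp [jetContract]; ring)
      (fun v θ η => by ext α i; exact (by intros; ring : ∀ a b c d e f : ℝ,
        a * (b + c) + d * (e + f) = (a * b + d * e) + (a * c + d * f)) _ _ _ _ _ _)
      (fun c v θ => by ext α i; exact (by intros; ring : ∀ a b c d e : ℝ,
        a * (c * b) + d * (c * e) = c * (a * b + d * e)) _ _ _ _ _))

@[simp]
theorem contractL_apply {r k l : ℕ} (h : l + 1 ≤ k) (v : Plane) (θ : Jet r k) :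
    contractL h v θ = jetContract h v θ := rfl

/-- Total differential equations on jets rest on this: one more derivative of the jet field is read
off from the jet of next order. -/
theorem hasFDerivAt_jet {r k l : ℕ} (h : l + 1 ≤ k) (hV : IsOpen V) {u : Plane → Fin r → ℝ}
    (hu : ContDiffOn ℝ ∞ u V) (hq : q ∈ V) :
    HasFDerivAt (fun q => jet l q u) ((contractL h).flip (jet k q u)) q := by
  rw [hasFDerivAt_pi']
  intro α
  rw [hasFDerivAt_pi']
  intro i
  have hui : ContDiffOn ℝ ∞ (fun q => u q i) V := contDiffOn_pi.1 hu i
  have := (differentiableAt_of_smooth hV (partialD_smooth hV hui α.1.1 α.1.2) hq).hasFDerivAt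
  refine this.congr_fderiv (ContinuousLinearMap.ext fun v => ?_)
  rw [fderiv_eq_dx_dy, dx_partialD, dy_partialD hV hui _ _ hq]
  rfl

theorem jet_smooth {r k : ℕ} (hV : IsOpen V) {u : Plane → Fin r → ℝ} (hu : ContDiffOn ℝ ∞ u V) :
    ContDiffOn ℝ ∞ (fun q => jet k q u) V :=
  contDiffOn_pi.2 fun α => contDiffOn_pi.2 fun i =>
    partialD_smooth hV (contDiffOn_pi.1 hu i) α.1.1 α.1.2

theorem jetProj_jet {r k l : ℕ} (h : l ≤ k) (p : Plane) (u : Plane → Fin r → ℝ) :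
    jetProj h (jet k p u) = jet l p u := rfl

/-! ### Functions with prescribed derivatives at a point -/

open Polynomial in
theorem partialD_polynomial (A B : ℝ[X]) (p : Plane) (m n : ℕ) :
    partialD m n (fun q => A.eval (q.1 - p.1) * B.eval (q.2 - p.2)) =
      fun q => (derivative^[m] A).eval (q.1 - p.1) * (derivative^[n] B).eval (q.2 - p.2) := by
  have hA : ∀ (A : ℝ[X]) (q : Plane), HasFDerivAt (fun q : Plane => A.eval (q.1 - p.1))
      ((derivative A).eval (q.1 - p.1) • ContinuousLinearMap.fst ℝ ℝ ℝ) q := fun A q =>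
    HasDerivAt.comp_hasFDerivAt (f := fun q : Plane => q.1 - p.1) q (A.hasDerivAt (q.1 - p.1))
      ((hasFDerivAt_fst (𝕜 := ℝ)).sub_const p.1)
  have hB : ∀ (B : ℝ[X]) (q : Plane), HasFDerivAt (fun q : Plane => B.eval (q.2 - p.2))
      ((derivative B).eval (q.2 - p.2) • ContinuousLinearMap.snd ℝ ℝ ℝ) q := fun A q =>
    HasDerivAt.comp_hasFDerivAt (f := fun q : Plane => q.2 - p.2) q (A.hasDerivAt (q.2 - p.2))
      ((hasFDerivAt_snd (𝕜 := ℝ)).sub_const p.2)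
  have hx : ∀ A B : ℝ[X], dx (fun q => A.eval (q.1 - p.1) * B.eval (q.2 - p.2)) =
      fun q => (derivative A).eval (q.1 - p.1) * B.eval (q.2 - p.2) := by
    intro A B
    ext q
    simp only [dx, ((hA A q).fun_mul (hB B q)).fderiv]
    simp [ex]; ring
  have hy : ∀ A B : ℝ[X], dy (fun q => A.eval (q.1 - p.1) * B.eval (q.2 - p.2)) =
      fun q => A.eval (q.1 - p.1) * (derivative B).eval (q.2 - p.2) := by
    intro A B
    ext q
    simp only [dy, ((hA A q).fun_mul (hB B q)).fderiv]
    simp [ey]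
  induction m with
  | zero =>
    induction n with
    | zero => rfl
    | succ n ih =>
      have : partialD 0 (n + 1) = fun f => dy (partialD 0 n f) :=
        funext fun f => Function.iterate_succ_apply' dy n f
      rw [this]
      simp only [ih, hy, Function.iterate_succ_apply']
  | succ m ih => rw [← dx_partialD, ih, hx, Function.iterate_succ_apply']

open Polynomial in
theorem exists_partialD_eq (p : Plane) (k : ℕ) (c : ℕ → ℕ → ℝ) : ∃ f : Plane → ℝ,
    ContDiff ℝ ∞ f ∧ ∀ m n, partialD m n f p = if m + n ≤ k then c m n else 0 := by
  have smooth : ∀ A B : ℝ[X], ContDiff ℝ ∞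
      (fun q : Plane => A.eval (q.1 - p.1) * B.eval (q.2 - p.2)) := fun A B =>
    ((A.contDiff_aeval ∞).comp (contDiff_fst.sub contDiff_const)).mul
      ((B.contDiff_aeval ∞).comp (contDiff_snd.sub contDiff_const))
  -- The Taylor polynomial at p with the prescribed coefficients; it contains no monomial of degree
  -- above k.
  refine ⟨fun q => ∑ α ∈ (Finset.range (k + 1) ×ˢ Finset.range (k + 1)),
    (monomial α.1 (if α.1 + α.2 ≤ k then c α.1 α.2 / (α.1.factorial * α.2.factorial) else 0)).eval
      (q.1 - p.1) * (monomial α.2 (1 : ℝ)).eval (q.2 - p.2), ContDiff.sum fun α _ => smooth _ _,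
      fun m n => ?_⟩
  rw [(isOperatorOn_partialD isOpen_univ m n).sum _ (fun α _ => (smooth _ _).contDiffOn)
    (mem_univ p)]
  simp only [partialD_polynomial, sub_self, ← coeff_zero_eq_eval_zero, coeff_iterate_derivative,
    coeff_monomial, zero_add, Nat.descFactorial_self]
  split_ifs with h
  · rw [Finset.sum_eq_single (m, n)]
    · simp [h]; field_simp
    · rintro ⟨a, b⟩ - hab
      by_cases h1 : a = m
      · have : b ≠ n := fun h => hab (by simp [h1, h])
        simp [this]
      · simp [h1]
    · intro hn
      simp at hn; omega
  · refine Finset.sum_eq_zero ?_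
    rintro ⟨a, b⟩ -
    by_cases h1 : a = m
    · by_cases h2 : b = n
      · subst h1 h2; simp [h]
      · simp [h2]
    · simp [h1]

theorem exists_partialD_eq_vector {r : ℕ} (p : Plane) (k : ℕ) (c : ℕ → ℕ → Fin r → ℝ) :
    ∃ u : Plane → Fin r → ℝ, ContDiff ℝ ∞ u ∧
      ∀ m n i, partialD m n (fun q => u q i) p = if m + n ≤ k then c m n i else 0 := by
  choose f hf using fun i => exists_partialD_eq p k (fun m n => c m n i)
  exact ⟨fun q i => f i q, contDiff_pi.2 fun i => (hf i).1, fun m n i => (hf i).2 m n⟩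

/-- Identities between linear functions of jets may thus be checked on jets of smooth functions,
where they become rules of calculus. -/
theorem exists_jet_eq {r k : ℕ} (p : Plane) (θ : Jet r k) :
    ∃ u : Plane → Fin r → ℝ, ContDiff ℝ ∞ u ∧ jet k p u = θ := by
  obtain ⟨u, hu, h⟩ := exists_partialD_eq_vector p k
    (fun m n => if h : m + n ≤ k then θ ⟨(m, n), h⟩ else 0)
  refine ⟨u, hu, ?_⟩
  ext α i
  have := α.2
  simp only [jet, h, this, if_true, dif_pos]
  rfl

/-! ### Vanishing to a given order -/

/-- All derivatives of order less than `N` of `f` vanish at `p`. -/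
def VanishesTo (N : ℕ) (f : Plane → ℝ) (p : Plane) : Prop :=
  ∀ m n, m + n < N → partialD m n f p = 0

theorem VanishesTo.mono {M N : ℕ} (h : VanishesTo N f p) (hMN : M ≤ N) : VanishesTo M f p :=
  fun m n hmn => h m n (hmn.trans_le hMN)

/-- In the Leibniz rule every term that differentiates c contains a derivative of f of order less
than N. -/
theorem partialD_mul_of_vanishesTo (hV : IsOpen V) (hp : p ∈ V) {N : ℕ} :
    ∀ {c f : Plane → ℝ}, ContDiffOn ℝ ∞ c V → ContDiffOn ℝ ∞ f V → VanishesTo N f p →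
      ∀ m n, m + n ≤ N → partialD m n (fun q => c q * f q) p = c p * partialD m n f p := by
  have step : ∀ (v : Plane) (c f : Plane → ℝ), ContDiffOn ℝ ∞ c V → ContDiffOn ℝ ∞ f V →
      EqOn (fun q => fderiv ℝ (fun q => c q * f q) q v)
        (fun q => (fun q => fderiv ℝ c q v) q * f q + c q * (fun q => fderiv ℝ f q v) q) V := by
    intro v c f hc hf q hq
    simp only
    rw [fderiv_fun_mul (differentiableAt_of_smooth hV hc hq) (differentiableAt_of_smooth hV hf hq)]
    simp; ring
  induction N with
  | zero =>
    intro c f hc hf _ m n hmn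
    obtain ⟨rfl, rfl⟩ : m = 0 ∧ n = 0 := by omega
    rfl
  | succ N ih =>
    intro c f hc hf h m n hmn
    have gen : ∀ D : (Plane → ℝ) → Plane → ℝ, IsOperatorOn V D →
        (∀ c f : Plane → ℝ, ContDiffOn ℝ ∞ c V → ContDiffOn ℝ ∞ f V →
          EqOn (D fun q => c q * f q) (fun q => D c q * f q + c q * D f q) V) →
        ∀ a b, VanishesTo N (D f) p → a + b < N + 1 →
          partialD a b (D fun q => c q * f q) p = c p * partialD a b (D f) p := by
      intro D hD hl a b hDf hab
      have o := isOperatorOn_partialD hV a b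
      rw [o.congr _ _ (hl c f hc hf) hp,
        o.add _ _ ((hD.smooth c hc).mul hf) (hc.mul (hD.smooth f hf)) hp]
      simp only
      rw [ih (hD.smooth c hc) hf (h.mono (Nat.le_succ N)) a b (by omega),
        ih hc (hD.smooth f hf) hDf a b (by omega), h a b hab]
      ring
    cases m with
    | succ m =>
      rw [← partialD_dx hV (hc.mul hf) m n hp, ← partialD_dx hV hf m n hp]
      refine gen dx (isOperatorOn_dx hV) (step ex) m n (fun a b hab => ?_) (by omega)
      rw [partialD_dx hV hf a b hp]
      exact h (a + 1) b (by omega)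
    | zero =>
      cases n with
      | zero => rfl
      | succ n =>
        refine gen dy (isOperatorOn_dy hV) (step ey) 0 n (fun a b hab => ?_) (by omega)
        exact h a (b + 1) (by omega)

/-- `P` is a first order linear differential operator on `U` with smooth coefficients, with
principal symbol the vector field `X`. -/
def IsFirstOrder (U : Set Plane) (P : (Plane → ℝ) → Plane → ℝ) (X : Plane → Plane) : Prop :=
  ContDiffOn ℝ ∞ X U ∧ ∃ b : Plane → ℝ, ContDiffOn ℝ ∞ b U ∧
    ∀ V, IsOpen V → V ⊆ U → ∀ f, ContDiffOn ℝ ∞ f V →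
      EqOn (P f) (fun q => fderiv ℝ f q (X q) + b q * f q) V

theorem IsFirstOrder.smooth {U : Set Plane} {P : (Plane → ℝ) → Plane → ℝ} {X : Plane → Plane}
    (hP : IsFirstOrder U P X) (hV : IsOpen V) (hVU : V ⊆ U) (hf : ContDiffOn ℝ ∞ f V) :
    ContDiffOn ℝ ∞ (P f) V := by
  obtain ⟨hX, b, hb, h⟩ := hP
  exact (((isOperatorOn_fderiv hV (hX.mono hVU)).smooth f hf).add ((hb.mono hVU).mul hf)).congr
    (h V hV hVU f hf)

/-- Only the principal symbol survives: the zero order term and the derivatives of the coefficients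
meet derivatives of f that vanish at p. -/
theorem IsFirstOrder.partialD_of_vanishesTo {U : Set Plane} {P : (Plane → ℝ) → Plane → ℝ}
    {X : Plane → Plane} (hP : IsFirstOrder U P X) (hV : IsOpen V) (hVU : V ⊆ U)
    (hf : ContDiffOn ℝ ∞ f V) (hp : p ∈ V) {N : ℕ} (h : VanishesTo (N + 1) f p) {m n : ℕ}
    (hmn : m + n ≤ N) : partialD m n (P f) p =
      (X p).1 * partialD (m + 1) n f p + (X p).2 * partialD m (n + 1) f p := by
  obtain ⟨hX, b, hb, hPf⟩ := hP
  have hX := hX.mono hVU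
  have hb := hb.mono hVU
  have hX1 : ContDiffOn ℝ ∞ (fun q => (X q).1) V := contDiff_fst.comp_contDiffOn hX
  have hX2 : ContDiffOn ℝ ∞ (fun q => (X q).2) V := contDiff_snd.comp_contDiffOn hX
  have hx := (isOperatorOn_dx hV).smooth f hf
  have hy := (isOperatorOn_dy hV).smooth f hf
  have o := isOperatorOn_partialD hV m n
  have e : EqOn (P f) (fun q => ((X q).1 * dx f q + (X q).2 * dy f q) + b q * f q) V := by
    intro q hq
    exact (hPf V hV hVU f hf hq).trans (by simp only [fderiv_eq_dx_dy f q (X q)])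
  rw [o.congr _ _ e hp, o.add _ _ ((hX1.mul hx).add (hX2.mul hy)) (hb.mul hf) hp]
  simp only
  rw [o.add _ _ (hX1.mul hx) (hX2.mul hy) hp]
  simp only
  rw [partialD_mul_of_vanishesTo hV hp hX1 hx (N := N) (fun a c hac => by
      rw [partialD_dx hV hf a c hp]; exact h _ _ (by omega)) m n hmn,
    partialD_mul_of_vanishesTo hV hp hX2 hy (N := N) (fun a c hac => by
      rw [partialD_dy]; exact h _ _ (by omega)) m n hmn,
    partialD_mul_of_vanishesTo hV hp hb hf h m n (by omega), h m n (by omega),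
    partialD_dx hV hf m n hp, partialD_dy]
  ring

end Calculus

/-! ### The symbol of the abelian equation

A sequence `w` is regarded as the tuple of derivatives `w m = ∂_x^m ∂_y^(N - m) f` of some order
`N`; polynomials act on sequences through the shift. -/

section Symbol

open Polynomial

/-- The action of polynomials on sequences. -/
def act : ℝ[X] →ₐ[ℝ] Module.End ℝ (ℕ → ℝ) :=
  aeval (LinearMap.funLeft ℝ ℝ Nat.succ)

/-- The polynomial that corresponds to the derivative in the direction `v`. -/
def symPoly (v : Plane) : ℝ[X] := C v.1 * X + C v.2

theorem act_symPoly (v : Plane) (w : ℕ → ℝ) (m : ℕ) :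
    act (symPoly v) w m = v.1 * w (m + 1) + v.2 * w m := by
  simp [act, symPoly, LinearMap.funLeft_apply]

theorem act_apply (P : ℝ[X]) (w : ℕ → ℝ) (m : ℕ) :
    act P w m = ∑ k ∈ Finset.range (P.natDegree + 1), P.coeff k * w (m + k) := by
  have h : ∀ k, ((LinearMap.funLeft ℝ ℝ Nat.succ) ^ k : Module.End ℝ (ℕ → ℝ)) w m = w (m + k) := by
    intro k
    induction k generalizing w with
    | zero => rfl
    | succ k ih =>
      rw [pow_succ, Module.End.mul_apply, ih, LinearMap.funLeft_apply]
      rfl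
  rw [act, aeval_eq_sum_range]
  simp [h]

theorem act_mul (P Q : ℝ[X]) (w : ℕ → ℝ) : act (P * Q) w = act P (act Q w) := by
  rw [map_mul]; rfl

theorem act_eq_zero {P : ℝ[X]} {d m : ℕ} (hP : P.natDegree ≤ d) {w : ℕ → ℝ}
    (hw : ∀ k ≤ m + d, w k = 0) : act P w m = 0 := by
  rw [act_apply]
  refine Finset.sum_eq_zero fun k hk => ?_
  rw [hw (m + k) (by have := Finset.mem_range.1 hk; omega), mul_zero]

theorem act_congr {P : ℝ[X]} {d m : ℕ} (hP : P.natDegree ≤ d) {w w' : ℕ → ℝ}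
    (hw : ∀ k ≤ m + d, w k = w' k) : act P w m = act P w' m := by
  rw [← sub_eq_zero, ← Pi.sub_apply, ← map_sub]
  exact act_eq_zero hP fun k hk => by simp [hw k hk]

theorem natDegree_symPoly_le (v : Plane) : (symPoly v).natDegree ≤ 1 := natDegree_linear_le

theorem natDegree_prod_symPoly_le {ι : Type*} (s : Finset ι) (Y : ι → Plane) :
    (∏ i ∈ s, symPoly (Y i)).natDegree ≤ s.card :=
  (natDegree_prod_le _ _).trans ((Finset.sum_le_sum fun i _ => natDegree_symPoly_le (Y i)).trans
    (by simp))

/-- Linear independence of two plane vectors. -/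
def Indep (v w : Plane) : Prop := v.1 * w.2 - v.2 * w.1 ≠ 0

theorem Indep.eq_zero {v w : Plane} (h : Indep v w) {a b : ℝ} (h1 : v.1 * a + v.2 * b = 0)
    (h2 : w.1 * a + w.2 * b = 0) : a = 0 ∧ b = 0 := by
  constructor
  · refine (mul_eq_zero.1 (?_ : (v.1 * w.2 - v.2 * w.1) * a = 0)).resolve_left h
    linear_combination w.2 * h1 - v.2 * h2
  · refine (mul_eq_zero.1 (?_ : (v.1 * w.2 - v.2 * w.1) * b = 0)).resolve_left h
    linear_combination v.1 * h2 - w.1 * h1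

/-- The polynomial of v is coprime to each factor of the product, so the factors can be removed one
at a time. -/
theorem eq_zero_of_act_prod_eq_zero {ι : Type*} {v : Plane} {Y : ι → Plane} (s : Finset ι)
    (hY : ∀ i ∈ s, Indep v (Y i)) {k : ℕ} (hk : s.card ≤ k) {w : ℕ → ℝ}
    (hv : ∀ m < k, act (symPoly v) w m = 0)
    (hs : ∀ m, m + s.card ≤ k → act (∏ i ∈ s, symPoly (Y i)) w m = 0) : ∀ m ≤ k, w m = 0 := by
  classical
  induction s using Finset.induction_on with
  | empty => simpa using hs
  | insert a s ha ih =>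
    rw [Finset.card_insert_of_notMem ha] at hk hs
    refine ih (fun i hi => hY i (Finset.mem_insert_of_mem hi)) (by omega) ?_
    have key : ∀ m, m + (s.card + 1) ≤ k → act (∏ i ∈ s, symPoly (Y i)) w (m + 1) = 0 ∧
        act (∏ i ∈ s, symPoly (Y i)) w m = 0 := by
      intro m hm
      refine (hY a (Finset.mem_insert_self _ _)).eq_zero ?_ ?_
      · rw [← act_symPoly, ← act_mul, mul_comm, act_mul]
        exact act_eq_zero (natDegree_prod_symPoly_le s Y) fun j hj => hv j (by omega)
      · have := hs m hm
        rwa [Finset.prod_insert ha, act_mul, act_symPoly] at this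
    intro m hm
    rcases m with _ | m
    · exact (key 0 (by omega)).2
    · exact (key m (by omega)).1

variable {ι : Type*} [Fintype ι] {Y : Option ι → Plane}

/-- The symbol of the abelian equation on homogeneous jets of order `k`. -/
def symbolMap (Y : Option ι → Plane) (k : ℕ) :
    (Fin (k + 1) → ι → ℝ) →ₗ[ℝ] (Fin k → Option ι → ℝ) where
  toFun w m j := j.elim ((Y none).1 * ∑ i, w m.succ i + (Y none).2 * ∑ i, w m.castSucc i)
    fun i => (Y (some i)).1 * w m.succ i + (Y (some i)).2 * w m.castSucc i
  map_add' w w' := by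
    ext m j
    cases j <;> simp [Finset.sum_add_distrib] <;> ring
  map_smul' c w := by
    ext m j
    cases j <;> simp [← Finset.mul_sum] <;> ring

/-- Extension of a finite tuple by zero. -/
def extendZero {k : ℕ} (w : Fin k → ℝ) (m : ℕ) : ℝ := if h : m < k then w ⟨m, h⟩ else 0

theorem symbolMap_some (k : ℕ) (w : Fin (k + 1) → ι → ℝ) (m : Fin k) (i : ι) :
    symbolMap Y k w m (some i) =
      act (symPoly (Y (some i))) (extendZero fun m => w m i) m := by
  have := m.2
  rw [act_symPoly, extendZero, extendZero, dif_pos (by omega), dif_pos (by omega)]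
  rfl

theorem symbolMap_none (k : ℕ) (w : Fin (k + 1) → ι → ℝ) (m : Fin k) :
    symbolMap Y k w m none =
      act (symPoly (Y none)) (∑ i, extendZero fun m => w m i) m := by
  have h1 : (m : ℕ) + 1 < k + 1 := by omega
  have h2 : (m : ℕ) < k + 1 := by omega
  rw [act_symPoly]
  simp only [Finset.sum_apply, extendZero, dif_pos h1, dif_pos h2]
  rfl

variable [DecidableEq ι]

/-- The product of all symbols other than the i-th kills ∑ w_j, since it contains the symbol with
index `none`, and kills each w_j with j ≠ i, since it contains the j-th one. Hence it kills w_i, and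
its factors are independent of the i-th symbol, which also kills w_i. -/
theorem symbol_injective (hY : ∀ i j, i ≠ j → Indep (Y i) (Y j)) {w : ι → ℕ → ℝ}
    (h1 : ∀ m < Fintype.card ι, ∀ i, act (symPoly (Y (some i))) (w i) m = 0)
    (h0 : ∀ m < Fintype.card ι, act (symPoly (Y none)) (∑ i, w i) m = 0) (i : ι) :
    ∀ m ≤ Fintype.card ι, w i m = 0 := by
  have hcard : (Finset.univ.erase (some i) : Finset (Option ι)).card = Fintype.card ι := by
    simp
  have hpos : 0 < Fintype.card ι := Fintype.card_pos_iff.2 ⟨i⟩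
  refine eq_zero_of_act_prod_eq_zero (v := Y (some i)) (Y := Y) (Finset.univ.erase (some i))
    (fun j hj => hY _ _ (Finset.ne_of_mem_erase hj).symm) hcard.le (fun m hm => h1 m hm i) ?_
  intro m hm
  obtain rfl : m = 0 := by omega
  have cancel : ∀ j ∈ (Finset.univ.erase (some i) : Finset (Option ι)), ∀ z : ℕ → ℝ,
      (∀ m < Fintype.card ι, act (symPoly (Y j)) z m = 0) →
      act (∏ l ∈ Finset.univ.erase (some i), symPoly (Y l)) z 0 = 0 := by
    intro j hj z hz
    rw [← Finset.mul_prod_erase _ _ hj, mul_comm, act_mul]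
    refine act_eq_zero (d := Fintype.card ι - 1) ((natDegree_prod_symPoly_le _ _).trans ?_)
      fun k hk => hz k (by omega)
    rw [Finset.card_erase_of_mem hj, hcard]
  have hsum := cancel none (by simp) _ h0
  rw [map_sum, Finset.sum_apply, Finset.sum_eq_single i] at hsum
  · exact hsum
  · intro j _ hj
    exact cancel (some j) (by simp [hj]) _ fun m hm => h1 m hm j
  · simp

theorem symbolMap_injective (hY : ∀ i j, i ≠ j → Indep (Y i) (Y j)) :
    Function.Injective (symbolMap Y (Fintype.card ι)) := by
  rw [injective_iff_map_eq_zero]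
  intro w hw
  ext m i
  have := symbol_injective hY (w := fun i => extendZero fun m => w m i)
    (fun m hm i => by
      rw [← symbolMap_some _ w ⟨m, hm⟩ i, hw]; rfl)
    (fun m hm => by rw [← symbolMap_none _ w ⟨m, hm⟩, hw]; rfl) i m (by omega)
  rwa [extendZero, dif_pos m.2] at this

/-- Omitting the last or the first entry of w gives two tuples one order lower, both in the kernel
of the symbol there. -/
theorem symbolMap_succ_injective [Nonempty ι] (hY : ∀ i j, i ≠ j → Indep (Y i) (Y j)) :
    Function.Injective (symbolMap Y (Fintype.card ι + 1)) := by
  have hpos : 0 < Fintype.card ι := Fintype.card_pos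
  rw [injective_iff_map_eq_zero]
  intro w hw
  have h1 : (fun m i => w (Fin.castSucc m) i) = 0 := by
    apply (injective_iff_map_eq_zero _).1 (symbolMap_injective hY)
    ext m j
    have := congrFun (congrFun hw m.castSucc) j
    cases j <;> exact this
  have h2 : (fun m i => w (Fin.succ m) i) = 0 := by
    apply (injective_iff_map_eq_zero _).1 (symbolMap_injective hY)
    ext m j
    have := congrFun (congrFun hw m.succ) j
    cases j <;> exact this
  ext m i
  cases m using Fin.cases with
  | zero => exact congrFun (congrFun h1 0) i
  | succ m => exact congrFun (congrFun h2 m) i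

/-- The symbol is surjective in orders up to the number of unknown functions. -/
theorem exists_symbol_eq (hY : ∀ i j, i ≠ j → Indep (Y i) (Y j)) (t : ℕ → Option ι → ℝ) :
    ∃ w : ι → ℕ → ℝ, ∀ m < Fintype.card ι,
      (∀ i, act (symPoly (Y (some i))) (w i) m = t m (some i)) ∧
      act (symPoly (Y none)) (∑ i, w i) m = t m none := by
  -- Both spaces have dimension n(n + 1) for n unknowns. Lower orders are covered because the action
  -- does not depend on the order: only an initial segment of t and w is then used.
  have hs : Function.Surjective (symbolMap Y (Fintype.card ι)) := by
    rw [← LinearMap.injective_iff_surjective_of_finrank_eq_finrank]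
    · exact symbolMap_injective hY
    · simp [Module.finrank_pi_fintype]; ring
  obtain ⟨w, hw⟩ := hs fun m => t m
  refine ⟨fun i => extendZero fun m => w m i, fun m hm => ⟨fun i => ?_, ?_⟩⟩
  · rw [← symbolMap_some _ w ⟨m, hm⟩ i, hw]
  · rw [← symbolMap_none _ w ⟨m, hm⟩, hw]

/-- The functional that annihilates the image of the symbol in the first order where it is not
surjective. -/
def symbolObstruction (Y : Option ι → Plane) : (Option ι → ℕ → ℝ) →ₗ[ℝ] ℝ :=
  LinearMap.proj 0 ∘ₗ (act (∏ i, symPoly (Y (some i))) ∘ₗ LinearMap.proj none -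
    ∑ i, act (symPoly (Y none) * ∏ j ∈ Finset.univ.erase i, symPoly (Y (some j))) ∘ₗ
      LinearMap.proj (some i))

theorem symbolObstruction_apply (t : Option ι → ℕ → ℝ) :
    symbolObstruction Y t = act (∏ i, symPoly (Y (some i))) (t none) 0 -
      ∑ i, act (symPoly (Y none) * ∏ j ∈ Finset.univ.erase i, symPoly (Y (some j)))
        (t (some i)) 0 := by
  simp [symbolObstruction]

theorem natDegree_obstruction_le (i : ι) :
    (symPoly (Y none) * ∏ j ∈ Finset.univ.erase i, symPoly (Y (some j))).natDegree ≤
      Fintype.card ι := by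
  refine natDegree_mul_le.trans ((add_le_add (natDegree_symPoly_le _)
    (natDegree_prod_symPoly_le _ fun j => Y (some j))).trans ?_)
  rw [Finset.card_erase_of_mem (Finset.mem_univ i), Finset.card_univ]
  have : 0 < Fintype.card ι := Fintype.card_pos_iff.2 ⟨i⟩
  omega

theorem symbolObstruction_congr {t t' : Option ι → ℕ → ℝ}
    (h : ∀ j, ∀ m ≤ Fintype.card ι, t j m = t' j m) :
    symbolObstruction Y t = symbolObstruction Y t' := by
  rw [symbolObstruction_apply, symbolObstruction_apply]
  congr 1
  · exact act_congr (d := Fintype.card ι) ((natDegree_prod_symPoly_le _ fun j => Y (some j)).trans (by simp))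
      fun k hk => h _ k (by omega)
  · exact Finset.sum_congr rfl fun i _ => act_congr (natDegree_obstruction_le i)
      fun k hk => h _ k (by omega)

/-- By commutativity each w_i is acted on in both terms by the same product of all n + 1 symbols. -/
theorem symbolObstruction_symbol (w : ι → ℕ → ℝ) :
    symbolObstruction Y (fun j => j.elim (act (symPoly (Y none)) (∑ i, w i))
      fun i => act (symPoly (Y (some i))) (w i)) = 0 := by
  rw [symbolObstruction_apply]
  simp only [Option.elim]
  rw [← act_mul, map_sum, Finset.sum_apply, sub_eq_zero]
  refine Finset.sum_congr rfl fun i _ => ?_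
  rw [← act_mul, mul_assoc, Finset.prod_erase_mul _ _ (Finset.mem_univ i), mul_comm]

theorem exists_symbol_eq_of_obstruction [Nonempty ι] (hY : ∀ i j, i ≠ j → Indep (Y i) (Y j))
    {t : ℕ → Option ι → ℝ} (ht : symbolObstruction Y (fun j m => t m j) = 0) :
    ∃ w : ι → ℕ → ℝ, ∀ m < Fintype.card ι + 1,
      (∀ i, act (symPoly (Y (some i))) (w i) m = t m (some i)) ∧
      act (symPoly (Y none)) (∑ i, w i) m = t m none := by
  let Φ : (Fin (Fintype.card ι + 1) → Option ι → ℝ) →ₗ[ℝ] ℝ :=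
    { toFun := fun t => symbolObstruction Y fun j => extendZero fun m => t m j
      map_add' := fun t t' => by
        rw [← map_add]; congr 1; ext j m; simp only [extendZero, Pi.add_apply]; split_ifs <;> simp
      map_smul' := fun c t => by
        rw [RingHom.id_apply, ← map_smul]; congr 1; ext j m
        simp only [extendZero, Pi.smul_apply]; split_ifs <;> simp }
  -- A unit entry in the component `none`, placed at the degree of the product, gives its leading
  -- coefficient.
  have hΦ : Φ ≠ 0 := by
    have hne : ∏ i, symPoly (Y (some i)) ≠ 0 := by
      refine Finset.prod_ne_zero_iff.2 fun i _ h => hY (some i) none (by simp) ?_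
      have h0 := congrArg (coeff · 0) h
      have h1 := congrArg (coeff · 1) h
      simp [symPoly] at h0 h1
      simp [h0, h1]
    intro h0
    have := LinearMap.congr_fun h0 fun m j => j.elim
      (if (m : ℕ) = (∏ i, symPoly (Y (some i))).natDegree then 1 else 0) fun _ => 0
    refine hne (leadingCoeff_eq_zero.1 ?_)
    have hdeg : (∏ i, symPoly (Y (some i))).natDegree < Fintype.card ι + 1 :=
      Nat.lt_succ_of_le ((natDegree_prod_symPoly_le _ fun j => Y (some j)).trans (by simp))
    have hz : (extendZero fun _ : Fin (Fintype.card ι + 1) => (0 : ℝ)) = 0 := by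
      ext m; simp [extendZero]
    change symbolObstruction Y _ = 0 at this
    rw [symbolObstruction_apply] at this
    simp only [Option.elim, hz, map_zero, Pi.zero_apply, Finset.sum_const_zero, sub_zero] at this
    rw [act_apply, Finset.sum_eq_single (∏ i, symPoly (Y (some i))).natDegree] at this
    · simpa [extendZero, hdeg] using this
    · intro b _ hb
      simp only [extendZero, zero_add]
      split_ifs <;> simp_all
    · simp
  have hle : LinearMap.range (symbolMap Y (Fintype.card ι + 1)) ≤ LinearMap.ker Φ := by
    rintro _ ⟨w, rfl⟩
    rw [LinearMap.mem_ker]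
    refine Eq.trans ?_ (symbolObstruction_symbol (Y := Y) fun i => extendZero fun m => w m i)
    refine symbolObstruction_congr fun j m hm => ?_
    rw [extendZero, dif_pos (by omega)]
    cases j with
    | none => exact symbolMap_none _ w ⟨m, by omega⟩
    | some i => exact symbolMap_some _ w ⟨m, by omega⟩ i
  -- The image has dimension n(n + 2) by injectivity, and the kernel of a nonzero functional has
  -- dimension (n + 1)² - 1, the same number.
  have heq : LinearMap.range (symbolMap Y (Fintype.card ι + 1)) = LinearMap.ker Φ := by
    refine Submodule.eq_of_le_of_finrank_eq hle ?_
    have h1 := LinearMap.finrank_range_add_finrank_ker Φ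
    have h2 : Module.finrank ℝ (LinearMap.range Φ) = 1 := by
      rw [LinearMap.range_eq_top.2 (LinearMap.surjective hΦ)]
      simp
    rw [LinearMap.finrank_range_of_inj (symbolMap_succ_injective hY)]
    simp [Module.finrank_pi_fintype, h2] at h1 ⊢
    linarith
  have hmem : (fun (m : Fin (Fintype.card ι + 1)) => t m) ∈ LinearMap.ker Φ := by
    rw [LinearMap.mem_ker]
    refine Eq.trans (symbolObstruction_congr fun j m hm => ?_) ht
    rw [extendZero, dif_pos (by omega)]
  rw [← heq] at hmem
  obtain ⟨w, hw⟩ := hmem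
  refine ⟨fun i => extendZero fun m => w m i, fun m hm => ⟨fun i => ?_, ?_⟩⟩
  · rw [← symbolMap_some _ w ⟨m, hm⟩ i, hw]
  · rw [← symbolMap_none _ w ⟨m, hm⟩, hw]

end Symbol

/-! ### Linear differential operators in terms of jets -/

section Operators

/-- `jetProj` as a continuous linear map. -/
def jetProjL {r k l : ℕ} (h : l ≤ k) : Jet r k →L[ℝ] Jet r l :=
  LinearMap.toContinuousLinearMap (jetProj h)

@[simp]
theorem jetProjL_apply {r k l : ℕ} (h : l ≤ k) (θ : Jet r k) : jetProjL h θ = jetProj h θ := rfl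

/-- `Q` is a linear differential operator of order at most `k` on `U` with smooth coefficients. -/
def IsJetOperator {r : ℕ} (U : Set Plane) (k : ℕ) (Q : (Plane → Fin r → ℝ) → Plane → ℝ) : Prop :=
  ∃ c : Plane → Jet r k →L[ℝ] ℝ, ContDiffOn ℝ ∞ c U ∧ ∀ V, IsOpen V → V ⊆ U →
    ∀ u, ContDiffOn ℝ ∞ u V → ∀ q ∈ V, Q u q = c q (jet k q u)

variable {r k : ℕ} {U : Set Plane} {Q Q' : (Plane → Fin r → ℝ) → Plane → ℝ}

theorem isJetOperator_component (U : Set Plane) (i : Fin r) :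
    IsJetOperator U 0 fun u q => u q i :=
  ⟨fun _ => (ContinuousLinearMap.proj (R := ℝ) (φ := fun _ : Fin r => ℝ) i).comp
    (ContinuousLinearMap.proj (R := ℝ) (φ := fun _ : JetIndex 0 => Fin r → ℝ) ⟨(0, 0), le_rfl⟩),
    contDiffOn_const, fun _ _ _ _ _ _ _ => rfl⟩

theorem IsJetOperator.mono {l : ℕ} (hQ : IsJetOperator U k Q) (h : k ≤ l) :
    IsJetOperator U l Q := by
  obtain ⟨c, hc, hQ⟩ := hQ
  exact ⟨fun q => (c q).comp (jetProjL h), hc.clm_comp contDiffOn_const,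
    fun V hV hVU u hu q hq => hQ V hV hVU u hu q hq⟩

theorem IsJetOperator.sum {ι : Type*} {Q : ι → (Plane → Fin r → ℝ) → Plane → ℝ} (s : Finset ι)
    (hQ : ∀ i, IsJetOperator U k (Q i)) : IsJetOperator U k fun u q => ∑ i ∈ s, Q i u q := by
  choose c hc h using hQ
  refine ⟨fun q => ∑ i ∈ s, c i q, ContDiffOn.sum fun i _ => hc i, fun V hV hVU u hu q hq => ?_⟩
  rw [sum_apply]
  exact Finset.sum_congr rfl fun i _ => h i V hV hVU u hu q hq

theorem IsJetOperator.sub (hQ : IsJetOperator U k Q) (hQ' : IsJetOperator U k Q') :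
    IsJetOperator U k fun u q => Q u q - Q' u q := by
  obtain ⟨c, hc, h⟩ := hQ
  obtain ⟨c', hc', h'⟩ := hQ'
  refine ⟨fun q => c q - c' q, hc.sub hc', fun V hV hVU u hu q hq => ?_⟩
  beta_reduce
  rw [h V hV hVU u hu q hq, h' V hV hVU u hu q hq, sub_apply]

theorem IsJetOperator.smooth (hQ : IsJetOperator U k Q) {V : Set Plane} (hV : IsOpen V)
    (hVU : V ⊆ U) {u : Plane → Fin r → ℝ} (hu : ContDiffOn ℝ ∞ u V) : ContDiffOn ℝ ∞ (Q u) V := by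
  obtain ⟨c, hc, h⟩ := hQ
  exact ((hc.mono hVU).clm_apply (jet_smooth hV hu)).congr fun q hq => h V hV hVU u hu q hq

/-- The product rule for c(q) applied to the jet of u: the derivative of c keeps the order, and the
derivative of the jet field contracts the jet of next order with X. -/
theorem IsFirstOrder.isJetOperator_comp {P : (Plane → ℝ) → Plane → ℝ} {X : Plane → Plane}
    (hU : IsOpen U) (hP : IsFirstOrder U P X) (hQ : IsJetOperator U k Q) :
    IsJetOperator U (k + 1) fun u => P (Q u) := by
  have hQs := fun V (hV : IsOpen V) (hVU : V ⊆ U) u hu => hQ.smooth hV hVU (u := u) hu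
  obtain ⟨hX, b, hb, hP⟩ := hP
  obtain ⟨c, hc, h⟩ := hQ
  refine ⟨fun q => (fderiv ℝ c q (X q)).comp (jetProjL (Nat.le_succ k)) +
    (c q).comp (contractL (r := r) le_rfl (X q)) + b q • (c q).comp (jetProjL (Nat.le_succ k)),
    ?_, fun V hV hVU u hu q hq => ?_⟩
  · have h1 : ContDiffOn ℝ ∞ (fun q => fderiv ℝ c q (X q)) U :=
      (hc.fderiv_of_isOpen hU (by simp)).clm_apply hX
    have h2 : ContDiffOn ℝ ∞ (fun q => contractL (r := r) (k := k + 1) (l := k) le_rfl (X q)) U :=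
      (contractL (r := r) (k := k + 1) (l := k) le_rfl).contDiff.comp_contDiffOn hX
    exact ((h1.clm_comp contDiffOn_const).add (hc.clm_comp h2)).add
      (hb.smul (hc.clm_comp contDiffOn_const))
  · have hd : HasFDerivAt c (fderiv ℝ c q) q :=
      ((hc q (hVU hq)).contDiffAt (hU.mem_nhds (hVU hq))).differentiableAt (by simp) |>.hasFDerivAt
    have hj := hasFDerivAt_jet (l := k) (k := k + 1) le_rfl hV hu hq
    have he : Q u =ᶠ[𝓝 q] fun q => c q (jet k q u) :=
      Filter.eventuallyEq_of_mem (hV.mem_nhds hq) fun q hq => h V hV hVU u hu q hq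
    beta_reduce
    rw [hP V hV hVU _ (hQs V hV hVU u hu) hq]
    beta_reduce
    rw [he.fderiv_eq, (hd.clm_apply hj).fderiv, h V hV hVU u hu q hq]
    simp only [add_apply, ContinuousLinearMap.comp_apply, smul_apply, smul_eq_mul,
      ContinuousLinearMap.flip_apply, jetProjL_apply, jetProj_jet]
    ring

theorem isFirstOrder_fderiv (U : Set Plane) (v : Plane) :
    IsFirstOrder U (fun f q => fderiv ℝ f q v) fun _ => v :=
  ⟨contDiffOn_const, fun _ => 0, contDiffOn_const, fun _ _ _ _ _ q _ => by simp⟩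

theorem IsJetOperator.partialD (hU : IsOpen U) (hQ : IsJetOperator U k Q) (m n : ℕ) :
    IsJetOperator U (k + m + n) fun u => partialD m n (Q u) := by
  induction m with
  | zero =>
    induction n with
    | zero => exact hQ
    | succ n ih =>
      have := (isFirstOrder_fderiv U ey).isJetOperator_comp hU ih
      have e : ∀ f, Web.partialD 0 (n + 1) f = dy (Web.partialD 0 n f) :=
        fun f => Function.iterate_succ_apply' dy n f
      simp only [e]
      exact this
  | succ m ih =>
    have := ((isFirstOrder_fderiv U ex).isJetOperator_comp hU ih)
    simp only [← dx_partialD]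
    exact this.mono (by omega)

end Operators

/-! ### Systems of the type of the abelian equation -/

/-- Multi-indices of order less than `k`. -/
abbrev LowIndex (k : ℕ) : Type := {α : ℕ × ℕ // α.1 + α.2 < k}

instance (k : ℕ) : Fintype (LowIndex k) :=
  Fintype.subtype (((Finset.range k) ×ˢ (Finset.range k)).filter fun α => α.1 + α.2 < k) (by
    intro α
    simp only [Finset.mem_filter, Finset.mem_product, Finset.mem_range]
    omega)

/-- A system `P₁ u₁ = ⋯ = P_n u_n = 0`, `P₀ u₁ + ⋯ + P₀ u_n = 0` with first order operators `P_j`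
whose symbols are pairwise linearly independent vector fields. -/
structure FirstOrderSystem (n : ℕ) where
  domain : Set Plane
  isOpen : IsOpen domain
  op : Option (Fin n) → (Plane → ℝ) → Plane → ℝ
  vec : Option (Fin n) → Plane → Plane
  firstOrder : ∀ j, IsFirstOrder domain (op j) (vec j)
  indep : ∀ p ∈ domain, ∀ i j, i ≠ j → Indep (vec i p) (vec j p)

/-- Entries of a tuple, with their sum as the entry with index `none`. -/
def withSum {n : ℕ} {A : Type*} [AddCommMonoid A] (w : Fin n → A) (j : Option (Fin n)) : A :=
  j.elim (∑ i, w i) w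

/-- The jet with the given top order part and no lower order part. -/
def topJet {n : ℕ} (k : ℕ) (w : Fin n → ℕ → ℝ) : Jet n k :=
  fun α i => if α.1.1 + α.1.2 = k then w i α.1.1 else 0

/-- Extension of jets by zero. -/
def extendJet {n : ℕ} (k l : ℕ) (θ : Jet n k) : Jet n l :=
  fun α => if h : α.1.1 + α.1.2 ≤ k then θ ⟨α.1, h⟩ else 0

theorem extendJet_of_le {n k l : ℕ} {θ : Jet n k} {α : JetIndex l} (h : α.1.1 + α.1.2 ≤ k) :
    extendJet k l θ α = θ ⟨α.1, h⟩ := dif_pos h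

theorem extendJet_of_not_le {n k l : ℕ} {θ : Jet n k} {α : JetIndex l} (h : ¬α.1.1 + α.1.2 ≤ k) :
    extendJet k l θ α = 0 := dif_neg h

theorem jetProj_extendJet {n k l : ℕ} (h : k ≤ l) (θ : Jet n k) :
    jetProj h (extendJet k l θ) = θ := by
  ext α i
  have := α.2
  change extendJet k l θ ⟨α.1, _⟩ i = _
  simp only [extendJet, dif_pos this]
  rfl

theorem jetProj_topJet {n k : ℕ} (w : Fin n → ℕ → ℝ) :
    jetProj (Nat.le_succ k) (topJet (k + 1) w) = 0 := by
  ext α i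
  have := α.2
  change (if α.1.1 + α.1.2 = k + 1 then _ else (0 : ℝ)) = 0
  rw [if_neg (by omega)]

theorem eq_topJet_of_jetProj_eq_zero {n k : ℕ} {θ : Jet n (k + 1)}
    (h : jetProj (Nat.le_succ k) θ = 0) : θ = topJet (k + 1) fun i m =>
      if hm : m ≤ k + 1 then θ ⟨(m, k + 1 - m), by simp only; omega⟩ i else 0 := by
  ext ⟨⟨a, b⟩, hab⟩ i
  simp only [topJet]
  simp only at hab
  split_ifs with h1 h2
  · have : b = k + 1 - a := by omega
    subst this; rfl
  · omega
  · exact congrFun (congrFun h ⟨(a, b), by simp only; omega⟩) i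

namespace FirstOrderSystem

variable {n : ℕ} (S : FirstOrderSystem n)

/-- The left-hand sides of the equations. -/
def eqn (u : Plane → Fin n → ℝ) : Option (Fin n) → Plane → ℝ
  | none => fun p => ∑ i, S.op none (fun q => u q i) p
  | some i => S.op (some i) fun q => u q i

theorem isJetOperator_eqn (j : Option (Fin n)) :
    IsJetOperator S.domain 1 fun u => S.eqn u j := by
  cases j with
  | none =>
    exact IsJetOperator.sum _ fun i =>
      (S.firstOrder none).isJetOperator_comp S.isOpen (isJetOperator_component _ i)
  | some i =>
    exact (S.firstOrder (some i)).isJetOperator_comp S.isOpen (isJetOperator_component _ i)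

theorem eqn_smooth {V : Set Plane} (hV : IsOpen V) (hVS : V ⊆ S.domain) {u : Plane → Fin n → ℝ}
    (hu : ContDiffOn ℝ ∞ u V) (j : Option (Fin n)) : ContDiffOn ℝ ∞ (S.eqn u j) V :=
  (S.isJetOperator_eqn j).smooth hV hVS hu

theorem exists_prolongedEqn (k : ℕ) :
    ∃ F : Plane → Jet n k →L[ℝ] (LowIndex k → Option (Fin n) → ℝ), ContDiffOn ℝ ∞ F S.domain ∧
      ∀ V, IsOpen V → V ⊆ S.domain → ∀ u, ContDiffOn ℝ ∞ u V → ∀ q ∈ V, ∀ α j,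
        F q (jet k q u) α j = partialD α.1.1 α.1.2 (S.eqn u j) q := by
  have : ∀ (α : LowIndex k) (j : Option (Fin n)),
      IsJetOperator S.domain k fun u => partialD α.1.1 α.1.2 (S.eqn u j) := fun α j =>
    ((S.isJetOperator_eqn j).partialD S.isOpen _ _).mono (by have := α.2; omega)
  choose c hc h using this
  refine ⟨fun q => ContinuousLinearMap.pi fun α => ContinuousLinearMap.pi fun j => c α j q, ?_,
    fun V hV hVU u hu q hq α j => (h α j V hV hVU u hu q hq).symm⟩
  refine contDiffOn_clm_apply.2 fun θ => contDiffOn_pi.2 fun α => contDiffOn_pi.2 fun j => ?_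
  exact (hc α j).clm_apply contDiffOn_const

/-- The derivatives of order less than `k` of the equations, as linear functions of `k`-jets. -/
def prolongedEqn (k : ℕ) : Plane → Jet n k →L[ℝ] (LowIndex k → Option (Fin n) → ℝ) :=
  (S.exists_prolongedEqn k).choose

theorem prolongedEqn_smooth (k : ℕ) : ContDiffOn ℝ ∞ (S.prolongedEqn k) S.domain :=
  (S.exists_prolongedEqn k).choose_spec.1

theorem prolongedEqn_jet {k : ℕ} {V : Set Plane} (hV : IsOpen V) (hVS : V ⊆ S.domain)
    {u : Plane → Fin n → ℝ} (hu : ContDiffOn ℝ ∞ u V) {q : Plane} (hq : q ∈ V) (α : LowIndex k)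
    (j : Option (Fin n)) :
    S.prolongedEqn k q (jet k q u) α j = partialD α.1.1 α.1.2 (S.eqn u j) q :=
  (S.exists_prolongedEqn k).choose_spec.2 V hV hVS u hu q hq α j

variable {S} {p : Plane}

/-- The equations of low order do not depend on the order of the jet on which they are evaluated. -/
theorem prolongedEqn_jetProj {k l : ℕ} (h : l ≤ k) (hp : p ∈ S.domain) (θ : Jet n k)
    (α : LowIndex l) (j : Option (Fin n)) :
    S.prolongedEqn l p (jetProj h θ) α j =
      S.prolongedEqn k p θ ⟨α.1, α.2.trans_le h⟩ j := by
  obtain ⟨u, hu, rfl⟩ := exists_jet_eq p θ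
  rw [jetProj_jet, S.prolongedEqn_jet S.isOpen subset_rfl hu.contDiffOn hp,
    S.prolongedEqn_jet S.isOpen subset_rfl hu.contDiffOn hp]

theorem partialD_eqn_of_vanishesTo {V : Set Plane} (hV : IsOpen V) (hVS : V ⊆ S.domain)
    {u : Plane → Fin n → ℝ} (hu : ContDiffOn ℝ ∞ u V) (hp : p ∈ V) {N : ℕ}
    (h : ∀ i, VanishesTo (N + 1) (fun q => u q i) p) {a b : ℕ} (hab : a + b ≤ N)
    (j : Option (Fin n)) : partialD a b (S.eqn u j) p =
      (S.vec j p).1 * withSum (fun i => partialD (a + 1) b (fun q => u q i) p) j +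
      (S.vec j p).2 * withSum (fun i => partialD a (b + 1) (fun q => u q i) p) j := by
  have hui : ∀ i, ContDiffOn ℝ ∞ (fun q => u q i) V := contDiffOn_pi.1 hu
  cases j with
  | none =>
    have := (isOperatorOn_partialD hV a b).sum Finset.univ
      (fun i _ => (S.firstOrder none).smooth hV hVS (hui i)) hp
    refine this.trans ?_
    simp only [withSum, Option.elim, Finset.mul_sum, ← Finset.sum_add_distrib]
    exact Finset.sum_congr rfl fun i _ =>
      (S.firstOrder none).partialD_of_vanishesTo hV hVS (hui i) hp (h i) hab
  | some i => exact (S.firstOrder (some i)).partialD_of_vanishesTo hV hVS (hui i) hp (h i) hab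

/-- The link between analysis and algebra: adding a pure top order part to a jet changes only the
equations of top order, and changes them by the symbol. -/
theorem prolongedEqn_topJet {k : ℕ} (hp : p ∈ S.domain) (w : Fin n → ℕ → ℝ)
    (α : LowIndex (k + 1)) (j : Option (Fin n)) :
    S.prolongedEqn (k + 1) p (topJet (k + 1) w) α j =
      if α.1.1 + α.1.2 = k then act (symPoly (S.vec j p)) (withSum w j) α.1.1 else 0 := by
  obtain ⟨u, hu, hu'⟩ := exists_jet_eq p (topJet (k + 1) w)
  have hval : ∀ a b, a + b ≤ k + 1 → ∀ i, partialD a b (fun q => u q i) p =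
      if a + b = k + 1 then w i a else 0 := fun a b hab i =>
    congrFun (congrFun hu' ⟨(a, b), hab⟩) i
  have hα := α.2
  rw [← hu', S.prolongedEqn_jet S.isOpen subset_rfl hu.contDiffOn hp,
    partialD_eqn_of_vanishesTo S.isOpen subset_rfl hu.contDiffOn hp (N := k)
      (fun i a b hab => by rw [hval a b (by omega), if_neg (by omega)]) (by omega)]
  simp only [hval _ _ (by omega : α.1.1 + 1 + α.1.2 ≤ k + 1),
    hval _ _ (by omega : α.1.1 + (α.1.2 + 1) ≤ k + 1)]
  rw [act_symPoly]
  split_ifs with h1 h2 h3 <;> first | omega | skip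
  · cases j <;> simp [withSum]
  · cases j <;> simp [withSum]

/-- An arbitrary extension of θ already has the right equations in low order. Those of top order are
corrected by a homogeneous jet, which exists because the symbol is surjective in orders up to n. -/
theorem exists_lift {k : ℕ} (hk : k + 1 ≤ n) (hp : p ∈ S.domain) (θ : Jet n k)
    (t : LowIndex (k + 1) → Option (Fin n) → ℝ)
    (ht : ∀ (α : LowIndex k) j, S.prolongedEqn k p θ α j = t ⟨α.1, α.2.trans (Nat.lt_succ_self k)⟩ j) :
    ∃ θ' : Jet n (k + 1), jetProj (Nat.le_succ k) θ' = θ ∧ S.prolongedEqn (k + 1) p θ' = t := by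
  set θ₀ := extendJet k (k + 1) θ with hθ₀
  obtain ⟨w, hw⟩ := exists_symbol_eq (S.indep p hp) fun m j =>
    if hm : m ≤ k then t ⟨(m, k - m), by simp only; omega⟩ j -
      S.prolongedEqn (k + 1) p θ₀ ⟨(m, k - m), by simp only; omega⟩ j else 0
  have hπ : jetProj (Nat.le_succ k) θ₀ = θ := jetProj_extendJet _ θ
  refine ⟨θ₀ + topJet (k + 1) w, by rw [map_add, hπ, jetProj_topJet, add_zero], ?_⟩
  ext ⟨⟨a, b⟩, hab⟩ j
  rw [map_add, Pi.add_apply, Pi.add_apply, prolongedEqn_topJet hp]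
  simp only at hab ⊢
  split_ifs with h
  · have hb : b = k - a := by omega
    subst hb
    have key : act (symPoly (S.vec j p)) (withSum w j) a =
        if hm : a ≤ k then t ⟨(a, k - a), by simp only; omega⟩ j -
          S.prolongedEqn (k + 1) p θ₀ ⟨(a, k - a), by simp only; omega⟩ j else 0 := by
      have := hw a (by simp; omega)
      cases j with
      | none => exact this.2
      | some i => exact this.1 i
    rw [key, dif_pos (by omega)]
    ring
  · have := ht ⟨(a, b), by simp only; omega⟩ j
    rw [← hπ, prolongedEqn_jetProj _ hp] at this
    rw [add_zero]
    exact this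

theorem prolongedEqn_surjective {k : ℕ} (hk : k ≤ n) (hp : p ∈ S.domain) :
    Function.Surjective (S.prolongedEqn k p) := by
  induction k with
  | zero => exact fun t => ⟨0, funext fun α => absurd α.2 (by omega)⟩
  | succ k ih =>
    intro t
    obtain ⟨θ, hθ⟩ := ih (by omega) fun α => t ⟨α.1, α.2.trans (Nat.lt_succ_self k)⟩
    obtain ⟨θ', -, h⟩ := exists_lift hk hp θ t fun α j => by rw [hθ]
    exact ⟨θ', h⟩

/-- The jet is homogeneous of order n, where the symbol is injective. -/
theorem jet_eq_zero_of_prolongedEqn {k : ℕ} (hk : k + 1 = n) (hp : p ∈ S.domain)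
    {θ : Jet n (k + 1)} (h0 : jetProj (Nat.le_succ k) θ = 0)
    (h : ∀ (α : LowIndex (k + 1)) j, α.1.1 + α.1.2 = k → S.prolongedEqn (k + 1) p θ α j = 0) :
    θ = 0 := by
  rw [eq_topJet_of_jetProj_eq_zero h0] at h ⊢
  set w : Fin n → ℕ → ℝ := fun i m =>
    if hm : m ≤ k + 1 then θ ⟨(m, k + 1 - m), by simp only; omega⟩ i else 0
  have key : ∀ m < Fintype.card (Fin n), ∀ j,
      act (symPoly (S.vec j p)) (withSum w j) m = 0 := by
    intro m hm j
    rw [Fintype.card_fin] at hm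
    have := h ⟨(m, k - m), by simp only; omega⟩ j (by simp only; omega)
    rw [prolongedEqn_topJet hp] at this
    simp only at this
    rwa [if_pos (by omega)] at this
  have := symbol_injective (S.indep p hp) (w := w) (fun m hm i => key m hm (some i))
    (fun m hm => key m hm none)
  ext α i
  have hα := α.2
  simp only [topJet]
  rw [this i α.1.1 (by simp; omega)]
  simp

end FirstOrderSystem

/-- An entry of a tuple of derivatives of order less than `k`, taken to be zero in order `k` and
above. -/
def entry {n k : ℕ} (j : Option (Fin n)) (a b : ℕ) : (LowIndex k → Option (Fin n) → ℝ) →ₗ[ℝ] ℝ :=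
  if h : a + b < k then LinearMap.proj j ∘ₗ LinearMap.proj ⟨(a, b), h⟩ else 0

theorem entry_apply {n k : ℕ} (j : Option (Fin n)) (a b : ℕ)
    (g : LowIndex k → Option (Fin n) → ℝ) :
    entry j a b g = if h : a + b < k then g ⟨(a, b), h⟩ j else 0 := by
  unfold entry
  split_ifs <;> rfl

/-- The formal derivative of a tuple of derivatives of order less than `k`, the missing derivatives
of order `k` being replaced by zero. -/
def truncatedContract {n : ℕ} (k : ℕ) :
    Plane →L[ℝ] (LowIndex k → Option (Fin n) → ℝ) →L[ℝ] (LowIndex k → Option (Fin n) → ℝ) :=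
  LinearMap.toContinuousLinearMap ((LinearMap.toContinuousLinearMap (𝕜 := ℝ)
      (E := LowIndex k → Option (Fin n) → ℝ)
      (F' := LowIndex k → Option (Fin n) → ℝ)).toLinearMap ∘ₗ
    LinearMap.mk₂ ℝ (fun v g α j =>
        v.1 * entry j (α.1.1 + 1) α.1.2 g + v.2 * entry j α.1.1 (α.1.2 + 1) g)
      (fun v w g => by ext; simp only [Pi.add_apply, Prod.fst_add, Prod.snd_add]; ring)
      (fun c v g => by ext; simp [mul_assoc]; ring)
      (fun v g g' => by ext; simp only [Pi.add_apply, map_add]; ring)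
      (fun c v g => by ext; simp only [Pi.smul_apply, map_smul, smul_eq_mul]; ring))

theorem truncatedContract_apply {n k : ℕ} (v : Plane) (g : LowIndex k → Option (Fin n) → ℝ)
    (α : LowIndex k) (j : Option (Fin n)) : truncatedContract k v g α j =
      v.1 * (if h : α.1.1 + 1 + α.1.2 < k then g ⟨(α.1.1 + 1, α.1.2), h⟩ j else 0) +
      v.2 * (if h : α.1.1 + (α.1.2 + 1) < k then g ⟨(α.1.1, α.1.2 + 1), h⟩ j else 0) := by
  rw [← entry_apply, ← entry_apply]
  rfl

theorem jet_ext_of_contract {n k : ℕ} {θ η : Jet n (k + 1)}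
    (h : jetProj (Nat.le_succ k) θ = jetProj (Nat.le_succ k) η)
    (hc : ∀ v, jetContract (l := k) le_rfl v θ = jetContract le_rfl v η) : θ = η := by
  ext ⟨⟨a, b⟩, hab⟩ i
  simp only at hab
  by_cases h0 : a + b ≤ k
  · exact congrFun (congrFun h ⟨(a, b), h0⟩) i
  rcases a with _ | a
  · obtain ⟨b, rfl⟩ : ∃ b', b = b' + 1 := ⟨b - 1, by omega⟩
    simpa [jetContract, ey] using congrFun (congrFun (hc ey) ⟨(0, b), by simp only; omega⟩) i
  · simpa [jetContract, ex] using congrFun (congrFun (hc ex) ⟨(a, b), by simp only; omega⟩) i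

/-! ### The connection on jets of order n - 1 and its curvature. -/

namespace FirstOrderSystem

variable {n : ℕ} (S : FirstOrderSystem n)

/-- The part of order exactly `k` of the prolonged equation. -/
def topEqn (k : ℕ) : Plane → Jet n (k + 1) →L[ℝ] (Fin (k + 1) → Option (Fin n) → ℝ) := fun p =>
  ContinuousLinearMap.pi fun m => (ContinuousLinearMap.proj (R := ℝ)
    (φ := fun _ : LowIndex (k + 1) => Option (Fin n) → ℝ)
      ⟨(m, k - m), by have := m.2; simp only; omega⟩).comp (S.prolongedEqn (k + 1) p)

/-- A `(k + 1)`-jet is determined by its projection and the equations of top order `k`. -/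
def splitting (k : ℕ) (p : Plane) :
    Jet n (k + 1) →L[ℝ] Jet n k × (Fin (k + 1) → Option (Fin n) → ℝ) :=
  (jetProjL (Nat.le_succ k)).prod (S.topEqn k p)

/-- The lift of `k`-jets to `(k + 1)`-jets that satisfy the equations in top order. -/
def liftL (k : ℕ) (p : Plane) : Jet n k →L[ℝ] Jet n (k + 1) :=
  (ContinuousLinearMap.inverse (S.splitting k p)).comp (ContinuousLinearMap.inl ℝ _ _)

/-- The connection form on `k`-jets. -/
def connForm (k : ℕ) (p : Plane) : Plane →L[ℝ] Jet n k →L[ℝ] Jet n k :=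
  ((ContinuousLinearMap.compL ℝ (Jet n k) (Jet n (k + 1)) (Jet n k)).flip (S.liftL k p)).comp
    (contractL le_rfl)

@[simp]
theorem connForm_apply (k : ℕ) (p v : Plane) (θ : Jet n k) :
    S.connForm k p v θ = jetContract le_rfl v (S.liftL k p θ) := rfl

variable {S} {p : Plane} {k : ℕ}

theorem topEqn_eq_zero_iff {θ : Jet n (k + 1)} : S.topEqn k p θ = 0 ↔
    ∀ (α : LowIndex (k + 1)) j, α.1.1 + α.1.2 = k → S.prolongedEqn (k + 1) p θ α j = 0 := by
  constructor
  · rintro h ⟨⟨a, b⟩, hab⟩ j he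
    simp only at he hab
    have := congrFun (congrFun h ⟨a, by omega⟩) j
    obtain rfl : b = k - a := by omega
    exact this
  · intro h
    ext m j
    exact h _ j (by have := m.2; simp only; omega)

/-- Injectivity is that of the symbol in order n. For surjectivity, `exists_lift` is given the low
order equations of θ and the prescribed ones in top order. -/
theorem exists_splitting_equiv (hk : k + 1 = n) (hp : p ∈ S.domain) :
    ∃ e : Jet n (k + 1) ≃L[ℝ] Jet n k × (Fin (k + 1) → Option (Fin n) → ℝ),
      (e : Jet n (k + 1) →L[ℝ] _) = S.splitting k p := by
  have hinj : LinearMap.ker (S.splitting k p).toLinearMap = ⊥ := by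
    rw [LinearMap.ker_eq_bot']
    intro θ hθ
    have h1 : jetProj (Nat.le_succ k) θ = 0 := congrArg Prod.fst hθ
    have h2 : S.topEqn k p θ = 0 := congrArg Prod.snd hθ
    exact jet_eq_zero_of_prolongedEqn hk hp h1 (topEqn_eq_zero_iff.1 h2)
  have hsurj : LinearMap.range (S.splitting k p).toLinearMap = ⊤ := by
    rw [LinearMap.range_eq_top]
    rintro ⟨θ, t⟩
    obtain ⟨θ', h1, h2⟩ := exists_lift hk.le hp θ (fun α j =>
      if h : α.1.1 + α.1.2 < k then S.prolongedEqn k p θ ⟨α.1, h⟩ j else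
        t ⟨α.1.1, by have := α.2; omega⟩ j) (fun α j => by simp only [dif_pos α.2])
    refine ⟨θ', Prod.ext h1 ?_⟩
    ext m j
    change S.prolongedEqn (k + 1) p θ' ⟨(m, k - m), _⟩ j = _
    rw [h2]
    exact dif_neg (by have := m.2; simp only; omega)
  exact ⟨ContinuousLinearEquiv.ofBijective (S.splitting k p) hinj hsurj,
    ContinuousLinearEquiv.coe_ofBijective _ _ _⟩

theorem splitting_smooth : ContDiffOn ℝ ∞ (S.splitting k) S.domain := by
  refine contDiffOn_clm_apply.2 fun θ => contDiffOn_const.prodMk ?_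
  exact contDiffOn_pi.2 fun m =>
    contDiffOn_pi.1 ((S.prolongedEqn_smooth (k + 1)).clm_apply contDiffOn_const) _

theorem splitting_inverse_smooth (hk : k + 1 = n) :
    ContDiffOn ℝ ∞ (fun p => ContinuousLinearMap.inverse (S.splitting k p)) S.domain := by
  intro p hp
  obtain ⟨e, he⟩ := exists_splitting_equiv hk hp
  have := contDiffAt_map_inverse (𝕜 := ℝ) (n := ∞) e
  rw [he] at this
  exact this.comp_contDiffWithinAt p (S.splitting_smooth p hp)

theorem liftL_smooth (hk : k + 1 = n) : ContDiffOn ℝ ∞ (S.liftL k) S.domain :=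
  (splitting_inverse_smooth hk).clm_comp contDiffOn_const

theorem connForm_smooth (hk : k + 1 = n) : ContDiffOn ℝ ∞ (S.connForm k) S.domain := by
  refine contDiffOn_clm_apply.2 fun v => contDiffOn_clm_apply.2 fun θ => ?_
  exact (contractL (r := n) (k := k + 1) (l := k) le_rfl v).contDiff.comp_contDiffOn
    ((liftL_smooth hk).clm_apply contDiffOn_const)

theorem splitting_liftL (hk : k + 1 = n) (hp : p ∈ S.domain) (θ : Jet n k) :
    S.splitting k p (S.liftL k p θ) = (θ, 0) := by
  obtain ⟨e, he⟩ := exists_splitting_equiv hk hp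
  rw [liftL, ← he]
  simp

theorem jetProj_liftL (hk : k + 1 = n) (hp : p ∈ S.domain) (θ : Jet n k) :
    jetProj (Nat.le_succ k) (S.liftL k p θ) = θ :=
  congrArg Prod.fst (splitting_liftL hk hp θ)

theorem topEqn_liftL (hk : k + 1 = n) (hp : p ∈ S.domain) (θ : Jet n k) :
    S.topEqn k p (S.liftL k p θ) = 0 :=
  congrArg Prod.snd (splitting_liftL hk hp θ)

/-- The deviation of a jet from the lift of its projection depends linearly on its top order
equations, with coefficients smooth in the point. This allows it to be differentiated in the proof
of flatness. -/
theorem sub_liftL_eq (hk : k + 1 = n) (hp : p ∈ S.domain) (θ : Jet n (k + 1)) :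
    θ - S.liftL k p (jetProj (Nat.le_succ k) θ) =
      ContinuousLinearMap.inverse (S.splitting k p) (0, S.topEqn k p θ) := by
  obtain ⟨e, he⟩ := exists_splitting_equiv hk hp
  have h : e (θ - S.liftL k p (jetProj (Nat.le_succ k) θ)) = (0, S.topEqn k p θ) := by
    rw [map_sub]
    have h1 : e (S.liftL k p (jetProj (Nat.le_succ k) θ)) = (jetProj (Nat.le_succ k) θ, 0) := by
      rw [← splitting_liftL hk hp, ← he]; rfl
    have h2 : e θ = (jetProj (Nat.le_succ k) θ, S.topEqn k p θ) := by
      change (e : Jet n (k + 1) →L[ℝ] Jet n k × (Fin (k + 1) → Option (Fin n) → ℝ)) θ = _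
      rw [he]; rfl
    rw [h1, h2]
    simp
  rw [← he, ContinuousLinearMap.inverse_equiv, ← h]
  simp

theorem eq_liftL (hk : k + 1 = n) (hp : p ∈ S.domain) {θ : Jet n (k + 1)}
    (h : S.prolongedEqn (k + 1) p θ = 0) : θ = S.liftL k p (jetProj (Nat.le_succ k) θ) := by
  have h2 : S.topEqn k p θ = 0 := topEqn_eq_zero_iff.2 fun α j _ => by rw [h]; rfl
  rw [← sub_eq_zero, sub_liftL_eq hk hp, h2]
  exact map_zero _

/-- The lift is defined for all jets, not only for those in the prolongation: it keeps the equations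
of low order and kills those of top order. This is the source of the truncation in
`truncatedContract`. -/
theorem prolongedEqn_liftL (hk : k + 1 = n) (hp : p ∈ S.domain) (θ : Jet n k)
    (α : LowIndex (k + 1)) (j : Option (Fin n)) :
    S.prolongedEqn (k + 1) p (S.liftL k p θ) α j =
      if h : α.1.1 + α.1.2 < k then S.prolongedEqn k p θ ⟨α.1, h⟩ j else 0 := by
  split_ifs with h
  · conv_rhs => rw [← jetProj_liftL hk hp θ]
    rw [prolongedEqn_jetProj _ hp]
  · exact topEqn_eq_zero_iff.1 (topEqn_liftL hk hp θ) α j (by have := α.2; omega)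

theorem prolongedEqn_liftL_eq_zero (hk : k + 1 = n) (hp : p ∈ S.domain) {θ : Jet n k}
    (h : S.prolongedEqn k p θ = 0) : S.prolongedEqn (k + 1) p (S.liftL k p θ) = 0 := by
  ext α j
  rw [prolongedEqn_liftL hk hp, h]
  simp

/-- The derivative of the prolonged equation. -/
theorem fderiv_prolongedEqn (hp : p ∈ S.domain) (v : Plane) (θ : Jet n (k + 1)) (α : LowIndex k)
    (j : Option (Fin n)) :
    (fderiv ℝ (S.prolongedEqn k) p v (jetProj (Nat.le_succ k) θ) +
      S.prolongedEqn k p (jetContract le_rfl v θ)) α j =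
    v.1 * S.prolongedEqn (k + 1) p θ ⟨(α.1.1 + 1, α.1.2), by have := α.2; simp only; omega⟩ j +
    v.2 * S.prolongedEqn (k + 1) p θ ⟨(α.1.1, α.1.2 + 1), by have := α.2; simp only; omega⟩ j := by
  -- For θ the jet of u, both sides are the derivative along v of the same partial derivative of the
  -- equations for u.
  obtain ⟨u, hu, rfl⟩ := exists_jet_eq p θ
  have hus : ContDiffOn ℝ ∞ u S.domain := hu.contDiffOn
  have hd : HasFDerivAt (S.prolongedEqn k) (fderiv ℝ (S.prolongedEqn k) p) p :=
    ((S.prolongedEqn_smooth k p hp).contDiffAt (S.isOpen.mem_nhds hp)).differentiableAt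
      (by simp) |>.hasFDerivAt
  have h1 := hd.clm_apply (hasFDerivAt_jet (l := k) (k := k + 1) le_rfl S.isOpen hus hp)
  have h2 := (hasFDerivAt_pi'.1 (hasFDerivAt_pi'.1 h1 α) j).fderiv
  have he : (fun q => S.prolongedEqn k q (jet k q u) α j) =ᶠ[𝓝 p]
      partialD α.1.1 α.1.2 (S.eqn u j) :=
    Filter.eventuallyEq_of_mem (S.isOpen.mem_nhds hp)
      fun q hq => S.prolongedEqn_jet S.isOpen subset_rfl hus hq α j
  rw [he.fderiv_eq] at h2
  have h3 := DFunLike.congr_fun h2 v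
  rw [fderiv_eq_dx_dy, dx_partialD,
    dy_partialD S.isOpen (S.eqn_smooth S.isOpen subset_rfl hus j) _ _ hp] at h3
  rw [S.prolongedEqn_jet S.isOpen subset_rfl hus hp, S.prolongedEqn_jet S.isOpen subset_rfl hus hp,
    h3]
  simp only [jetProj_jet, Pi.add_apply, ContinuousLinearMap.comp_apply, add_apply,
    ContinuousLinearMap.flip_apply, contractL_apply, ContinuousLinearMap.proj_apply]
  ring

/-- The connection form preserves the prolonged equation. -/
theorem fderiv_prolongedEqn_connForm (hk : k + 1 = n) (hp : p ∈ S.domain) (v : Plane)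
    (θ : Jet n k) : fderiv ℝ (S.prolongedEqn k) p v θ +
      S.prolongedEqn k p (S.connForm k p v θ) = truncatedContract k v (S.prolongedEqn k p θ) := by
  have h := fderiv_prolongedEqn hp v (S.liftL k p θ)
  rw [jetProj_liftL hk hp] at h
  ext α j
  rw [connForm_apply, h α j, truncatedContract_apply, prolongedEqn_liftL hk hp,
    prolongedEqn_liftL hk hp]

/-- If the next prolongation is surjective, the connection is flat on the prolonged equation. -/
theorem connForm_flat (hk : k + 1 = n) (hp : p ∈ S.domain)
    (H : ∀ θ, S.prolongedEqn (k + 1) p θ = 0 → ∃ θ', S.prolongedEqn (k + 2) p θ' = 0 ∧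
      jetProj (Nat.le_succ (k + 1)) θ' = θ) {θ : Jet n k} (hθ : S.prolongedEqn k p θ = 0)
    (v w : Plane) : fderiv ℝ (S.connForm k) p v w θ + S.connForm k p w (S.connForm k p v θ) =
      fderiv ℝ (S.connForm k) p w v θ + S.connForm k p v (S.connForm k p w θ) := by
  -- A smooth u is chosen whose (k + 2)-jet at p lies in the prolongation over the lift of θ. All
  -- derivatives of order at most k + 1 of the equations for u vanish at p.
  obtain ⟨θ', hθ', hπ⟩ := H _ (prolongedEqn_liftL_eq_zero hk hp hθ)
  obtain ⟨u, hu, rfl⟩ := exists_jet_eq p θ'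
  have hus : ContDiffOn ℝ ∞ u S.domain := hu.contDiffOn
  rw [jetProj_jet] at hπ
  have hs : jet k p u = θ := by
    rw [← jetProj_jet (Nat.le_succ k), hπ, jetProj_liftL hk hp]
  -- D measures how far the jet field of u is from being parallel. By `sub_liftL_eq` it is a smooth
  -- linear image of the top order equations, which vanish at p together with their first
  -- derivatives; so D and its derivative vanish at p.
  set D : Plane → Jet n (k + 1) := fun q => jet (k + 1) q u - S.liftL k q (jet k q u) with hD
  have hD0 : D p = 0 := by simp only [hD]; rw [hs, hπ, sub_self]
  have hg : HasFDerivAt (fun q => S.topEqn k q (jet (k + 1) q u))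
      (0 : Plane →L[ℝ] (Fin (k + 1) → Option (Fin n) → ℝ)) p := by
    rw [hasFDerivAt_pi']
    intro m
    rw [hasFDerivAt_pi']
    intro j
    have hsm := partialD_smooth S.isOpen (S.eqn_smooth S.isOpen subset_rfl hus j) m (k - m)
    have h1 := (differentiableAt_of_smooth S.isOpen hsm hp).hasFDerivAt
    have h2 : fderiv ℝ (partialD m (k - m) (S.eqn u j)) p = 0 := by
      refine ContinuousLinearMap.ext fun v => ?_
      have hm := m.2
      have e1 := S.prolongedEqn_jet S.isOpen subset_rfl hus hp
        (⟨(m + 1, k - m), by simp only; omega⟩ : LowIndex (k + 2)) j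
      have e2 := S.prolongedEqn_jet S.isOpen subset_rfl hus hp
        (⟨(m, k - m + 1), by simp only; omega⟩ : LowIndex (k + 2)) j
      rw [hθ'] at e1 e2
      rw [fderiv_eq_dx_dy, dx_partialD,
        dy_partialD S.isOpen (S.eqn_smooth S.isOpen subset_rfl hus j) _ _ hp, ← e1, ← e2]
      simp
    rw [h2] at h1
    refine HasFDerivAt.congr_of_eventuallyEq (f := partialD m (k - m) (S.eqn u j)) ?_ ?_
    · exact h1
    · exact Filter.eventuallyEq_of_mem (S.isOpen.mem_nhds hp)
        fun q hq => S.prolongedEqn_jet S.isOpen subset_rfl hus hq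
          (⟨(m, k - m), by have := m.2; simp only; omega⟩ : LowIndex (k + 1)) j
  have hg0 : S.topEqn k p (jet (k + 1) p u) = 0 := by
    rw [hπ]; exact topEqn_liftL hk hp θ
  have hDd : HasFDerivAt D (0 : Plane →L[ℝ] Jet n (k + 1)) p := by
    have hinv := (((splitting_inverse_smooth (S := S) hk p hp).contDiffAt
      (S.isOpen.mem_nhds hp)).differentiableAt (by simp)).hasFDerivAt
    have h1 := hinv.clm_apply ((hasFDerivAt_const (0 : Jet n k) p).prodMk hg)
    refine HasFDerivAt.congr_of_eventuallyEq (h1.congr_fderiv ?_) ?_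
    · refine ContinuousLinearMap.ext fun v => ?_
      have h0 : ((0 : Jet n k), (0 : Fin (k + 1) → Option (Fin n) → ℝ)) = 0 := rfl
      simp [hg0, h0]
    · refine Filter.eventuallyEq_of_mem (S.isOpen.mem_nhds hp) fun q hq => ?_
      exact sub_liftL_eq hk hq _
  have hfd : (fun q => fderiv ℝ (fun q => jet k q u) q) =ᶠ[𝓝 p] fun q =>
      (S.connForm k q).flip (jet k q u) + (contractL le_rfl).flip (D q) := by
    refine Filter.eventuallyEq_of_mem (S.isOpen.mem_nhds hp) fun q hq => ?_
    rw [(hasFDerivAt_jet (l := k) (k := k + 1) le_rfl S.isOpen hus hq).fderiv]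
    refine ContinuousLinearMap.ext fun v => ?_
    simp only [ContinuousLinearMap.flip_apply, add_apply, hD, map_sub, sub_apply, connForm_apply,
      contractL_apply]
    abel
  have hM : HasFDerivAt (S.connForm k) (fderiv ℝ (S.connForm k) p) p :=
    (((connForm_smooth hk p hp).contDiffAt (S.isOpen.mem_nhds hp)).differentiableAt
      (by simp)).hasFDerivAt
  have hj := hasFDerivAt_jet (l := k) (k := k + 1) le_rfl S.isOpen hus hp
  have hjs : ContDiffAt ℝ ∞ (fun q => jet k q u) p :=
    (jet_smooth S.isOpen hus p hp).contDiffAt (S.isOpen.mem_nhds hp)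
  have hsym := hjs.isSymmSndFDerivAt (by simpa using natCast_le_infty 2)
  have hdd : DifferentiableAt ℝ (fderiv ℝ fun q => jet k q u) p :=
    (hjs.fderiv_right (m := ∞) (by simp)).differentiableAt (by simp)
  -- At p the second derivative of the jet field is therefore the one computed as if the field were
  -- parallel, and its symmetry is the vanishing of the curvature on θ.
  have key : ∀ v w : Plane, fderiv ℝ (fderiv ℝ fun q => jet k q u) p v w =
      fderiv ℝ (S.connForm k) p v w θ + S.connForm k p w (S.connForm k p v θ) := by
    intro v w
    have h1 := hdd.hasFDerivAt.clm_apply (hasFDerivAt_const w p)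
    have h2 : (fun q => fderiv ℝ (fun q => jet k q u) q w) =ᶠ[𝓝 p] fun q =>
        S.connForm k q w (jet k q u) + contractL le_rfl w (D q) :=
      hfd.mono fun q hq => by
        beta_reduce at hq ⊢
        rw [hq]; rfl
    have h3 := ((hM.clm_apply (hasFDerivAt_const w p)).clm_apply hj).add
      ((hasFDerivAt_const (contractL (r := n) (k := k + 1) (l := k) le_rfl w) p).clm_apply hDd)
    have h4 := h1.unique (h3.congr_of_eventuallyEq h2)
    have h5 := DFunLike.congr_fun h4 v
    simp only [add_apply, ContinuousLinearMap.comp_apply, ContinuousLinearMap.flip_apply,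
      map_zero, zero_apply, zero_add, add_zero] at h5
    rw [h5, hs, hπ]
    simp
    abel
  rw [← key, ← key]
  exact hsym.eq v w

end FirstOrderSystem

/-! ### Dimensions and frames -/

theorem card_lowIndex (k : ℕ) : Fintype.card (LowIndex k) = ∑ i ∈ Finset.range k, (i + 1) := by
  have h : Fintype.card (LowIndex k) = (((Finset.range k) ×ˢ (Finset.range k)).filter
      fun α => α.1 + α.2 < k).card := Fintype.subtype_card _ _
  rw [h, Finset.card_eq_sum_card_fiberwise (f := fun α => α.1 + α.2) (t := Finset.range k)]
  · refine Finset.sum_congr rfl fun i hi => ?_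
    rw [← Finset.Nat.card_antidiagonal i]
    congr 1
    ext ⟨a, b⟩
    simp only [Finset.mem_filter, Finset.mem_product, Finset.mem_range] at hi ⊢
    refine Iff.trans ?_ Finset.HasAntidiagonal.mem_antidiagonal.symm
    omega
  · intro α hα
    simp only [Finset.coe_filter, mem_ofPred_eq] at hα
    simpa using hα.2

theorem card_jetIndex (k : ℕ) :
    Fintype.card (JetIndex k) = ∑ i ∈ Finset.range (k + 1), (i + 1) := by
  rw [← card_lowIndex]
  exact Fintype.card_congr (Equiv.subtypeEquivRight fun _ => Nat.lt_succ_iff.symm)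

theorem finrank_jet (r k : ℕ) :
    Module.finrank ℝ (Jet r k) = (∑ i ∈ Finset.range (k + 1), (i + 1)) * r := by
  simp [Module.finrank_pi_fintype, card_jetIndex]

/-- The kernels of a smooth family of surjective linear maps form a smooth subbundle. -/
theorem isSmoothSubbundle_ker {E G : Type*} [NormedAddCommGroup E] [NormedSpace ℝ E]
    [FiniteDimensional ℝ E] [NormedAddCommGroup G] [NormedSpace ℝ G] [FiniteDimensional ℝ G]
    {U : Set Plane} (hU : IsOpen U) {F : Plane → E →L[ℝ] G} (hF : ContDiffOn ℝ ∞ F U)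
    (hs : ∀ p ∈ U, Function.Surjective (F p)) {A : Plane → Submodule ℝ E} {N : ℕ}
    (hA : ∀ p ∈ U, A p = LinearMap.ker (F p).toLinearMap)
    (hN : ∀ p ∈ U, Module.finrank ℝ (A p) = N) : IsSmoothSubbundle U A N := by
  intro p hp
  set K := LinearMap.ker (F p).toLinearMap with hK
  have hKN : Module.finrank ℝ K = N := by rw [hK, ← hA p hp, hN p hp]
  -- A projection P onto the kernel at p completes F to an isomorphism at p, hence near p. The
  -- inverse images of (0, b j) form the frame.
  obtain ⟨P₀, hP₀⟩ := Submodule.exists_isCompl K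
  let P : E →L[ℝ] K := LinearMap.toContinuousLinearMap (K.projectionOnto P₀ hP₀)
  have hP : ∀ x : K, P x = x := fun x => Submodule.projectionOnto_apply_left hP₀ x
  let Φ : Plane → E →L[ℝ] G × K := fun q => (F q).prod P
  have hΦ : ContDiffOn ℝ ∞ Φ U := contDiffOn_clm_apply.2 fun x =>
    (hF.clm_apply contDiffOn_const).prodMk contDiffOn_const
  have hinj : LinearMap.ker (Φ p).toLinearMap = ⊥ := by
    rw [LinearMap.ker_eq_bot']
    intro x hx
    have h1 : F p x = 0 := congrArg Prod.fst hx
    have h2 : P x = 0 := congrArg Prod.snd hx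
    have h3 := hP ⟨x, h1⟩
    rw [show P ((⟨x, h1⟩ : K) : E) = P x from rfl, h2] at h3
    exact (congrArg Subtype.val h3).symm
  have hsurj : LinearMap.range (Φ p).toLinearMap = ⊤ := by
    rw [LinearMap.range_eq_top]
    rintro ⟨y, z⟩
    obtain ⟨x, rfl⟩ := hs p hp y
    refine ⟨x + ((z - P x : K) : E), Prod.ext ?_ ?_⟩
    · have : F p ((z - P x : K) : E) = 0 := (z - P x).2
      change F p (x + ((z - P x : K) : E)) = F p x
      rw [map_add, this, add_zero]
    · change P (x + ((z - P x : K) : E)) = z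
      rw [map_add, hP]
      abel
  let b := Module.finBasisOfFinrankEq ℝ K hKN
  let O : Set (E →L[ℝ] G × K) := range fun e : E ≃L[ℝ] G × K => (e : E →L[ℝ] G × K)
  refine ⟨U ∩ Φ ⁻¹' O, hΦ.continuousOn.isOpen_inter_preimage hU ContinuousLinearEquiv.isOpen,
    ⟨hp, ContinuousLinearEquiv.ofBijective (Φ p) hinj hsurj,
      ContinuousLinearEquiv.coe_ofBijective _ _ _⟩, inter_subset_left,
    fun j q => ContinuousLinearMap.inverse (Φ q) (0, b j), fun j q hq => ?_, fun q hq => ?_⟩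
  · obtain ⟨hqU, e, he⟩ := hq
    have h1 := contDiffAt_map_inverse (𝕜 := ℝ) (n := ∞) e
    beta_reduce at he
    rw [he] at h1
    exact (h1.comp_contDiffWithinAt q ((hΦ q hqU).mono inter_subset_left)).clm_apply
      contDiffWithinAt_const
  · obtain ⟨hqU, e, he⟩ := hq
    beta_reduce at he
    have hfun : (fun j => ContinuousLinearMap.inverse (Φ q) (0, b j)) =
        fun j => e.symm (0, b j) := by
      rw [← he]; simp
    rw [hfun]
    have hli : LinearIndependent ℝ fun j => e.symm (0, b j) := by
      have h1 := b.linearIndependent.map' (LinearMap.inr ℝ G K)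
        (LinearMap.ker_eq_bot.2 LinearMap.inr_injective)
      exact h1.map' (e.symm : G × K →ₗ[ℝ] E) (LinearMap.ker_eq_bot.2 e.symm.injective)
    refine ⟨hli, Submodule.eq_of_le_of_finrank_eq ?_ ?_⟩
    · rw [Submodule.span_le]
      rintro _ ⟨j, rfl⟩
      rw [SetLike.mem_coe, hA q hqU, LinearMap.mem_ker]
      have : (e : E →L[ℝ] G × K) (e.symm (0, b j)) = (0, b j) := by simp
      rw [he] at this
      exact congrArg Prod.fst this
    · rw [finrank_span_eq_card hli, Fintype.card_fin, hN q hqU]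

namespace FirstOrderSystem

variable {n : ℕ} {S : FirstOrderSystem n} {p : Plane} {k : ℕ}

theorem finrank_ker_prolongedEqn (hk : k ≤ n) (hp : p ∈ S.domain) :
    Module.finrank ℝ (LinearMap.ker (S.prolongedEqn k p).toLinearMap) =
      ∑ j ∈ Finset.range (k + 1), (n - j) := by
  have h1 := LinearMap.finrank_range_add_finrank_ker (S.prolongedEqn k p).toLinearMap
  rw [LinearMap.range_eq_top.2 (prolongedEqn_surjective hk hp), finrank_top, finrank_jet] at h1
  have h2 : Module.finrank ℝ (LowIndex k → Option (Fin n) → ℝ) =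
      (∑ i ∈ Finset.range k, (i + 1)) * (n + 1) := by
    simp [Module.finrank_pi_fintype, card_lowIndex]
  -- Passing from k to k + 1 adds (k + 2) n jet components and (k + 1)(n + 1) equations, a gain of n
  -- - (k + 1).
  have h3 : ∀ k ≤ n, (∑ i ∈ Finset.range k, (i + 1)) * (n + 1) + ∑ j ∈ Finset.range (k + 1), (n - j)
      = (∑ i ∈ Finset.range (k + 1), (i + 1)) * n := by
    intro k hk
    induction k with
    | zero => simp
    | succ k ih =>
      rw [Finset.sum_range_succ (fun j => n - j), Finset.sum_range_succ _ (k + 1), add_mul (∑ i ∈ _, _),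
        ← ih (by omega), Finset.sum_range_succ _ k]
      obtain ⟨c, rfl⟩ := Nat.exists_eq_add_of_le hk
      rw [Nat.add_sub_cancel_left]
      ring
  have h4 := h3 k hk
  omega

theorem map_jetProj_ker (hk : k + 1 ≤ n) (hp : p ∈ S.domain) :
    (LinearMap.ker (S.prolongedEqn (k + 1) p).toLinearMap).map (jetProj (Nat.le_succ k)) =
      LinearMap.ker (S.prolongedEqn k p).toLinearMap := by
  ext θ
  simp only [Submodule.mem_map, LinearMap.mem_ker, ContinuousLinearMap.coe_coe]
  constructor
  · rintro ⟨θ', h, rfl⟩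
    ext α j
    rw [prolongedEqn_jetProj _ hp, h]
    rfl
  · intro h
    obtain ⟨θ', h1, h2⟩ := exists_lift hk hp θ 0 fun α j => by rw [h]; rfl
    exact ⟨θ', h2, h1⟩

/-- Rank and nullity of the projection restricted to the prolongation, whose image is the whole
previous one. -/
theorem finrank_ker_inf_ker (hk : k + 1 ≤ n) (hp : p ∈ S.domain) :
    Module.finrank ℝ ↥(LinearMap.ker (S.prolongedEqn (k + 1) p).toLinearMap ⊓
      LinearMap.ker (jetProj (r := n) (Nat.le_succ k))) = n - (k + 1) := by
  set A := LinearMap.ker (S.prolongedEqn (k + 1) p).toLinearMap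
  have h1 := LinearMap.finrank_range_add_finrank_ker
    ((jetProj (r := n) (Nat.le_succ k)).domRestrict A)
  have h2 : LinearMap.range ((jetProj (r := n) (Nat.le_succ k)).domRestrict A) =
      LinearMap.ker (S.prolongedEqn k p).toLinearMap := by
    rw [← map_jetProj_ker hk hp, LinearMap.domRestrict, LinearMap.range_comp,
      Submodule.range_subtype]
  have h3 : LinearMap.ker ((jetProj (r := n) (Nat.le_succ k)).domRestrict A) =
      (LinearMap.ker (jetProj (r := n) (Nat.le_succ k))).comap A.subtype := rfl
  rw [h2, h3, ← Submodule.finrank_map_subtype_eq, Submodule.map_comap_subtype,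
    finrank_ker_prolongedEqn (by omega) hp, finrank_ker_prolongedEqn hk hp,
    Finset.sum_range_succ (fun j => n - j) (k + 1)] at h1
  exact Nat.add_left_cancel h1

theorem bijOn_jetProj (hk : k + 1 = n) (hp : p ∈ S.domain) :
    Set.BijOn (jetProj (r := n) (Nat.le_succ k)) (LinearMap.ker (S.prolongedEqn (k + 1) p).toLinearMap)
      (LinearMap.ker (S.prolongedEqn k p).toLinearMap) := by
  refine ⟨?_, fun θ hθ η hη h => ?_, ?_⟩
  · intro θ hθ
    rw [SetLike.mem_coe, ← map_jetProj_ker hk.le hp]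
    exact Submodule.mem_map_of_mem hθ
  · rw [eq_liftL hk hp hθ, eq_liftL hk hp hη, h]
  · intro θ hθ
    exact ⟨S.liftL k p θ, prolongedEqn_liftL_eq_zero hk hp hθ, jetProj_liftL hk hp θ⟩

theorem isLinearConnection (hk : k + 1 = n) {A : Plane → Submodule ℝ (Jet n k)}
    (hA : ∀ p ∈ S.domain, A p = LinearMap.ker (S.prolongedEqn k p).toLinearMap)
    {nabla : (Plane → Jet n k) → Plane → Plane → Jet n k}
    (hn : ∀ s, ∀ p ∈ S.domain, s p ∈ A p → ∀ v,
      nabla s p v = fderiv ℝ s p v - S.connForm k p v (s p)) :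
    IsLinearConnection S.domain A nabla := by
  have smooth : ∀ {V} {s : Plane → Jet n k}, IsOpen V → ContDiffOn ℝ ∞ s V → ∀ p ∈ V,
      DifferentiableAt ℝ s p := fun hV hs p hp =>
    ((hs p hp).contDiffAt (hV.mem_nhds hp)).differentiableAt (by simp)
  refine ⟨fun V hV hVS s hs v => ⟨?_, fun p hp => ?_⟩, fun V hV hVS s hs p hp => ⟨?_, ?_⟩,
    fun V hV hVS s t hs ht p hp v => ?_, fun V hV hVS f s hf hs p hp v => ?_⟩
  · refine ContDiffOn.congr (f := fun p => fderiv ℝ s p v - S.connForm k p v (s p)) ?_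
      fun p hp => hn s p (hVS hp) (hs.mem p hp) v
    exact ((hs.smooth.fderiv_of_isOpen hV (by simp)).clm_apply contDiffOn_const).sub
      ((((connForm_smooth hk).mono hVS).clm_apply contDiffOn_const).clm_apply hs.smooth)
  -- Differentiating F(s) = 0 and using that the connection form preserves F = 0 shows that the
  -- covariant derivative stays in the kernel of F.
  · have hpS := hVS hp
    have hmem : ∀ q ∈ V, S.prolongedEqn k q (s q) = 0 := fun q hq => by
      have := hs.mem q hq
      rwa [hA q (hVS hq)] at this
    rw [hn s p hpS (hs.mem p hp), hA p hpS, LinearMap.mem_ker, ContinuousLinearMap.coe_coe, map_sub,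
      sub_eq_zero]
    have hd : HasFDerivAt (S.prolongedEqn k) (fderiv ℝ (S.prolongedEqn k) p) p :=
      ((S.prolongedEqn_smooth k p hpS).contDiffAt (S.isOpen.mem_nhds hpS)).differentiableAt
        (by simp) |>.hasFDerivAt
    have h1 := hd.clm_apply (smooth hV hs.smooth p hp).hasFDerivAt
    have h2 : (fun q => S.prolongedEqn k q (s q)) =ᶠ[𝓝 p] fun _ => 0 :=
      Filter.eventuallyEq_of_mem (hV.mem_nhds hp) hmem
    have h3 := DFunLike.congr_fun (h1.unique ((hasFDerivAt_const _ p).congr_of_eventuallyEq h2)) v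
    have h4 := fderiv_prolongedEqn_connForm hk hpS v (s p)
    rw [hmem p hp, map_zero] at h4
    simp only [add_apply, ContinuousLinearMap.comp_apply, ContinuousLinearMap.flip_apply,
      zero_apply] at h3
    rw [eq_neg_of_add_eq_zero_left h3, eq_neg_of_add_eq_zero_right h4]
  · intro v w
    simp only [hn s p (hVS hp) (hs.mem p hp), map_add, add_apply]
    abel
  · intro c v
    simp only [hn s p (hVS hp) (hs.mem p hp), map_smul, smul_apply, smul_sub]
  · have hm : (fun q => s q + t q) p ∈ A p := (A p).add_mem (hs.mem p hp) (ht.mem p hp)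
    rw [hn _ p (hVS hp) hm, hn s p (hVS hp) (hs.mem p hp), hn t p (hVS hp) (ht.mem p hp),
      fderiv_fun_add (smooth hV hs.smooth p hp) (smooth hV ht.smooth p hp), map_add, add_apply]
    abel
  · have hm : (fun q => f q • s q) p ∈ A p := (A p).smul_mem _ (hs.mem p hp)
    rw [hn _ p (hVS hp) hm, hn s p (hVS hp) (hs.mem p hp),
      fderiv_fun_smul (differentiableAt_of_smooth hV hf hp) (smooth hV hs.smooth p hp), map_smul]
    simp only [add_apply, smul_apply, ContinuousLinearMap.smulRight_apply, smul_sub]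
    abel

/-! ### Solutions -/

variable (S) in
/-- `u` is a smooth solution of the system on `V`. -/
structure IsSolutionOn (V : Set Plane) (u : Plane → Fin n → ℝ) : Prop where
  smooth : ContDiffOn ℝ ∞ u V
  eqn_eq_zero : ∀ j, ∀ q ∈ V, S.eqn u j q = 0

theorem IsSolutionOn.prolongedEqn_jet {V : Set Plane} {u : Plane → Fin n → ℝ}
    (hu : S.IsSolutionOn V u) (hV : IsOpen V) (hVS : V ⊆ S.domain) (hp : p ∈ V) :
    S.prolongedEqn k p (jet k p u) = 0 := by
  ext α j
  rw [S.prolongedEqn_jet hV hVS hu.smooth hp]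
  exact (isOperatorOn_partialD hV _ _).map_zero (hu.eqn_eq_zero j) hp

/-- The jet field of a solution is parallel because its jet of next order is forced to be the lift.
-/
theorem IsSolutionOn.hasFDerivAt_jet {V : Set Plane} {u : Plane → Fin n → ℝ} (hk : k + 1 = n)
    (hu : S.IsSolutionOn V u) (hV : IsOpen V) (hVS : V ⊆ S.domain) (hp : p ∈ V) :
    HasFDerivAt (fun q => jet k q u) ((S.connForm k p).flip (jet k p u)) p := by
  have h := Web.hasFDerivAt_jet (l := k) (k := k + 1) le_rfl hV hu.smooth hp
  rw [eq_liftL hk (hVS hp) (hu.prolongedEqn_jet hV hVS hp), jetProj_jet] at h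
  exact h

/-- A solution is determined near a point by its jet at that point. -/
theorem IsSolutionOn.eventually_eq_zero {V : Set Plane} {u : Plane → Fin n → ℝ} (hk : k + 1 = n)
    (hu : S.IsSolutionOn V u) (hV : IsOpen V) (hVS : V ⊆ S.domain) (hp : p ∈ V)
    (h : jet k p u = 0) : ∀ᶠ q in 𝓝 p, u q = 0 := by
  obtain ⟨r, hr, hb⟩ := Metric.isOpen_iff.1 hV p hp
  have := eqOn_zero_of_hasFDerivAt (p := p) (r := r) (hb.trans hVS)
    (connForm_smooth (S := S) hk).continuousOn (s := fun q => jet k q u)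
    (fun q hq => hu.hasFDerivAt_jet hk hV hVS (hb hq)) h
  filter_upwards [Metric.ball_mem_nhds p hr] with q hq
  ext i
  exact congrFun (congrFun (this q hq) ⟨(0, 0), Nat.zero_le _⟩) i

/-- If all prolongations of order `n + 1` are surjective, there is a solution with any given jet. -/
theorem exists_solution (hk : k + 1 = n)
    (H : ∀ q ∈ S.domain, ∀ θ, S.prolongedEqn (k + 1) q θ = 0 → ∃ θ',
      S.prolongedEqn (k + 2) q θ' = 0 ∧ jetProj (Nat.le_succ (k + 1)) θ' = θ)
    (hp : p ∈ S.domain) {θ : Jet n k} (hθ : S.prolongedEqn k p θ = 0) :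
    ∃ V, IsOpen V ∧ p ∈ V ∧ V ⊆ S.domain ∧ ∃ u, S.IsSolutionOn V u ∧ jet k p u = θ := by
  obtain ⟨r, hr, hrS, s, hs0, hs⟩ := exists_solution_of_flat S.isOpen (connForm_smooth hk)
    (S.prolongedEqn_smooth k) (truncatedContract k)
    (fun q hq v x => fderiv_prolongedEqn_connForm hk hq v x)
    (fun q hq x hx v w => connForm_flat hk hq (H q hq) hx v w) hp hθ
  set B := Metric.ball p r with hB
  have hBo : IsOpen B := Metric.isOpen_ball
  have hsm : ContDiffOn ℝ ∞ s B := contDiffOn_of_hasFDerivAt hBo ((connForm_smooth hk).mono hrS)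
    fun q hq => (hs q hq).2
  -- The solution is the component of order zero of the parallel section s; it remains to see that s
  -- is the jet field of u.
  let u : Plane → Fin n → ℝ := fun q => s q ⟨(0, 0), Nat.zero_le _⟩
  have hu : ContDiffOn ℝ ∞ u B := contDiffOn_pi.1 hsm _
  have hui : ∀ i, ContDiffOn ℝ ∞ (fun q => u q i) B := contDiffOn_pi.1 hu
  have hder : ∀ q ∈ B, ∀ (α : JetIndex k) i v, fderiv ℝ (fun q => s q α i) q v =
      jetContract le_rfl v (S.liftL k q (s q)) α i := by
    intro q hq α i v
    rw [(hasFDerivAt_pi'.1 (hasFDerivAt_pi'.1 (hs q hq).2 α) i).fderiv]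
    rfl
  have hlift : ∀ q ∈ B, ∀ a b (h : a + b ≤ k) i,
      S.liftL k q (s q) ⟨(a, b), h.trans (Nat.le_succ k)⟩ i = s q ⟨(a, b), h⟩ i := by
    intro q hq a b h i
    exact congrFun (congrFun (jetProj_liftL hk (hrS hq) (s q)) ⟨(a, b), h⟩) i
  -- The derivatives of s are components of its lift, and the lift projects back to s, so each
  -- derivative of a component is the component of next order.
  have hjet : ∀ a b (h : a + b ≤ k) i, EqOn (partialD a b fun q => u q i)
      (fun q => s q ⟨(a, b), h⟩ i) B := by
    intro a
    induction a with
    | zero =>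
      intro b
      induction b with
      | zero => exact fun _ _ _ _ => rfl
      | succ b ih =>
        intro h i q hq
        rw [← dy_partialD hBo (hui i) 0 b hq, (isOperatorOn_dy hBo).congr _ _ (ih (by omega) i) hq]
        refine (hder q hq ⟨(0, b), by simp only; omega⟩ i ey).trans
          (Eq.trans ?_ (hlift q hq 0 (b + 1) h i))
        simp [jetContract, ey]
    | succ a ih =>
      intro b h i q hq
      rw [← dx_partialD, (isOperatorOn_dx hBo).congr _ _ (ih b (by omega) i) hq]
      refine (hder q hq ⟨(a, b), by simp only; omega⟩ i ex).trans
        (Eq.trans ?_ (hlift q hq (a + 1) b h i))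
      simp [jetContract, ex]
  have hsu : ∀ q ∈ B, jet k q u = s q := fun q hq => by
    ext ⟨⟨a, b⟩, h⟩ i
    exact hjet a b h i hq
  have hlift1 : ∀ q ∈ B, jet (k + 1) q u = S.liftL k q (s q) := by
    intro q hq
    refine jet_ext_of_contract ?_ fun v => ?_
    · rw [jetProj_jet, hsu q hq, jetProj_liftL hk (hrS hq)]
    · have h1 := hasFDerivAt_jet (l := k) (k := k + 1) le_rfl hBo hu hq
      have h2 := (hs q hq).2.congr_of_eventuallyEq
        (Filter.eventuallyEq_of_mem (hBo.mem_nhds hq) hsu)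
      exact DFunLike.congr_fun (h1.unique h2) v
  refine ⟨B, hBo, Metric.mem_ball_self hr, hrS, u, ⟨hu, fun j q hq => ?_⟩, ?_⟩
  -- The equations themselves are the entry of index (0, 0) of the prolonged equation, which
  -- vanishes on the lift.
  · have h1 := S.prolongedEqn_jet (k := k + 1) hBo hrS hu hq ⟨(0, 0), by simp⟩ j
    rw [hlift1 q hq, prolongedEqn_liftL_eq_zero hk (hrS hq) (hs q hq).1] at h1
    exact h1.symm
  · rw [hsu p (Metric.mem_ball_self hr), hs0]

/-- A jet of order `n` in the prolongation extends to one of order `n + 1` if the obstruction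
vanishes. -/
theorem exists_lift_of_obstruction (hk : k + 1 = n) (hp : p ∈ S.domain) {u : Plane → Fin n → ℝ}
    (hu : ContDiff ℝ ∞ u) (hθ : S.prolongedEqn (k + 1) p (jet (k + 1) p u) = 0)
    (h : symbolObstruction (fun j => S.vec j p)
      (fun j m => partialD m (k + 1 - m) (S.eqn u j) p) = 0) :
    ∃ θ', S.prolongedEqn (k + 2) p θ' = 0 ∧ jetProj (Nat.le_succ (k + 1)) θ' = jet (k + 1) p u := by
  have : Nonempty (Fin n) := ⟨⟨0, by omega⟩⟩
  -- The residual top order equations of the (k + 2)-jet of u lie in the image of the symbol;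
  -- subtracting a preimage removes them without changing the (k + 1)-jet.
  obtain ⟨w, hw⟩ := exists_symbol_eq_of_obstruction (S.indep p hp)
    (t := fun m j => partialD m (k + 1 - m) (S.eqn u j) p) h
  refine ⟨jet (k + 2) p u - topJet (k + 2) w, ?_, by
    rw [map_sub, jetProj_jet, jetProj_topJet, sub_zero]⟩
  ext ⟨⟨a, b⟩, hab⟩ j
  rw [map_sub, Pi.sub_apply, Pi.sub_apply, prolongedEqn_topJet hp]
  simp only at hab ⊢
  split_ifs with hs
  · rw [S.prolongedEqn_jet S.isOpen subset_rfl hu.contDiffOn hp]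
    have key : act (symPoly (S.vec j p)) (withSum w j) a =
        partialD a (k + 1 - a) (S.eqn u j) p := by
      have := hw a (by simp; omega)
      cases j with
      | none => exact this.2
      | some i => exact this.1 i
    rw [key]
    simp only
    rw [show k + 1 - a = b by omega]
    simp
  · have := congrFun (congrFun hθ ⟨(a, b), by simp only; omega⟩) j
    rw [← jetProj_jet (Nat.le_succ (k + 1)), prolongedEqn_jetProj _ hp] at this
    rw [sub_zero]
    exact this

end FirstOrderSystem

/-! ### The abelian equation as a first order system -/

theorem wedge_self_smul_add (a b c e : ℝ) (α β : Covector) :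
    wedge (a • α + b • β) (c • α + e • β) = (a * e - b * c) * wedge α β := by
  simp only [wedge, add_apply, smul_apply, smul_eq_mul]
  ring

namespace PlanarWeb.Normalization

variable {d : ℕ} {W : PlanarWeb d} {hd : 3 ≤ d} (N : W.Normalization hd) {p : Plane}

theorem wedge_form_ne_zero {i j : Fin d} (hij : i ≠ j) (hp : p ∈ W.domain) :
    wedge (N.form i p) (N.form j p) ≠ 0 := by
  have : wedge (N.form i p) (N.form j p) =
      N.scale i p * N.scale j p * wedge (W.form i p) (W.form j p) := by
    simp only [wedge, N.form_eq _ p hp, smul_apply, smul_eq_mul]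
    ring
  rw [this]
  exact mul_ne_zero (mul_ne_zero (N.scale_ne_zero i p hp) (N.scale_ne_zero j p hp))
    (W.transverse i j hij p hp)

theorem form_add_two (i : Fin (d - 2)) (hp : p ∈ W.domain) :
    N.form ⟨i + 2, by omega⟩ p = (-N.a i p) • N.om1 p + (-1 : ℝ) • N.om2 p := by
  rw [eq_neg_of_add_eq_zero_right (N.relation i p hp)]
  simp only [om1, om2]
  module

theorem a_ne_zero (i : Fin (d - 2)) (hp : p ∈ W.domain) : N.a i p ≠ 0 := by
  have h := N.wedge_form_ne_zero (i := ⟨1, by omega⟩) (j := ⟨i + 2, by omega⟩)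
    (by simp [Fin.ext_iff]) hp
  rw [N.form_add_two i hp, show N.form ⟨1, by omega⟩ p = (0 : ℝ) • N.om1 p + (1 : ℝ) • N.om2 p by
    simp [om2], wedge_self_smul_add] at h
  intro h0
  simp [h0] at h

theorem a_injective {i j : Fin (d - 2)} (hij : i ≠ j) (hp : p ∈ W.domain) :
    N.a i p - N.a j p ≠ 0 := by
  have h := N.wedge_form_ne_zero (i := ⟨i + 2, by omega⟩) (j := ⟨j + 2, by omega⟩)
    (by simpa [Fin.ext_iff] using hij) hp
  rw [N.form_add_two i hp, N.form_add_two j hp, wedge_self_smul_add] at h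
  intro h0
  refine h ?_
  linear_combination wedge (N.om1 p) (N.om2 p) * h0

theorem det_e1_e2_ne_zero (hp : p ∈ W.domain) :
    (N.e1 p).1 * (N.e2 p).2 - (N.e1 p).2 * (N.e2 p).1 ≠ 0 := by
  have h := N.wedge_ne_zero hp
  have : (N.e1 p).1 * (N.e2 p).2 - (N.e1 p).2 * (N.e2 p).1 =
      (wedge (N.om1 p) (N.om2 p))⁻¹ * ((wedge (N.om1 p) (N.om2 p))⁻¹ *
        wedge (N.om1 p) (N.om2 p)) := by
    simp only [e1, e2, Prod.smul_mk, smul_eq_mul]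
    generalize (wedge (N.om1 p) (N.om2 p))⁻¹ = c
    rw [wedge]
    ring
  rw [this, inv_mul_cancel₀ h, mul_one]
  exact inv_ne_zero h

theorem g1_smooth : ContDiffOn ℝ ∞ N.g1 W.domain :=
  ((N.extD_smooth ⟨1, by omega⟩).mul N.wedge_inv_smooth).neg

theorem g2_smooth : ContDiffOn ℝ ∞ N.g2 W.domain :=
  (N.extD_smooth ⟨0, by omega⟩).mul N.wedge_inv_smooth

theorem isFirstOrder_delta1 (k : ℕ) : IsFirstOrder W.domain (N.delta1 k) N.e1 := by
  refine ⟨N.e1_smooth, fun q => -(k * N.g1 q), (contDiffOn_const.mul N.g1_smooth).neg,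
    fun V _ _ f _ q _ => ?_⟩
  simp only [delta1]
  ring

/-- The symbol of `Δ_i`. -/
def symbolDelta (i : Fin (d - 2)) (q : Plane) : Plane := N.e1 q - N.a i q • N.e2 q

theorem isFirstOrder_Delta (i : Fin (d - 2)) (k : ℕ) :
    IsFirstOrder W.domain (N.Delta i k) (N.symbolDelta i) := by
  refine ⟨N.e1_smooth.sub ((N.a_smooth i).smul N.e2_smooth),
    fun q => -(k * N.g1 q) + k * N.g2 q * N.a i q - fderiv ℝ (N.a i) q (N.e2 q),
    ((contDiffOn_const.mul N.g1_smooth).neg.add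
      ((contDiffOn_const.mul N.g2_smooth).mul (N.a_smooth i))).sub
      (((N.a_smooth i).fderiv_of_isOpen W.isOpen (by simp)).clm_apply N.e2_smooth),
    fun V hV hVU f hf q hq => ?_⟩
  simp only [Delta, delta1, delta2, symbolDelta]
  rw [fderiv_fun_mul (differentiableAt_of_smooth W.isOpen (N.a_smooth i) (hVU hq))
    (differentiableAt_of_smooth hV hf hq)]
  simp only [add_apply, smul_apply, smul_eq_mul, map_sub, map_smul]
  ring

/-- The abelian equation as a first order system for the functions `u_i`. -/
def system : FirstOrderSystem (d - 2) where
  domain := W.domain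
  isOpen := W.isOpen
  op j := j.elim (N.delta1 1) fun i => N.Delta i 1
  vec j := j.elim N.e1 N.symbolDelta
  firstOrder j := match j with
    | none => N.isFirstOrder_delta1 1
    | some i => N.isFirstOrder_Delta i 1
  -- In the frame ∂₁, ∂₂ the symbols are (1, 0) and (1, -a_i), so the determinants are, up to sign,
  -- a_i and a_i - a_j. They are nonzero because the form with index i + 2 is transverse to ω₂ and
  -- to the other such forms.
  indep p hp i j hij := by
    have h := N.det_e1_e2_ne_zero hp
    rcases i with _ | i <;> rcases j with _ | j
    · exact absurd rfl hij
    · have : (N.e1 p).1 * (N.symbolDelta j p).2 - (N.e1 p).2 * (N.symbolDelta j p).1 =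
          -(N.a j p * ((N.e1 p).1 * (N.e2 p).2 - (N.e1 p).2 * (N.e2 p).1)) := by
        simp only [symbolDelta, Prod.fst_sub, Prod.snd_sub, Prod.smul_fst, Prod.smul_snd,
          smul_eq_mul]
        ring
      exact this.trans_ne <| neg_ne_zero.2 (mul_ne_zero (N.a_ne_zero j hp) h)
    · have : (N.symbolDelta i p).1 * (N.e1 p).2 - (N.symbolDelta i p).2 * (N.e1 p).1 =
          N.a i p * ((N.e1 p).1 * (N.e2 p).2 - (N.e1 p).2 * (N.e2 p).1) := by
        simp only [symbolDelta, Prod.fst_sub, Prod.snd_sub, Prod.smul_fst, Prod.smul_snd,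
          smul_eq_mul]
        ring
      exact this.trans_ne <| mul_ne_zero (N.a_ne_zero i hp) h
    · have : (N.symbolDelta i p).1 * (N.symbolDelta j p).2 -
          (N.symbolDelta i p).2 * (N.symbolDelta j p).1 =
          (N.a i p - N.a j p) * ((N.e1 p).1 * (N.e2 p).2 - (N.e1 p).2 * (N.e2 p).1) := by
        simp only [symbolDelta, Prod.fst_sub, Prod.snd_sub, Prod.smul_fst, Prod.smul_snd,
          smul_eq_mul]
        ring
      exact this.trans_ne <| mul_ne_zero (N.a_injective (fun h => hij (congrArg some h)) hp) h

/-- The condition on the representing function depends only on its k-jet, so any smooth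
representative will do. -/
theorem prolongation_eq_ker (k : ℕ) (hp : p ∈ W.domain) :
    N.prolongation k p = LinearMap.ker (N.system.prolongedEqn k p).toLinearMap := by
  ext θ
  rw [LinearMap.mem_ker, ContinuousLinearMap.coe_coe]
  constructor
  · rintro ⟨u, hu, rfl, h⟩
    ext α j
    rw [N.system.prolongedEqn_jet W.isOpen subset_rfl hu.contDiffOn hp]
    have := h hp α.1.1 α.1.2 (by have := α.2; omega)
    cases j with
    | none => exact this.2
    | some i => exact this.1 i
  · intro h
    obtain ⟨u, hu, rfl⟩ := exists_jet_eq p θ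
    refine ⟨u, hu, rfl, fun _ a b hab => ⟨fun i => ?_, ?_⟩⟩
    · have := N.system.prolongedEqn_jet W.isOpen subset_rfl hu.contDiffOn hp ⟨(a, b), hab⟩ (some i)
      rw [h] at this
      exact this.symm
    · have := N.system.prolongedEqn_jet W.isOpen subset_rfl hu.contDiffOn hp ⟨(a, b), hab⟩ none
      rw [h] at this
      exact this.symm

/-! ### The obstruction -/

theorem compose_append_singleton (L : List (ℕ → (Plane → ℝ) → Plane → ℝ))
    (P : ℕ → (Plane → ℝ) → Plane → ℝ) (k : ℕ) (f : Plane → ℝ) :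
    compose (L ++ [P]) k f = compose L (k + 1) (P k f) := by
  induction L with
  | nil => rfl
  | cons Q L ih =>
    simp only [List.cons_append, compose, ih, List.length_append, List.length_singleton]
    congr 1
    omega

/-- The operators in `L` are of first order, with the symbols in the list `X`. -/
def AreFirstOrder (U : Set Plane) (L : List (ℕ → (Plane → ℝ) → Plane → ℝ))
    (X : List (Plane → Plane)) : Prop :=
  List.Forall₂ (fun P X => ∀ k, IsFirstOrder U (P k) X) L X

theorem AreFirstOrder.isJetOperator {U : Set Plane} (hU : IsOpen U)
    {L : List (ℕ → (Plane → ℝ) → Plane → ℝ)} {X : List (Plane → Plane)}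
    (hL : AreFirstOrder U L X) {r l : ℕ} {Q : (Plane → Fin r → ℝ) → Plane → ℝ}
    (hQ : IsJetOperator U l Q) (k : ℕ) :
    IsJetOperator U (l + L.length) fun u => compose L k (Q u) := by
  induction hL with
  | nil => exact hQ
  | @cons P Y L X h hL ih => 
    have := (h (k + L.length)).isJetOperator_comp hU ih
    exact this

theorem AreFirstOrder.smooth {U : Set Plane} (hU : IsOpen U)
    {L : List (ℕ → (Plane → ℝ) → Plane → ℝ)} {X : List (Plane → Plane)}
    (hL : AreFirstOrder U L X) {f : Plane → ℝ} (hf : ContDiffOn ℝ ∞ f U) (k : ℕ) :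
    ContDiffOn ℝ ∞ (compose L k f) U := by
  induction hL with
  | nil => exact hf
  | cons h _ ih => exact (h _).smooth hU subset_rfl ih

/-- The leading derivatives of the result of a composition of first order operators. -/
theorem AreFirstOrder.partialD_compose {U : Set Plane} (hU : IsOpen U)
    {L : List (ℕ → (Plane → ℝ) → Plane → ℝ)} {X : List (Plane → Plane)}
    (hL : AreFirstOrder U L X) {f : Plane → ℝ} (hf : ContDiffOn ℝ ∞ f U) (hp : p ∈ U) (k : ℕ) :
    ∀ {M : ℕ}, VanishesTo (M + L.length) f p →
      VanishesTo M (compose L k f) p ∧ ∀ m ≤ M, partialD m (M - m) (compose L k f) p =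
        act (X.map fun X => symPoly (X p)).prod
          (fun m => partialD m (M + L.length - m) f p) m := by
  induction hL with
  | nil =>
    intro M h
    exact ⟨h, fun m _ => by simp [compose]⟩
  | @cons P Y L X h hL ih =>
    intro M hv
    rw [List.length_cons, ← add_assoc, add_right_comm] at hv
    obtain ⟨h1, h2⟩ := ih (M := M + 1) hv
    have hs := AreFirstOrder.smooth hU hL hf k
    have key := fun a b hab => (h (k + L.length)).partialD_of_vanishesTo hU subset_rfl hs hp
      (N := M) h1 (m := a) (n := b) hab
    refine ⟨fun a b hab => ?_, fun m hm => ?_⟩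
    · have e := key a b hab.le
      rw [h1 _ _ (by omega), h1 _ _ (by omega)] at e
      exact e.trans (by ring)
    · have e := key m (M - m) (by omega)
      have e1 := h2 (m + 1) (by omega)
      have e2 := h2 m (by omega)
      rw [show M + 1 - (m + 1) = M - m by omega] at e1
      rw [show M + 1 - m = M - m + 1 by omega] at e2
      rw [e1, e2, ← act_symPoly, ← act_mul] at e
      rw [List.map_cons, List.prod_cons, List.length_cons,
        show M + (L.length + 1) = M + 1 + L.length by omega]
      exact e

theorem AreFirstOrder.compose_apply {U : Set Plane} (hU : IsOpen U)
    {L : List (ℕ → (Plane → ℝ) → Plane → ℝ)} {X : List (Plane → Plane)}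
    (hL : AreFirstOrder U L X) {f : Plane → ℝ} (hf : ContDiffOn ℝ ∞ f U) (hp : p ∈ U) (k : ℕ)
    {l : ℕ} (hl : L.length = l) (h : VanishesTo l f p) :
    compose L k f p = act (X.map fun X => symPoly (X p)).prod
      (fun m => partialD m (l - m) f p) 0 := by
  subst hl
  have := (hL.partialD_compose hU hf hp k (M := 0) (by rwa [zero_add])).2 0 le_rfl
  simp only [zero_add] at this
  exact this

theorem areFirstOrder_ofFn {U : Set Plane} {m : ℕ} {P : Fin m → ℕ → (Plane → ℝ) → Plane → ℝ}
    {X : Fin m → Plane → Plane} (h : ∀ i k, IsFirstOrder U (P i k) (X i)) :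
    AreFirstOrder U (List.ofFn P) (List.ofFn X) := by
  rw [AreFirstOrder, List.forall₂_iff_get]
  refine ⟨by simp, fun i h1 h2 k => ?_⟩
  simpa using h _ k

theorem areFirstOrder_Delta :
    AreFirstOrder W.domain (List.ofFn N.Delta) (List.ofFn N.symbolDelta) :=
  areFirstOrder_ofFn N.isFirstOrder_Delta

theorem areFirstOrder_update (i : Fin (d - 2)) :
    AreFirstOrder W.domain (List.ofFn (Function.update N.Delta i N.delta1))
      (List.ofFn (Function.update N.symbolDelta i N.e1)) := by
  refine areFirstOrder_ofFn fun j k => ?_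
  by_cases h : j = i
  · subst h
    simpa using N.isFirstOrder_delta1 k
  · simpa [h] using N.isFirstOrder_Delta j k

/-- The crude order d - 1, from counting factors; the cancellation of the leading terms comes later.
-/
theorem isJetOperator_obstruction :
    IsJetOperator W.domain (d - 2 + 1) N.obstruction := by
  refine IsJetOperator.sum (Q := fun i u => N.box i fun q => u q i) _ fun i => ?_
  have h0 := isJetOperator_component W.domain i
  have h1 := N.areFirstOrder_Delta.isJetOperator W.isOpen
    ((N.isFirstOrder_delta1 1).isJetOperator_comp W.isOpen h0) 2
  have h2 := (N.areFirstOrder_update i).isJetOperator W.isOpen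
    ((N.isFirstOrder_Delta i 1).isJetOperator_comp W.isOpen h0) 2
  have he : (fun u : Plane → Fin (d - 2) → ℝ => N.box i fun q => u q i) = fun u q =>
      compose (List.ofFn N.Delta) 2 (N.delta1 1 fun q => u q i) q -
        compose (List.ofFn (Function.update N.Delta i N.delta1)) 2
          (N.Delta i 1 fun q => u q i) q := by
    ext u q
    simp only [box, compose_append_singleton]
  rw [he]
  exact (h1.mono (by simp; omega)).sub (h2.mono (by simp; omega))

theorem compose_sum {U : Set Plane} {L : List (ℕ → (Plane → ℝ) → Plane → ℝ)}
    (hL : ∀ P ∈ L, ∀ k, IsOperatorOn U (P k)) (k : ℕ) : IsOperatorOn U (compose L k) := by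
  induction L with
  | nil => exact isOperatorOn_id U
  | cons P L ih =>
    exact (hL P (by simp) _).comp (ih fun Q hQ => hL Q (by simp [hQ]))

/-- The first products in all □_i share the prefix Δ₁ ⋯ Δ_{d-2}, so they add up to this prefix
applied to the last equation; the second products act on the equations Δ_i u_i. Thus ϰ is a
differential consequence of the system. -/
theorem obstruction_eq {u : Plane → Fin (d - 2) → ℝ} (hu : ContDiff ℝ ∞ u) (hp : p ∈ W.domain) :
    N.obstruction u p = compose (List.ofFn N.Delta) 2 (N.system.eqn u none) p -
      ∑ i, compose (List.ofFn (Function.update N.Delta i N.delta1)) 2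
        (N.system.eqn u (some i)) p := by
  have hop : IsOperatorOn W.domain (compose (List.ofFn N.Delta) 2) :=
    compose_sum (fun P hP k => by
      obtain ⟨i, rfl⟩ := (List.mem_ofFn' _ _).1 hP
      exact N.isOperatorOn_Delta i k) 2
  have hs := hop.sum Finset.univ (f := fun i => N.delta1 1 fun q => u q i)
    (fun i _ => (N.isOperatorOn_delta1 1).smooth _ (contDiff_pi.1 hu i).contDiffOn) hp
  have he : N.system.eqn u none = fun q => ∑ i, N.delta1 1 (fun q => u q i) q := rfl
  rw [he, hs, ← Finset.sum_sub_distrib]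
  simp only [obstruction, box, compose_append_singleton]
  rfl

theorem eqn_vanishesTo {u : Plane → Fin (d - 2) → ℝ} (hu : ContDiff ℝ ∞ u) (hp : p ∈ W.domain)
    {l : ℕ} (h : N.system.prolongedEqn l p (jet l p u) = 0) (j : Option (Fin (d - 2))) :
    VanishesTo l (N.system.eqn u j) p := by
  intro a b hab
  have := N.system.prolongedEqn_jet W.isOpen subset_rfl hu.contDiffOn hp ⟨(a, b), hab⟩ j
  rw [h] at this
  exact this.symm

/-- The left-hand sides vanish to order d - 2 at p and are hit by d - 2 first order operators, so
only products of principal symbols remain. -/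
theorem obstruction_eq_symbolObstruction {u : Plane → Fin (d - 2) → ℝ} (hu : ContDiff ℝ ∞ u)
    (hp : p ∈ W.domain) (h : N.system.prolongedEqn (d - 2) p (jet (d - 2) p u) = 0) :
    N.obstruction u p = symbolObstruction (fun j => N.system.vec j p)
      (fun j m => partialD m (d - 2 - m) (N.system.eqn u j) p) := by
  have hv := N.eqn_vanishesTo hu hp h
  have hs := N.system.eqn_smooth W.isOpen subset_rfl hu.contDiffOn
  rw [N.obstruction_eq hu hp, symbolObstruction_apply,
    N.areFirstOrder_Delta.compose_apply W.isOpen (hs none) hp 2 (by simp) (hv none)]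
  congr 1
  · rw [List.map_ofFn, List.prod_ofFn]
    rfl
  · refine Finset.sum_congr rfl fun i _ => ?_
    rw [(N.areFirstOrder_update i).compose_apply W.isOpen (hs (some i)) hp 2 (by simp)
      (hv (some i)), List.map_ofFn, List.prod_ofFn, Function.comp_update,
      Finset.prod_update_of_mem (Finset.mem_univ i), Finset.sdiff_singleton_eq_erase]
    rfl

/-- One order more of vanishing leaves nothing for operators of order d - 2 to detect. -/
theorem obstruction_eq_zero_of_prolongedEqn {u : Plane → Fin (d - 2) → ℝ} (hu : ContDiff ℝ ∞ u)
    (hp : p ∈ W.domain) (h : N.system.prolongedEqn (d - 2 + 1) p (jet (d - 2 + 1) p u) = 0) :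
    N.obstruction u p = 0 := by
  have hv := N.eqn_vanishesTo hu hp h
  have hs := N.system.eqn_smooth W.isOpen subset_rfl hu.contDiffOn
  have h1 := (N.areFirstOrder_Delta.partialD_compose W.isOpen (hs none) hp 2 (M := 1)
    (by simpa [add_comm] using hv none)).1 0 0 (by omega)
  rw [N.obstruction_eq hu hp]
  refine (congrArg₂ (· - ·) h1 (Finset.sum_eq_zero fun i _ => ?_)).trans (sub_zero 0)
  exact ((N.areFirstOrder_update i).partialD_compose W.isOpen (hs (some i)) hp 2 (M := 1)
    (by simpa [add_comm] using hv (some i))).1 0 0 (by omega)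

/-- The obstruction vanishes on functions that vanish to order `d - 1`. -/
theorem obstruction_eq_zero_of_vanishesTo {u : Plane → Fin (d - 2) → ℝ} (hu : ContDiff ℝ ∞ u)
    (hp : p ∈ W.domain) (h : ∀ i, VanishesTo (d - 2 + 1) (fun q => u q i) p) :
    N.obstruction u p = 0 := by
  refine Finset.sum_eq_zero fun i _ => ?_
  have hui : ContDiffOn ℝ ∞ (fun q => u q i) W.domain := (contDiff_pi.1 hu i).contDiffOn
  have l1 : AreFirstOrder W.domain (List.ofFn N.Delta ++ [N.delta1])
      (List.ofFn N.symbolDelta ++ [N.e1]) :=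
    List.rel_append N.areFirstOrder_Delta (.cons N.isFirstOrder_delta1 .nil)
  have l2 : AreFirstOrder W.domain (List.ofFn (Function.update N.Delta i N.delta1) ++ [N.Delta i])
      (List.ofFn (Function.update N.symbolDelta i N.e1) ++ [N.symbolDelta i]) :=
    List.rel_append (N.areFirstOrder_update i) (.cons (N.isFirstOrder_Delta i) .nil)
  rw [box, l1.compose_apply W.isOpen hui hp 1 (by simp) (h i),
    l2.compose_apply W.isOpen hui hp 1 (by simp) (h i), sub_eq_zero]
  -- The two compositions contain the same symbols in different orders.
  have he : (List.map (fun X => symPoly (X p)) (List.ofFn N.symbolDelta ++ [N.e1])).prod =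
      (List.map (fun X => symPoly (X p))
        (List.ofFn (Function.update N.symbolDelta i N.e1) ++ [N.symbolDelta i])).prod := by
    rw [List.map_append, List.map_append, List.prod_append, List.prod_append, List.map_ofFn,
      List.map_ofFn, List.prod_ofFn, List.prod_ofFn, Function.comp_update,
      Finset.prod_update_of_mem (Finset.mem_univ i), Finset.sdiff_singleton_eq_erase,
      ← Finset.mul_prod_erase _ _ (Finset.mem_univ i)]
    simp only [List.map_cons, List.map_nil, List.prod_singleton, Function.comp_apply]
    ring
  rw [he]

/-- The obstruction is a linear function on jets of order `d - 2`. -/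
theorem exists_obstruction_jet : ∃ obs : Plane → Jet (d - 2) (d - 2) →ₗ[ℝ] ℝ,
    ∀ p ∈ W.domain, ∀ u : Plane → Fin (d - 2) → ℝ, ContDiff ℝ ∞ u →
      obs p (jet (d - 2) p u) = N.obstruction u p := by
  obtain ⟨c, -, hc⟩ := N.isJetOperator_obstruction
  have hc' : ∀ u : Plane → Fin (d - 2) → ℝ, ContDiff ℝ ∞ u → ∀ p ∈ W.domain,
      N.obstruction u p = c p (jet (d - 2 + 1) p u) := fun u hu p hp =>
    hc W.domain W.isOpen subset_rfl u hu.contDiffOn p hp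
  let ext : Jet (d - 2) (d - 2) →ₗ[ℝ] Jet (d - 2) (d - 2 + 1) :=
    { toFun := extendJet _ _
      map_add' := fun θ η => funext fun α => by
        change extendJet _ _ (θ + η) α = extendJet _ _ θ α + extendJet _ _ η α
        by_cases h : α.1.1 + α.1.2 ≤ d - 2
        · rw [extendJet_of_le h, extendJet_of_le h, extendJet_of_le h]; rfl
        · rw [extendJet_of_not_le h, extendJet_of_not_le h, extendJet_of_not_le h, add_zero]
      map_smul' := fun c θ => funext fun α => by
        change extendJet _ _ (c • θ) α = c • extendJet _ _ θ α
        by_cases h : α.1.1 + α.1.2 ≤ d - 2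
        · rw [extendJet_of_le h, extendJet_of_le h]; rfl
        · rw [extendJet_of_not_le h, extendJet_of_not_le h, smul_zero] }
  refine ⟨fun p => (c p).toLinearMap ∘ₗ ext, fun p hp u hu => ?_⟩
  -- The difference between the (d - 1)-jet of u and the extension by zero of its (d - 2)-jet is
  -- purely of top order, and ϰ does not see it.
  obtain ⟨v, hv, hv'⟩ := exists_jet_eq p (jet (d - 2 + 1) p u - ext (jet (d - 2) p u))
  have hproj : jet (d - 2) p v = 0 := by
    rw [← jetProj_jet (Nat.le_succ (d - 2)), hv', map_sub, jetProj_jet]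
    exact sub_eq_zero.2 (jetProj_extendJet _ _).symm
  have h0 := N.obstruction_eq_zero_of_vanishesTo hv hp fun i a b hab =>
    congrFun (congrFun hproj ⟨(a, b), Nat.lt_succ_iff.1 hab⟩) i
  rw [hc' v hv p hp, hv', map_sub, sub_eq_zero, ← hc' u hu p hp] at h0
  exact h0.symm

end PlanarWeb.Normalization

/-! ### Restatements with n in place of k + 1, to be used for n = d - 2 and k = d - 3. -/

namespace FirstOrderSystem

variable {n k : ℕ} {S : FirstOrderSystem n} {p : Plane}

theorem exists_solution_of_lift (hk : k + 1 = n)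
    (H : ∀ q ∈ S.domain, ∀ θ : Jet n n, S.prolongedEqn n q θ = 0 → ∃ θ',
      S.prolongedEqn (n + 1) q θ' = 0 ∧ jetProj (Nat.le_succ n) θ' = θ)
    (hp : p ∈ S.domain) {θ : Jet n k} (hθ : S.prolongedEqn k p θ = 0) :
    ∃ V, IsOpen V ∧ p ∈ V ∧ V ⊆ S.domain ∧ ∃ u, S.IsSolutionOn V u ∧ jet k p u = θ := by
  subst hk
  exact exists_solution rfl H hp hθ

theorem exists_lift_of_symbolObstruction (hn : 0 < n) (hp : p ∈ S.domain)
    {u : Plane → Fin n → ℝ} (hu : ContDiff ℝ ∞ u) (hθ : S.prolongedEqn n p (jet n p u) = 0)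
    (h : symbolObstruction (fun j => S.vec j p)
      (fun j m => partialD m (n - m) (S.eqn u j) p) = 0) :
    ∃ θ', S.prolongedEqn (n + 1) p θ' = 0 ∧ jetProj (Nat.le_succ n) θ' = jet n p u := by
  obtain ⟨k, rfl⟩ : ∃ k, n = k + 1 := ⟨n - 1, by omega⟩
  exact exists_lift_of_obstruction rfl hp hu hθ h

theorem bijOn_jetProj_ker (hk : k + 1 = n) (h : k ≤ n) (hp : p ∈ S.domain) :
    Set.BijOn (jetProj (r := n) h) (LinearMap.ker (S.prolongedEqn n p).toLinearMap)
      (LinearMap.ker (S.prolongedEqn k p).toLinearMap) := by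
  subst hk
  exact bijOn_jetProj rfl hp

theorem jetContract_eq_connForm (hk : k + 1 = n) (h : k + 1 ≤ n) (h' : k ≤ n) (hp : p ∈ S.domain)
    {η : Jet n n} (hη : S.prolongedEqn n p η = 0) (v : Plane) :
    jetContract h v η = S.connForm k p v (jetProj h' η) := by
  subst hk
  conv_lhs => rw [eq_liftL rfl hp hη]
  rfl

end FirstOrderSystem

theorem jet_congr {r k : ℕ} {u v : Plane → Fin r → ℝ} {p : Plane} (h : u =ᶠ[𝓝 p] v) :
    jet k p u = jet k p v := by
  obtain ⟨V, hVs, hV, hpV⟩ := mem_nhds_iff.1 h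
  ext α i
  exact (isOperatorOn_partialD hV _ _).congr _ _ (fun q hq => congrFun (hVs hq) i) hpV

theorem sum_fin_eq {A : Type*} [AddCommMonoid A] {d : ℕ} (hd : 2 ≤ d) (f : Fin d → A) :
    ∑ i, f i = f ⟨0, by omega⟩ + f ⟨1, by omega⟩ + ∑ i : Fin (d - 2), f ⟨i + 2, by omega⟩ := by
  obtain ⟨m, rfl⟩ := Nat.exists_eq_add_of_le' hd
  rw [Fin.sum_univ_succ, Fin.sum_univ_succ]
  exact (add_assoc _ _ _).symm

theorem extD_smul_eq {f : Plane → ℝ} {β : Plane → Covector} {p : Plane}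
    (hf : DifferentiableAt ℝ f p) (hβ : DifferentiableAt ℝ β p) :
    extD (fun q => f q • β q) p = dx f p * β p ey - dy f p * β p ex + f p * extD β p := by
  simp only [extD, fderiv_fun_smul hf hβ, dx, dy, add_apply, smul_apply,
    ContinuousLinearMap.smulRight_apply, smul_eq_mul]
  ring

theorem extD_congr {β η : Plane → Covector} {V : Set Plane} (hV : IsOpen V) (h : EqOn β η V)
    {p : Plane} (hp : p ∈ V) : extD β p = extD η p := by
  have : β =ᶠ[𝓝 p] η := h.eventuallyEq_of_mem (hV.mem_nhds hp)
  simp only [extD, this.fderiv_eq]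

/-! ### Existence of a normalization. -/

namespace PlanarWeb

/-- The coefficient of `ω_i ∧ ω_j` for the given forms of the web. -/
def wedgeForm {d : ℕ} (W : PlanarWeb d) (i j : Fin d) (p : Plane) : ℝ :=
  wedge (W.form i p) (W.form j p)

section NormalizationExists

variable {d : ℕ} (W : PlanarWeb d)

theorem wedgeForm_smooth (i j : Fin d) : ContDiffOn ℝ ∞ (W.wedgeForm i j) W.domain :=
  (((W.smooth i).clm_apply contDiffOn_const).mul ((W.smooth j).clm_apply contDiffOn_const)).sub
    (((W.smooth i).clm_apply contDiffOn_const).mul ((W.smooth j).clm_apply contDiffOn_const))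

theorem wedgeForm_ne_zero {i j : Fin d} (hij : i.1 ≠ j.1) {p : Plane} (hp : p ∈ W.domain) :
    W.wedgeForm i j p ≠ 0 :=
  W.transverse i j (fun h => hij (congrArg Fin.val h)) p hp

/-- Cramer's rule for three covectors in the plane. -/
theorem wedgeForm_smul (i j k : Fin d) (p : Plane) :
    W.wedgeForm i j p • W.form k p =
      W.wedgeForm k j p • W.form i p + W.wedgeForm i k p • W.form j p := by
  refine ContinuousLinearMap.ext fun v => ?_
  rw [clm_apply_eq, clm_apply_eq (W.wedgeForm k j p • W.form i p + W.wedgeForm i k p • W.form j p)]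
  simp only [add_apply, smul_apply, smul_eq_mul, wedgeForm, wedge]
  ring

variable (i₀ i₁ i₂ : Fin d)

/-- The ratio of the coefficients in the linear relation between `ω_j` and two of the forms. -/
def relationRatio (j : Fin d) (p : Plane) : ℝ :=
  W.wedgeForm j i₁ p / W.wedgeForm i₀ j p

variable {i₀ i₁ i₂}

theorem relationRatio_smooth {j : Fin d} (h0 : i₀.1 ≠ j.1) :
    ContDiffOn ℝ ∞ (W.relationRatio i₀ i₁ j) W.domain :=
  (W.wedgeForm_smooth j i₁).div (W.wedgeForm_smooth i₀ j) fun _ => W.wedgeForm_ne_zero h0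

theorem relationRatio_ne_zero {j : Fin d} (h0 : i₀.1 ≠ j.1) (h1 : j.1 ≠ i₁.1) {p : Plane}
    (hp : p ∈ W.domain) : W.relationRatio i₀ i₁ j p ≠ 0 :=
  div_ne_zero (W.wedgeForm_ne_zero h1 hp) (W.wedgeForm_ne_zero h0 hp)

variable (i₀ i₁ i₂) in
/-- Factors that normalize the forms of the web. -/
def normalizingScale (j : Fin d) (p : Plane) : ℝ :=
  if j.1 = i₀.1 then W.relationRatio i₀ i₁ i₂ p
  else if j.1 = i₁.1 then 1
  else -(W.wedgeForm i₀ i₁ p / W.wedgeForm i₀ j p)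

theorem normalizingScale_smooth (h : i₀.1 ≠ i₂.1) (j : Fin d) :
    ContDiffOn ℝ ∞ (W.normalizingScale i₀ i₁ i₂ j) W.domain := by
  unfold normalizingScale
  split_ifs with h0 h1
  · exact W.relationRatio_smooth h
  · exact contDiffOn_const
  · exact ((W.wedgeForm_smooth i₀ i₁).div (W.wedgeForm_smooth i₀ j)
      fun _ => W.wedgeForm_ne_zero (Ne.symm h0)).neg

theorem normalizingScale_ne_zero (h01 : i₀.1 ≠ i₁.1) (h02 : i₀.1 ≠ i₂.1) (h21 : i₂.1 ≠ i₁.1)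
    (j : Fin d) {p : Plane} (hp : p ∈ W.domain) : W.normalizingScale i₀ i₁ i₂ j p ≠ 0 := by
  unfold normalizingScale
  split_ifs with h0 h1
  · exact W.relationRatio_ne_zero h02 h21 hp
  · exact one_ne_zero
  · exact neg_ne_zero.2 (div_ne_zero (W.wedgeForm_ne_zero h01 hp)
      (W.wedgeForm_ne_zero (Ne.symm h0) hp))

/-- Dividing Cramer's rule by the coefficient of ω_{i₀} ∧ ω_j leaves ω_{i₁} with coefficient 1 and
ω_{i₀} with `relationRatio` of j. Absorbing the ratio of i₂ into ω_{i₀} makes the new coefficient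
equal to 1 for j = i₂. -/
theorem normalizingScale_relation (h01 : i₀.1 ≠ i₁.1) (h02 : i₀.1 ≠ i₂.1) (h21 : i₂.1 ≠ i₁.1)
    {j : Fin d} (h0 : j.1 ≠ i₀.1) (h1 : j.1 ≠ i₁.1) {p : Plane} (hp : p ∈ W.domain) :
    (W.relationRatio i₀ i₁ j p / W.relationRatio i₀ i₁ i₂ p) •
        (W.normalizingScale i₀ i₁ i₂ i₀ p • W.form i₀ p) +
      W.normalizingScale i₀ i₁ i₂ i₁ p • W.form i₁ p +
      W.normalizingScale i₀ i₁ i₂ j p • W.form j p = 0 := by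
  have hj := W.wedgeForm_ne_zero (Ne.symm h0) hp
  have h2 := W.relationRatio_ne_zero h02 h21 hp
  have s0 : W.normalizingScale i₀ i₁ i₂ i₀ p = W.relationRatio i₀ i₁ i₂ p := if_pos rfl
  have s1 : W.normalizingScale i₀ i₁ i₂ i₁ p = 1 := (if_neg (Ne.symm h01)).trans (if_pos rfl)
  have s2 : W.normalizingScale i₀ i₁ i₂ j p = -(W.wedgeForm i₀ i₁ p / W.wedgeForm i₀ j p) :=
    (if_neg h0).trans (if_neg h1)
  have e : (W.wedgeForm i₀ i₁ p / W.wedgeForm i₀ j p) • W.form j p =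
      W.relationRatio i₀ i₁ j p • W.form i₀ p + W.form i₁ p := by
    rw [div_eq_inv_mul, mul_smul, wedgeForm_smul, smul_add, smul_smul, smul_smul,
      inv_mul_cancel₀ hj, one_smul, relationRatio, div_eq_inv_mul]
  rw [s0, s1, s2, smul_smul, div_mul_cancel₀ _ h2, one_smul,
    ← e, ← add_smul, add_neg_cancel, zero_smul]

theorem nonempty_normalization (hd : 3 ≤ d) : Nonempty (W.Normalization hd) := by
  have h01 : (⟨0, by omega⟩ : Fin d).1 ≠ (⟨1, by omega⟩ : Fin d).1 := by simp
  have h02 : (⟨0, by omega⟩ : Fin d).1 ≠ (⟨2, by omega⟩ : Fin d).1 := by simp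
  have h21 : (⟨2, by omega⟩ : Fin d).1 ≠ (⟨1, by omega⟩ : Fin d).1 := by simp
  have h0 : ∀ i : Fin (d - 2), (⟨i + 2, by omega⟩ : Fin d).1 ≠ (⟨0, by omega⟩ : Fin d).1 := by simp
  have h1 : ∀ i : Fin (d - 2), (⟨i + 2, by omega⟩ : Fin d).1 ≠ (⟨1, by omega⟩ : Fin d).1 := by simp
  have ha : ∀ p ∈ W.domain, W.relationRatio ⟨0, by omega⟩ ⟨1, by omega⟩ ⟨2, by omega⟩ p /
      W.relationRatio ⟨0, by omega⟩ ⟨1, by omega⟩ ⟨2, by omega⟩ p = 1 :=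
    fun p hp => div_self (W.relationRatio_ne_zero h02 h21 hp)
  have hs := fun i : Fin (d - 2) =>
    (W.relationRatio_smooth (i₁ := ⟨1, by omega⟩) (h0 i).symm).div
      (W.relationRatio_smooth (i₁ := ⟨1, by omega⟩) h02)
      fun p hp => W.relationRatio_ne_zero h02 h21 hp
  have hr := fun (i : Fin (d - 2)) p (hp : p ∈ W.domain) =>
    W.normalizingScale_relation h01 h02 h21 (h0 i) (h1 i) hp
  exact ⟨⟨_, _, _, W.normalizingScale_smooth h02,
    fun i p hp => W.normalizingScale_ne_zero h01 h02 h21 i hp, fun _ _ _ => rfl, hs, hr, ha⟩⟩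

end NormalizationExists

/-! ### Equivalence of the abelian equation with the system for the functions u_i. -/

namespace Normalization

variable {d : ℕ} {W : PlanarWeb d} {hd : 3 ≤ d} (N : W.Normalization hd) {p : Plane}
  {V : Set Plane}

theorem form_differentiableAt (i : Fin d) (hp : p ∈ W.domain) :
    DifferentiableAt ℝ (N.form i) p :=
  ((N.om_smooth i p hp).contDiffAt (W.isOpen.mem_nhds hp)).differentiableAt (by simp)

/-- Since dω₁ = g₂ ω₁ ∧ ω₂, the term f dω₁ is exactly the weight one correction in δ₂. -/
theorem extD_smul_om1 {f : Plane → ℝ} (hf : DifferentiableAt ℝ f p) (hp : p ∈ W.domain) :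
    extD (fun q => f q • N.om1 q) p = -(wedge (N.om1 p) (N.om2 p) * N.delta2 1 f p) := by
  have h := N.wedge_ne_zero hp
  have h' : DifferentiableAt ℝ N.om1 p := N.form_differentiableAt _ hp
  rw [extD_smul_eq hf h', delta2, fderiv_eq_dx_dy, g2]
  simp only [e2, Prod.smul_mk, smul_eq_mul]
  field_simp
  simp only [om1]
  ring

theorem extD_smul_om2 {f : Plane → ℝ} (hf : DifferentiableAt ℝ f p) (hp : p ∈ W.domain) :
    extD (fun q => f q • N.om2 q) p = wedge (N.om1 p) (N.om2 p) * N.delta1 1 f p := by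
  have h := N.wedge_ne_zero hp
  have h' : DifferentiableAt ℝ N.om2 p := N.form_differentiableAt _ hp
  rw [extD_smul_eq hf h', delta1, fderiv_eq_dx_dy, g1]
  simp only [e1, Prod.smul_mk, smul_eq_mul]
  field_simp
  simp only [om2]
  ring

/-- By the relation, f ω_{i+2} = -a_i f ω₁ - f ω₂, and the two preceding formulas combine to Δ_i. -/
theorem extD_smul_form (hV : IsOpen V) (hVW : V ⊆ W.domain) {f : Plane → ℝ}
    (hf : ContDiffOn ℝ ∞ f V) (i : Fin (d - 2)) (hp : p ∈ V) :
    extD (fun q => f q • N.form ⟨i + 2, by omega⟩ q) p =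
      -(wedge (N.om1 p) (N.om2 p) * N.Delta i 1 f p) := by
  have hpW := hVW hp
  have haf : DifferentiableAt ℝ (fun q => N.a i q * f q) p :=
    differentiableAt_of_smooth hV (((N.a_smooth i).mono hVW).mul hf) hp
  have hfp := differentiableAt_of_smooth hV hf hp
  have e : EqOn (fun q => f q • N.form ⟨i + 2, by omega⟩ q)
      (fun q => (-1 : ℝ) • ((N.a i q * f q) • N.om1 q) + (-1 : ℝ) • (f q • N.om2 q)) V := by
    intro q hq
    simp only
    rw [N.form_add_two i (hVW hq)]
    module
  have d1 : DifferentiableAt ℝ (fun q => (N.a i q * f q) • N.om1 q) p :=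
    haf.smul (N.form_differentiableAt ⟨0, by omega⟩ hpW)
  have d2 : DifferentiableAt ℝ (fun q => f q • N.om2 q) p :=
    hfp.smul (N.form_differentiableAt ⟨1, by omega⟩ hpW)
  have c1 : DifferentiableAt ℝ (fun q => (-1 : ℝ) • ((N.a i q * f q) • N.om1 q)) p :=
    d1.fun_const_smul _
  have c2 : DifferentiableAt ℝ (fun q => (-1 : ℝ) • (f q • N.om2 q)) p := d2.fun_const_smul _
  rw [extD_congr hV e hp, extD_add c1 c2, extD_smul _ d1,
    extD_smul _ d2, N.extD_smul_om1 haf hpW, N.extD_smul_om2 hfp hpW, Delta]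
  ring

theorem eq_zero_of_smul_om {b c : ℝ} (hp : p ∈ W.domain) (h : b • N.om1 p + c • N.om2 p = 0) :
    b = 0 ∧ c = 0 := by
  have hw := N.wedge_ne_zero hp
  have h1 : wedge (b • N.om1 p + c • N.om2 p) ((0 : ℝ) • N.om1 p + (1 : ℝ) • N.om2 p) = 0 := by
    rw [h]; simp [wedge]
  have h2 : wedge (b • N.om1 p + c • N.om2 p) ((1 : ℝ) • N.om1 p + (0 : ℝ) • N.om2 p) = 0 := by
    rw [h]; simp [wedge]
  rw [wedge_self_smul_add] at h1 h2
  exact ⟨by simpa [hw] using h1, by simpa [hw] using h2⟩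

/-- The solutions of the abelian equation for the normalized forms. -/
structure IsNormalizedSolution (V : Set Plane) (mu : Plane → Fin d → ℝ) : Prop where
  smooth : ContDiffOn ℝ ∞ mu V
  sum_eq_zero : ∀ p ∈ V, ∑ i, mu p i • N.form i p = 0
  closed : ∀ i, ∀ p ∈ V, extD (fun q => mu q i • N.form i q) p = 0

variable {N}

theorem _root_.Web.PlanarWeb.IsAbelianSolution.normalized (hV : IsOpen V) (hVW : V ⊆ W.domain)
    {lam : Plane → Fin d → ℝ} (h : W.IsAbelianSolution V lam) :
    N.IsNormalizedSolution V fun q i => lam q i / N.scale i q := by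
  have e : ∀ i, ∀ q ∈ V, (lam q i / N.scale i q) • N.form i q = lam q i • W.form i q := by
    intro i q hq
    rw [N.form_eq i q (hVW hq), smul_smul, div_mul_cancel₀ _ (N.scale_ne_zero i q (hVW hq))]
  refine ⟨contDiffOn_pi.2 fun i => (contDiffOn_pi.1 h.smooth i).div ((N.scale_smooth i).mono hVW)
    fun q hq => N.scale_ne_zero i q (hVW hq), fun q hq => ?_, fun i q hq => ?_⟩
  · rw [← h.sum_eq_zero q hq]
    exact Finset.sum_congr rfl fun i _ => e i q hq
  · rw [← h.closed i q hq]
    exact extD_congr hV (e i) hq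

theorem IsNormalizedSolution.abelian (hV : IsOpen V) (hVW : V ⊆ W.domain)
    {mu : Plane → Fin d → ℝ} (h : N.IsNormalizedSolution V mu) :
    W.IsAbelianSolution V fun q i => mu q i * N.scale i q := by
  have e : ∀ i, ∀ q ∈ V, (mu q i * N.scale i q) • W.form i q = mu q i • N.form i q := by
    intro i q hq
    rw [N.form_eq i q (hVW hq), smul_smul]
  refine ⟨contDiffOn_pi.2 fun i => (contDiffOn_pi.1 h.smooth i).mul ((N.scale_smooth i).mono hVW),
    fun q hq => ?_, fun i q hq => ?_⟩
  · rw [← h.sum_eq_zero q hq]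
    exact Finset.sum_congr rfl fun i _ => e i q hq
  · rw [← h.closed i q hq]
    exact extD_congr hV (e i) hq

variable (N) in
theorem sum_smul_form (c : Fin d → ℝ) (hp : p ∈ W.domain) :
    ∑ i, c i • N.form i p =
      (c ⟨0, by omega⟩ - ∑ i : Fin (d - 2), N.a i p * c ⟨i + 2, by omega⟩) • N.om1 p +
      (c ⟨1, by omega⟩ - ∑ i : Fin (d - 2), c ⟨i + 2, by omega⟩) • N.om2 p := by
  have h : ∑ i : Fin (d - 2), c ⟨i + 2, by omega⟩ • N.form ⟨i + 2, by omega⟩ p =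
      (-∑ i : Fin (d - 2), N.a i p * c ⟨i + 2, by omega⟩) • N.om1 p +
      (-∑ i : Fin (d - 2), c ⟨i + 2, by omega⟩) • N.om2 p := by
    rw [← Finset.sum_neg_distrib, ← Finset.sum_neg_distrib, Finset.sum_smul, Finset.sum_smul,
      ← Finset.sum_add_distrib]
    refine Finset.sum_congr rfl fun i _ => ?_
    rw [N.form_add_two i hp]
    module
  rw [sum_fin_eq (by omega), h]
  simp only [om1, om2]
  module

/-- The first two coefficients are determined by the others, so the u_i carry the whole solution. -/
theorem IsNormalizedSolution.eq_sum (hVW : V ⊆ W.domain) {mu : Plane → Fin d → ℝ}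
    (h : N.IsNormalizedSolution V mu) (hp : p ∈ V) :
    mu p ⟨0, by omega⟩ = ∑ i : Fin (d - 2), N.a i p * mu p ⟨i + 2, by omega⟩ ∧
      mu p ⟨1, by omega⟩ = ∑ i : Fin (d - 2), mu p ⟨i + 2, by omega⟩ := by
  have h1 := h.sum_eq_zero p hp
  rw [N.sum_smul_form _ (hVW hp)] at h1
  obtain ⟨h2, h3⟩ := N.eq_zero_of_smul_om (hVW hp) h1
  exact ⟨sub_eq_zero.1 h2, sub_eq_zero.1 h3⟩

theorem IsNormalizedSolution.isSolutionOn (hV : IsOpen V) (hVW : V ⊆ W.domain)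
    {mu : Plane → Fin d → ℝ} (h : N.IsNormalizedSolution V mu) :
    N.system.IsSolutionOn V fun q i => mu q ⟨i + 2, by omega⟩ := by
  have hs := contDiffOn_pi.1 h.smooth
  refine ⟨contDiffOn_pi.2 fun i => hs _, fun j q hq => ?_⟩
  have hw := N.wedge_ne_zero (hVW hq)
  cases j with
  | none =>
    have h2 := N.extD_smul_om2 (differentiableAt_of_smooth hV (hs ⟨1, by omega⟩) hq) (hVW hq)
    have h1 := h2.symm.trans (h.closed ⟨1, by omega⟩ q hq)
    have h3 := (mul_eq_zero.1 h1).resolve_left hw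
    have hop : EqOn (fun q => mu q ⟨1, by omega⟩)
        (fun q => ∑ i : Fin (d - 2), mu q ⟨i + 2, by omega⟩) V := fun q hq =>
      (h.eq_sum hVW hq).2
    have h4 : N.delta1 1 (fun q => mu q ⟨1, by omega⟩) q =
        ∑ i : Fin (d - 2), N.delta1 1 (fun q => mu q ⟨i + 2, by omega⟩) q := by
      have he : (fun q => mu q ⟨1, by omega⟩) =ᶠ[𝓝 q]
          fun q => ∑ i : Fin (d - 2), mu q ⟨i + 2, by omega⟩ :=
        hop.eventuallyEq_of_mem (hV.mem_nhds hq)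
      simp only [delta1, he.fderiv_eq, hop hq]
      rw [fderiv_fun_sum fun i _ => differentiableAt_of_smooth hV (hs _) hq,
        Finset.sum_sub_distrib, Finset.mul_sum, sum_apply]
    exact h4.symm.trans h3
  | some i =>
    have h1 := h.closed ⟨i + 2, by omega⟩ q hq
    rw [N.extD_smul_form hV hVW (hs _) i hq] at h1
    exact (mul_eq_zero.1 (neg_eq_zero.1 h1)).resolve_left hw

variable (N) in
/-- The functions `λ_i` in terms of the functions `u_i`. -/
def fullSolution (u : Plane → Fin (d - 2) → ℝ) (q : Plane) (j : Fin d) : ℝ :=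
  if j.1 = 0 then ∑ i, N.a i q * u q i else if j.1 = 1 then ∑ i, u q i else
    if h : 2 ≤ j.1 then u q ⟨j.1 - 2, by omega⟩ else 0

theorem fullSolution_add_two (u : Plane → Fin (d - 2) → ℝ) (q : Plane) (i : Fin (d - 2)) :
    N.fullSolution u q ⟨i + 2, by omega⟩ = u q i := by
  simp [fullSolution]

theorem isNormalizedSolution_fullSolution (hV : IsOpen V) (hVW : V ⊆ W.domain)
    {u : Plane → Fin (d - 2) → ℝ} (h : N.system.IsSolutionOn V u) :
    N.IsNormalizedSolution V (N.fullSolution u) := by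
  have hs := contDiffOn_pi.1 h.smooth
  have has : ∀ i, ContDiffOn ℝ ∞ (fun q => N.a i q * u q i) V := fun i =>
    ((N.a_smooth i).mono hVW).mul (hs i)
  refine ⟨contDiffOn_pi.2 fun j => ?_, fun q hq => ?_, fun j q hq => ?_⟩
  · by_cases h0 : j.1 = 0
    · simp only [fullSolution, h0, if_true]
      exact ContDiffOn.sum fun i _ => has i
    by_cases h1 : j.1 = 1
    · simp only [fullSolution, h1, one_ne_zero, if_false, if_true]
      exact ContDiffOn.sum fun i _ => hs i
    · have h2 : 2 ≤ j.1 := by omega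
      simp only [fullSolution, h0, h1, if_false, dif_pos h2]
      exact hs _
  · rw [N.sum_smul_form _ (hVW hq)]
    simp only [fullSolution_add_two]
    simp [fullSolution]
  · have h0 : ∑ i, N.delta1 1 (fun q => u q i) q = 0 := h.eqn_eq_zero none q hq
    have hi : ∀ i, N.Delta i 1 (fun q => u q i) q = 0 := fun i => h.eqn_eq_zero (some i) q hq
    have d1 := fun i => differentiableAt_of_smooth hV (hs i) hq
    have d2 := fun i => differentiableAt_of_smooth hV (has i) hq
    obtain ⟨j, hj⟩ := j
    rcases j with _ | _ | j
    · refine (N.extD_smul_om1 (f := fun q => ∑ i, N.a i q * u q i)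
        (DifferentiableAt.fun_sum fun i _ => d2 i) (hVW hq)).trans ?_
      have e : N.delta2 1 (fun q => ∑ i, N.a i q * u q i) q =
          ∑ i, N.delta2 1 (fun q => N.a i q * u q i) q := by
        simp only [delta2]
        rw [fderiv_fun_sum fun i _ => d2 i, Finset.sum_sub_distrib, Finset.mul_sum, sum_apply]
      -- Closedness of λ₁ω₁ is no separate equation: Δ_i u_i = 0 turns δ₂(a_i u_i) into δ₁ u_i, and
      -- the sum of these vanishes.
      have e2 : ∑ i, N.delta2 1 (fun q => N.a i q * u q i) q = 0 := by
        rw [← h0]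
        exact Finset.sum_congr rfl fun i _ => (sub_eq_zero.1 (hi i)).symm
      rw [e, e2]
      simp
    · refine (N.extD_smul_om2 (f := fun q => ∑ i, u q i)
        (DifferentiableAt.fun_sum fun i _ => d1 i) (hVW hq)).trans ?_
      have e : N.delta1 1 (fun q => ∑ i, u q i) q = ∑ i, N.delta1 1 (fun q => u q i) q := by
        simp only [delta1]
        rw [fderiv_fun_sum fun i _ => d1 i, Finset.sum_sub_distrib, Finset.mul_sum, sum_apply]
      rw [e, h0, mul_zero]
    · have := N.extD_smul_form hV hVW (hs ⟨j, by omega⟩) ⟨j, by omega⟩ hq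
      rw [hi, mul_zero, neg_zero] at this
      exact this

/-! ### The jets of the solutions of the abelian equation -/

theorem exists_representative (hp : p ∈ W.domain) (g : W.abelianGerms p) :
    ∃ lam : Plane → Fin d → ℝ, (lam : Germ (𝓝 p) (Fin d → ℝ)) = g ∧
      ∃ V, IsOpen V ∧ p ∈ V ∧ V ⊆ W.domain ∧ W.IsAbelianSolution V lam := by
  obtain ⟨lam, hl, V, hV, hpV, h⟩ := g.2
  exact ⟨lam, hl, V ∩ W.domain, hV.inter W.isOpen, ⟨hpV, hp⟩, inter_subset_right, h⟩

variable (N) in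
/-- The functions `u_i` in terms of the functions `λ_i`. -/
def reduced (lam : Plane → Fin d → ℝ) (q : Plane) (i : Fin (d - 2)) : ℝ :=
  lam q ⟨i + 2, by omega⟩ / N.scale ⟨i + 2, by omega⟩ q

theorem isSolutionOn_reduced (hV : IsOpen V) (hVW : V ⊆ W.domain) {lam : Plane → Fin d → ℝ}
    (h : W.IsAbelianSolution V lam) : N.system.IsSolutionOn V (N.reduced lam) :=
  (h.normalized hV hVW (N := N)).isSolutionOn hV hVW

theorem jet_reduced_congr {k : ℕ} {lam mu : Plane → Fin d → ℝ}
    (h : (lam : Germ (𝓝 p) (Fin d → ℝ)) = mu) :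
    jet k p (N.reduced lam) = jet k p (N.reduced mu) := by
  refine jet_congr ((Germ.coe_eq.1 h).mono fun q hq => ?_)
  ext i
  simp only [reduced, hq]

theorem jet_add {r k : ℕ} (hV : IsOpen V) (hp : p ∈ V) {u v : Plane → Fin r → ℝ}
    (hu : ContDiffOn ℝ ∞ u V) (hv : ContDiffOn ℝ ∞ v V) :
    jet k p (fun q i => u q i + v q i) = jet k p u + jet k p v := by
  ext α i
  exact (isOperatorOn_partialD hV _ _).add _ _ (contDiffOn_pi.1 hu i) (contDiffOn_pi.1 hv i) hp

theorem jet_smul {r k : ℕ} (hV : IsOpen V) (hp : p ∈ V) (c : ℝ) {u : Plane → Fin r → ℝ}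
    (hu : ContDiffOn ℝ ∞ u V) : jet k p (fun q i => c * u q i) = c • jet k p u := by
  ext α i
  exact (isOperatorOn_partialD hV _ _).smul c _ (contDiffOn_pi.1 hu i) hp

variable (N) in
/-- The `k`-jet at `p` of a germ of a solution of the abelian equation. -/
def germJet (k : ℕ) (hp : p ∈ W.domain) : W.abelianGerms p →ₗ[ℝ] Jet (d - 2) k where
  toFun g := jet k p (N.reduced (exists_representative hp g).choose)
  map_add' g h := by
    obtain ⟨eg, V, hV, hpV, hVW, sg⟩ := (exists_representative hp g).choose_spec
    obtain ⟨eh, V', hV', hpV', hVW', sh⟩ := (exists_representative hp h).choose_spec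
    set lg := (exists_representative hp g).choose
    set lh := (exists_representative hp h).choose
    have e : ((exists_representative hp (g + h)).choose : Germ (𝓝 p) (Fin d → ℝ)) =
        (lg + lh : Plane → Fin d → ℝ) := by
      rw [(exists_representative hp (g + h)).choose_spec.1, Germ.coe_add, eg, eh]
      rfl
    rw [jet_reduced_congr e]
    have e' : N.reduced (lg + lh) = fun q i => N.reduced lg q i + N.reduced lh q i := by
      ext q i
      simp only [reduced, Pi.add_apply, add_div]
    rw [e']
    exact jet_add (hV.inter hV') ⟨hpV, hpV'⟩
      ((isSolutionOn_reduced hV hVW sg).smooth.mono inter_subset_left)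
      ((isSolutionOn_reduced hV' hVW' sh).smooth.mono inter_subset_right)
  map_smul' c g := by
    obtain ⟨eg, V, hV, hpV, hVW, sg⟩ := (exists_representative hp g).choose_spec
    set lg := (exists_representative hp g).choose
    have e : ((exists_representative hp (c • g)).choose : Germ (𝓝 p) (Fin d → ℝ)) =
        (c • lg : Plane → Fin d → ℝ) := by
      rw [(exists_representative hp (c • g)).choose_spec.1, Germ.coe_smul, eg]
      rfl
    rw [jet_reduced_congr e]
    have e' : N.reduced (c • lg) = fun q i => c * N.reduced lg q i := by
      ext q i
      simp only [reduced, Pi.smul_apply, smul_eq_mul, mul_div_assoc]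
    rw [e']
    exact jet_smul hV hpV c (isSolutionOn_reduced hV hVW sg).smooth

theorem germJet_apply {k : ℕ} (hp : p ∈ W.domain) {g : W.abelianGerms p}
    {lam : Plane → Fin d → ℝ} (h : (lam : Germ (𝓝 p) (Fin d → ℝ)) = g) :
    N.germJet k hp g = jet k p (N.reduced lam) :=
  jet_reduced_congr ((exists_representative hp g).choose_spec.1.trans h.symm)

/-- Every local solution of the reduced system comes from a germ of an abelian solution, through
`fullSolution`. -/
theorem mem_range_germJet {k : ℕ} (hp : p ∈ W.domain) {θ : Jet (d - 2) k} :
    θ ∈ LinearMap.range (N.germJet k hp) ↔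
      ∃ V, IsOpen V ∧ p ∈ V ∧ V ⊆ W.domain ∧ ∃ u, N.system.IsSolutionOn V u ∧ jet k p u = θ := by
  constructor
  · rintro ⟨g, rfl⟩
    obtain ⟨lam, hl, V, hV, hpV, hVW, h⟩ := exists_representative hp g
    exact ⟨V, hV, hpV, hVW, _, isSolutionOn_reduced hV hVW h, (germJet_apply hp hl).symm⟩
  · rintro ⟨V, hV, hpV, hVW, u, hu, rfl⟩
    have hs := (isNormalizedSolution_fullSolution hV hVW hu).abelian hV hVW
    refine ⟨⟨_, _, rfl, V, hV, hpV, hs.mono W inter_subset_left⟩, ?_⟩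
    rw [germJet_apply hp rfl]
    refine jet_congr (Filter.eventuallyEq_of_mem (hV.mem_nhds hpV) fun q hq => ?_)
    ext i
    simp only [reduced, fullSolution_add_two]
    exact mul_div_cancel_right₀ _ (N.scale_ne_zero _ q (hVW hq))

/-- A vanishing jet forces the u_i to vanish near p by uniqueness of parallel sections, and λ₁, λ₂
are combinations of the u_i. -/
theorem germJet_injective {k : ℕ} (hk : k + 1 = d - 2) (hp : p ∈ W.domain) :
    Function.Injective (N.germJet k hp) := by
  rw [injective_iff_map_eq_zero]
  intro g hg
  obtain ⟨lam, hl, V, hV, hpV, hVW, h⟩ := exists_representative hp g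
  rw [germJet_apply hp hl] at hg
  have h0 := (isSolutionOn_reduced hV hVW h).eventually_eq_zero hk hV hVW hpV hg
  refine Subtype.ext ?_
  rw [← hl]
  refine Germ.coe_eq.2 ?_
  filter_upwards [h0, hV.mem_nhds hpV] with q hq hqV
  obtain ⟨e0, e1⟩ := (h.normalized hV hVW (N := N)).eq_sum hVW hqV
  have hz : ∀ i : Fin (d - 2), lam q ⟨i + 2, by omega⟩ / N.scale ⟨i + 2, by omega⟩ q = 0 :=
    fun i => congrFun hq i
  simp only [hz, mul_zero, Finset.sum_const_zero] at e0 e1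
  ext ⟨j, hj⟩
  have key : lam q ⟨j, hj⟩ / N.scale ⟨j, hj⟩ q = 0 := by
    rcases j with _ | _ | j
    · exact e0
    · exact e1
    · exact hz ⟨j, by omega⟩
  exact (div_eq_zero_iff.1 key).resolve_right (N.scale_ne_zero _ q (hVW hqV))

theorem range_germJet_le {k : ℕ} (hp : p ∈ W.domain) : LinearMap.range (N.germJet k hp) ≤
    LinearMap.ker (N.system.prolongedEqn k p).toLinearMap := by
  intro θ hθ
  obtain ⟨V, hV, hpV, hVW, u, hu, rfl⟩ := (mem_range_germJet hp).1 hθ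
  exact hu.prolongedEqn_jet hV hVW hpV

theorem rankAt_eq {k : ℕ} (hk : k + 1 = d - 2) (hp : p ∈ W.domain) :
    W.rankAt p = (Module.finrank ℝ (LinearMap.range (N.germJet k hp)) : Cardinal) := by
  rw [rankAt, (LinearEquiv.ofInjective _ (germJet_injective (N := N) hk hp)).rank_eq,
    Module.finrank_eq_rank]

end Normalization

end PlanarWeb

theorem sum_range_sub_eq {d : ℕ} (hd : 3 ≤ d) :
    ∑ j ∈ Finset.range (d - 3 + 1), (d - 2 - j) = (d - 1) * (d - 2) / 2 := by
  obtain ⟨m, rfl⟩ := Nat.exists_eq_add_of_le' hd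
  have h := Finset.sum_range_id_mul_two (m + 2)
  rw [← Finset.sum_range_reflect, Finset.sum_range_succ] at h
  have e : ∑ j ∈ Finset.range (m + 1), (m + 2 - 1 - j) =
      ∑ j ∈ Finset.range (m + 3 - 3 + 1), (m + 3 - 2 - j) := by simp
  rw [← e, show (m + 3 - 1) * (m + 3 - 2) = (m + 2) * (m + 2 - 1) by simp, ← h]
  simp

/-! ### Assembly: the tower, the connection, the rank bound and the criterion for maximum rank. -/

namespace PlanarWeb.Normalization

variable {d : ℕ} {W : PlanarWeb d} {hd : 3 ≤ d} (N : W.Normalization hd) {p : Plane}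

theorem finrank_prolongation {k : ℕ} (hk : k ≤ d - 2) (hp : p ∈ W.domain) :
    Module.finrank ℝ (N.prolongation k p) = ∑ j ∈ Finset.range (k + 1), (d - 2 - j) := by
  rw [N.prolongation_eq_ker k hp]
  exact N.system.finrank_ker_prolongedEqn hk hp

theorem isSmoothSubbundle_prolongation {k : ℕ} (hk : k ≤ d - 2) :
    IsSmoothSubbundle W.domain (N.prolongation k) (∑ j ∈ Finset.range (k + 1), (d - 2 - j)) :=
  isSmoothSubbundle_ker W.isOpen (N.system.prolongedEqn_smooth k)
    (fun _ hp => N.system.prolongedEqn_surjective hk hp) (fun _ hp => N.prolongation_eq_ker k hp)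
    fun _ hp => N.finrank_prolongation hk hp

theorem map_jetProj_prolongation {k : ℕ} (hk : k + 1 ≤ d - 2) (hp : p ∈ W.domain) :
    (N.prolongation (k + 1) p).map (jetProj (Nat.le_succ k)) = N.prolongation k p := by
  rw [N.prolongation_eq_ker _ hp, N.prolongation_eq_ker _ hp]
  exact N.system.map_jetProj_ker hk hp

theorem finrank_prolongation_inf_ker {k : ℕ} (hk : k + 1 ≤ d - 2) (hp : p ∈ W.domain) :
    Module.finrank ℝ ↥(N.prolongation (k + 1) p ⊓ LinearMap.ker (jetProj (Nat.le_succ k))) =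
      d - (k + 1) - 2 := by
  rw [N.prolongation_eq_ker _ hp]
  exact (N.system.finrank_ker_inf_ker hk hp).trans (by omega)

theorem bijOn_jetProj_prolongation (h : d - 3 ≤ d - 2) (hp : p ∈ W.domain) :
    Set.BijOn (jetProj (r := d - 2) h) (N.prolongation (d - 2) p) (N.prolongation (d - 3) p) := by
  rw [N.prolongation_eq_ker _ hp, N.prolongation_eq_ker _ hp]
  exact N.system.bijOn_jetProj_ker (by omega) h hp

/-- On 𝔄_{d-3} the set-theoretic inverse of the projection agrees with the smooth lift, so the
general result applies; elsewhere the two may differ. -/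
theorem isLinearConnection_cartan :
    IsLinearConnection W.domain (N.prolongation (d - 3)) N.cartan := by
  refine N.system.isLinearConnection (by omega) (fun p hp => N.prolongation_eq_ker _ hp)
    fun s p hp hs v => ?_
  have hsurj := (N.bijOn_jetProj_prolongation (by omega) hp).surjOn hs
  have hmem : N.lift p (s p) ∈ N.prolongation (d - 2) p := Function.invFunOn_mem hsurj
  have hproj : jetProj (by omega) (N.lift p (s p)) = s p := Function.invFunOn_eq hsurj
  rw [N.prolongation_eq_ker _ hp] at hmem
  rw [cartan, N.system.jetContract_eq_connForm (by omega) _ (by omega) hp hmem, hproj]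

theorem rankAt_le (N : W.Normalization hd) (hp : p ∈ W.domain) :
    W.rankAt p ≤ (((d - 1) * (d - 2) / 2 : ℕ) : Cardinal) := by
  rw [rankAt_eq (N := N) (k := d - 3) (by omega) hp, ← sum_range_sub_eq hd,
    ← N.finrank_prolongation (by omega) hp, N.prolongation_eq_ker _ hp]
  exact Nat.cast_le.2 (Submodule.finrank_mono (range_germJet_le hp))

theorem rankAt_eq_iff (hp : p ∈ W.domain) :
    W.rankAt p = (((d - 1) * (d - 2) / 2 : ℕ) : Cardinal) ↔
      LinearMap.range (N.germJet (d - 3) hp) = N.prolongation (d - 3) p := by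
  rw [rankAt_eq (N := N) (k := d - 3) (by omega) hp, ← sum_range_sub_eq hd,
    ← N.finrank_prolongation (by omega) hp, N.prolongation_eq_ker _ hp, Nat.cast_inj]
  exact ⟨Submodule.eq_of_le_of_finrank_eq (range_germJet_le hp), fun h => by rw [h]⟩

/-- The obstruction vanishes on the jets at `p` of local solutions. -/
theorem obstruction_jet_eq_zero {obs : Jet (d - 2) (d - 2) →ₗ[ℝ] ℝ} (hp : p ∈ W.domain)
    (hobs : ∀ u : Plane → Fin (d - 2) → ℝ, ContDiff ℝ ∞ u →
      obs (jet (d - 2) p u) = N.obstruction u p)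
    {V : Set Plane} (hV : IsOpen V) (hVW : V ⊆ W.domain) (hpV : p ∈ V)
    {u : Plane → Fin (d - 2) → ℝ} (hu : N.system.IsSolutionOn V u) :
    obs (jet (d - 2) p u) = 0 := by
  -- The solution u is only local, so ϰ is evaluated on a globally smooth v with the same (d -
  -- 1)-jet at p; that order suffices to make ϰ vanish.
  obtain ⟨v, hv, hvu⟩ := exists_jet_eq p (jet (d - 2 + 1) p u)
  have h : jet (d - 2) p v = jet (d - 2) p u := by
    rw [← jetProj_jet (Nat.le_succ (d - 2)), hvu, jetProj_jet]
  rw [← h, hobs v hv]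
  refine N.obstruction_eq_zero_of_prolongedEqn hv hp ?_
  rw [hvu]
  exact hu.prolongedEqn_jet hV hVW hpV

/-- Maximum rank means that every element of 𝔄_{d-3} is the jet of a solution; as the last
projection is injective, the same holds for 𝔄_{d-2}, and ϰ vanishes on solutions. Conversely, if ϰ
vanishes on 𝔄_{d-2} at all points, the next prolongation is onto everywhere, the connection is flat
on 𝔄_{d-3}, and all its elements are jets of solutions. -/
theorem isOfMaximumRank_iff {obs : Plane → Jet (d - 2) (d - 2) →ₗ[ℝ] ℝ}
    (hobs : ∀ p ∈ W.domain, ∀ u : Plane → Fin (d - 2) → ℝ, ContDiff ℝ ∞ u →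
      obs p (jet (d - 2) p u) = N.obstruction u p) :
    W.IsOfMaximumRank ↔ ∀ p ∈ W.domain, ∀ θ ∈ N.prolongation (d - 2) p, obs p θ = 0 := by
  have hle : d - 3 ≤ d - 2 := by omega
  refine ⟨fun h p hp θ hθ => ?_, fun h p hp => ?_⟩
  · have hb := N.bijOn_jetProj_prolongation hle hp
    have hmem : jetProj hle θ ∈ LinearMap.range (N.germJet (d - 3) hp) := by
      rw [(N.rankAt_eq_iff hp).1 (h p hp)]
      exact hb.mapsTo hθ
    obtain ⟨V, hV, hpV, hVW, u, hu, hju⟩ := (mem_range_germJet hp).1 hmem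
    have hjet : jet (d - 2) p u ∈ N.prolongation (d - 2) p := by
      rw [N.prolongation_eq_ker _ hp]
      exact hu.prolongedEqn_jet hV hVW hpV
    have hθu : jet (d - 2) p u = θ := hb.injOn hjet hθ ((jetProj_jet hle p u).trans hju)
    rw [← hθu]
    exact N.obstruction_jet_eq_zero hp (hobs p hp) hV hVW hpV hu
  · refine (N.rankAt_eq_iff hp).2 (le_antisymm ?_ fun θ hθ => (mem_range_germJet hp).2 ?_)
    · rw [N.prolongation_eq_ker _ hp]
      exact range_germJet_le hp
    rw [N.prolongation_eq_ker _ hp] at hθ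
    refine N.system.exists_solution_of_lift (by omega) (fun q hq η hη => ?_) hp hθ
    obtain ⟨u, hu, rfl⟩ := exists_jet_eq q η
    refine N.system.exists_lift_of_symbolObstruction (by omega) hq hu hη ?_
    rw [← N.obstruction_eq_symbolObstruction hu hq hη, ← hobs q hq u hu]
    refine h q hq _ ?_
    rw [N.prolongation_eq_ker _ hq]
    exact hη

end PlanarWeb.Normalization

end Web

end

theorem theorem1 {d : ℕ} (hd : 3 ≤ d) (W : PlanarWeb d) :
    -- the normalization always exists, and what follows holds for every choice of it
    Nonempty (W.Normalization hd) ∧ ∀ N : W.Normalization hd,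
      -- the tower of vector bundles
      (∀ k ≤ d - 2, IsSmoothSubbundle W.domain (N.prolongation k)
        (∑ j ∈ Finset.range (k + 1), (d - 2 - j))) ∧
      (∀ k, k + 1 ≤ d - 2 → ∀ p ∈ W.domain,
        (N.prolongation (k + 1) p).map (jetProj (Nat.le_succ k)) = N.prolongation k p ∧
        Module.finrank ℝ ↥(N.prolongation (k + 1) p ⊓ LinearMap.ker (jetProj (Nat.le_succ k))) =
          d - (k + 1) - 2) ∧
      -- the last projection is an isomorphism, and it is a linear connection
      (∀ p ∈ W.domain, Set.BijOn
        (jetProj (r := d - 2) (Nat.sub_le_sub_left (show 2 ≤ 3 by omega) d)) (N.prolongation (d - 2) p)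
        (N.prolongation (d - 3) p)) ∧
      IsLinearConnection W.domain (N.prolongation (d - 3)) N.cartan ∧
      (∀ p ∈ W.domain,
        Module.finrank ℝ (N.prolongation (d - 3) p) = (d - 1) * (d - 2) / 2) ∧
      -- the bound for the rank
      (∀ p ∈ W.domain, W.rankAt p ≤ (((d - 1) * (d - 2) / 2 : ℕ) : Cardinal)) ∧
      -- the obstruction is a linear function on jets of order `d - 2`, and its vanishing
      -- on the last bundle of the tower is the condition for maximum rank
      ∃ obs : Plane → Jet (d - 2) (d - 2) →ₗ[ℝ] ℝ,
        (∀ p ∈ W.domain, ∀ u : Plane → Fin (d - 2) → ℝ, ContDiff ℝ ∞ u →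
          obs p (jet (d - 2) p u) = N.obstruction u p) ∧
        (W.IsOfMaximumRank ↔ ∀ p ∈ W.domain, ∀ θ ∈ N.prolongation (d - 2) p, obs p θ = 0) := by
  refine ⟨W.nonempty_normalization hd, fun N => ⟨fun k hk => N.isSmoothSubbundle_prolongation hk,
    fun k hk p hp => ⟨N.map_jetProj_prolongation hk hp, N.finrank_prolongation_inf_ker hk hp⟩,
    fun p hp => N.bijOn_jetProj_prolongation _ hp, N.isLinearConnection_cartan, fun p hp => ?_,
    fun p hp => N.rankAt_le hp, ?_⟩⟩
  · rw [N.finrank_prolongation (by omega) hp, sum_range_sub_eq hd]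
  · obtain ⟨obs, hobs⟩ := N.exists_obstruction_jet
    exact ⟨obs, hobs, N.isOfMaximumRank_iff hobs⟩
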